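/- **Theorem (Classification of homogeneous Lagrangian Engel structures).** A *Lagrangian Engel structure* on a smooth 4-manifold $M$ is a symplectic form $\Omega$ together with a smooth rank-2 subbundle $I\subset T^*M$ such that $D=I^\perp\subset TM$ is an Engel 2-plane field (the first derived system $I^{(1)}$ has rank 1 and $I^{(2)}=0$, where $I^{(1)}$ is the kernel of $\delta\colon I\to\Lambda^2(T^*M/I)$, $\delta\eta\equiv d\eta \bmod I$, and $I^{(2)}=(I^{(1)})^{(1)}$) and $D$ is Lagrangian for $\Omega$. It is *homogeneous* if the group of diffeomorphisms of $M$ preserving $\Omega$ and $I$ acts transitively on $M$. It *has a compact quotient* if there are a compact 4-manifold $N$ with a Lagrangian Engel structure and a surjective local diffeomorphism $\pi\colon M\to N$ that pulls the structure of $N$ back to that of $M$ and whose fibres are the orbits of the group of symmetries $\varphi$ of $M$ with $\pi\circ\varphi=\pi$. A smooth global coframing $(\omega_1,\omega_2,\omega_3,\omega_4)$ is *0-adapted* if $\Omega=\omega_1\wedge\omega_3+\omega_2\wedge\omega_4$, $I=\langle\omega_1,\omega_2\rangle$ and $I^{(1)}=\langle\omega_1\rangle$. Write $\omega_{ij}=\omega_i\wedge\omega_j$.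 (i) There are at most six families of homogeneous Lagrangian Engel structures that can have compact quotients: if a homogeneous Lagrangian Engel structure on a smooth (Hausdorff, second countable) 4-manifold $M$ has a compact quotient, then $M$ carries a 0-adapted coframing that satisfies, for some real constants $a,b$, the structure equations of one of the following cases. * Case 1: $d\omega_1=\omega_{23}+a\,\omega_{13}$, $d\omega_2=\omega_{34}$, $d\omega_3=0$, $d\omega_4=b\,\omega_{23}$. * Case 2: $d\omega_1=\omega_{23}+a\,\omega_{13}+b\,\omega_{14}$, $d\omega_2=b\,\omega_{13}+\omega_{34}+b\,\omega_{24}$, $d\omega_3=0$, $d\omega_4=0$. * Case 3: $d\omega_1=\omega_{23}+a\,\omega_{13}-\tfrac14a^2\omega_{14}$, $d\omega_2=-\tfrac14a^2\omega_{13}+\omega_{34}-\tfrac14a^2\omega_{24}$, $d\omega_3=\tfrac12a^2b(\omega_{13}-\omega_{24})+ab\,\omega_{23}-\tfrac14a^3b\,\omega_{14}$, $d\omega_4=ab(\omega_{13}-\omega_{24})+2b\,\omega_{23}-\tfrac12a^2b\,\omega_{14}$. * Case 4: $d\omega_1=\omega_{23}+b\,\omega_{13}+a\,\omega_{14}$,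 $d\omega_2=(a^2+\tfrac14ab^2)\omega_{12}+a\,\omega_{13}+\omega_{34}+a\,\omega_{24}$, $d\omega_3=(2a^3+\tfrac12a^2b^2)\omega_{12}+\tfrac12ab^2\omega_{13}+ab\,\omega_{23}+a^2b\,\omega_{14}+2a^2\omega_{24}$, $d\omega_4=ab(-a-\tfrac14b^2)\omega_{12}+ab\,\omega_{13}+(a-\tfrac14b^2)\omega_{23}+(a^2-\tfrac14ab^2)\omega_{14}-ab\,\omega_{24}$. * Case 5: $d\omega_1=\omega_{13}+\omega_{24}$, $d\omega_2=a\,\omega_{12}+\omega_{34}$, $d\omega_3=a(\omega_{13}+\omega_{24})$, $d\omega_4=-a\,\omega_{12}-\omega_{34}$. * Case 6: $d\omega_1=\omega_{13}+\omega_{24}$, $d\omega_2=\omega_{34}$, $d\omega_3=0$, $d\omega_4=a\,\omega_{23}-\omega_{34}$. (ii) In each case and for all real $a,b$, the equations are consistent: they are the equations of the left-invariant 1-forms dual to a basis of a 4-dimensional real Lie algebra. Moreover, every smooth coframing on a 4-manifold that satisfies them is 0-adapted to a Lagrangian Engel structure on that manifold. -/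

import Mathlib

open scoped Manifold ContDiff Topology

universe u

/-- The model space `ℝ⁴`. -/
abbrev E4 : Type := EuclideanSpace ℝ (Fin 4)

noncomputable section

namespace LagEngel

/-! ### Differential forms on a smooth 4-manifold -/

section Forms

variable (M : Type u) [TopologicalSpace M] [ChartedSpace E4 M]

/-- A (not necessarily smooth) differential `n`-form on `M`. -/
abbrev Form (n : ℕ) : Type u :=
  ∀ x : M, TangentSpace 𝓘(ℝ, E4) x [⋀^Fin n]→L[ℝ] ℝ

/-- A (not necessarily smooth) field of covectors on `M`. -/
abbrev CovectorField : Type u :=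
  ∀ x : M, TangentSpace 𝓘(ℝ, E4) x →L[ℝ] ℝ

/-- A field of subspaces of the cotangent spaces of `M`. -/
abbrev PfaffianSystem : Type u :=
  ∀ x : M, Submodule ℝ (TangentSpace 𝓘(ℝ, E4) x →L[ℝ] ℝ)

end Forms

section Calculus

variable {M : Type u} [TopologicalSpace M] [ChartedSpace E4 M]

/-- The coordinate expression of a form in the chart of `M` centred at `x₀`: its pullback under
the inverse of the chart (meaningful on the target of the chart). -/
def Form.inChart {n : ℕ} (η : Form M n) (x₀ : M) : E4 → E4 [⋀^Fin n]→L[ℝ] ℝ := fun y =>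
  (η ((extChartAt 𝓘(ℝ, E4) x₀).symm y)).compContinuousLinearMap
    (mfderiv 𝓘(ℝ, E4) 𝓘(ℝ, E4) (extChartAt 𝓘(ℝ, E4) x₀).symm y)

/-- The form is smooth on the set `U` (used for open `U`): all its coordinate expressions are. -/
def Form.SmoothOn {n : ℕ} (η : Form M n) (U : Set M) : Prop :=
  ∀ x₀ : M, ContDiffOn ℝ ∞ (η.inChart x₀)
    ((extChartAt 𝓘(ℝ, E4) x₀).target ∩ (extChartAt 𝓘(ℝ, E4) x₀).symm ⁻¹' U)

/-- The exterior derivative, computed at `x` in the chart centred at `x`. -/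
def Form.d {n : ℕ} (η : Form M n) : Form M (n + 1) := fun x =>
  (extDeriv (η.inChart x) (extChartAt 𝓘(ℝ, E4) x x)).compContinuousLinearMap
    (mfderiv 𝓘(ℝ, E4) 𝓘(ℝ, E4) (extChartAt 𝓘(ℝ, E4) x) x)

/-- A covector field regarded as a 1-form. -/
def CovectorField.toForm (α : CovectorField M) : Form M 1 := fun x =>
  ContinuousAlternatingMap.ofSubsingleton ℝ (TangentSpace 𝓘(ℝ, E4) x) ℝ (0 : Fin 1) (α x)

/-- The exterior derivative of a 1-form. -/
def CovectorField.d (α : CovectorField M) : Form M 2 := α.toForm.d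

/-- The wedge product of two covectors, `(α ∧ β)(v, w) = α v * β w - α w * β v`. -/
def wedge {V : Type*} [AddCommGroup V] [Module ℝ V] [TopologicalSpace V]
    (α β : V →L[ℝ] ℝ) : V [⋀^Fin 2]→L[ℝ] ℝ :=
  ContinuousMultilinearMap.alternatization
    ((ContinuousMultilinearMap.mkPiAlgebra ℝ (Fin 2) ℝ).compContinuousLinearMap ![α, β])

theorem wedge_apply {V : Type*} [AddCommGroup V] [Module ℝ V] [TopologicalSpace V]
    (α β : V →L[ℝ] ℝ) (v w : V) : wedge α β ![v, w] = α v * β w - α w * β v := by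
  have h : (Finset.univ : Finset (Equiv.Perm (Fin 2))) = {1, Equiv.swap 0 1} := by decide
  rw [wedge, ContinuousMultilinearMap.alternatization_apply_apply, h,
    Finset.sum_insert (by decide), Finset.sum_singleton]
  simp [sub_eq_add_neg]

/-! ### Pfaffian systems and Engel structures -/

/-- The annihilator `D = I^⊥ ⊆ TM` of a Pfaffian system. -/
def PfaffianSystem.perp (I : PfaffianSystem M) (x : M) :
    Submodule ℝ (TangentSpace 𝓘(ℝ, E4) x) where
  carrier := {v | ∀ α ∈ I x, α v = 0}
  zero_mem' := fun α _ => map_zero α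
  add_mem' := fun hv hw α hα => by rw [map_add, hv α hα, hw α hα, add_zero]
  smul_mem' := fun c v hv α hα => by rw [map_smul, hv α hα, smul_zero]

/-- `I` is a smooth subbundle of rank `r` of the cotangent bundle: near each point it is spanned by
`r` smooth pointwise linearly independent 1-forms. -/
def PfaffianSystem.IsSubbundle (I : PfaffianSystem M) (r : ℕ) : Prop :=
  ∀ x : M, ∃ U : Set M, IsOpen U ∧ x ∈ U ∧ ∃ η : Fin r → CovectorField M,
    (∀ i, (η i).toForm.SmoothOn U) ∧
    ∀ y ∈ U, LinearIndependent ℝ (fun i => η i y) ∧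
      I y = Submodule.span ℝ (Set.range fun i => η i y)

/-- The derived system `I⁽¹⁾ = ker δ`, where `δ : I → Λ²(T^*M/I)` is `δη ≡ dη mod I`: the values
at `x` of the local smooth sections `η` of `I` such that `dη` at `x` vanishes on `I^⊥`. (These
values form a subspace as soon as `I` is a smooth subbundle.) -/
def PfaffianSystem.derived (I : PfaffianSystem M) : PfaffianSystem M := fun x =>
  Submodule.span ℝ {α | ∃ U : Set M, IsOpen U ∧ x ∈ U ∧ ∃ η : CovectorField M,
    η.toForm.SmoothOn U ∧ (∀ y ∈ U, η y ∈ I y) ∧ η x = α ∧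
    ∀ v ∈ I.perp x, ∀ w ∈ I.perp x, η.d x ![v, w] = 0}

/-- `D = I^⊥` is an Engel structure: `I` has rank 2, `I⁽¹⁾` has rank 1 and `I⁽²⁾ = 0`. -/
structure PfaffianSystem.IsEngel (I : PfaffianSystem M) : Prop where
  rank_two : I.IsSubbundle 2
  derived_rank_one : I.derived.IsSubbundle 1
  derived_derived : ∀ x, I.derived.derived x = ⊥

/-- `Ω` is a symplectic form: a smooth closed nondegenerate 2-form. -/
structure Form.IsSymplectic (Ω : Form M 2) : Prop where
  smooth : Ω.SmoothOn Set.univ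
  closed : ∀ x, Ω.d x = 0
  nondegenerate : ∀ (x : M) (v : TangentSpace 𝓘(ℝ, E4) x), (∀ w, Ω x ![v, w] = 0) → v = 0

end Calculus

/-! ### Lagrangian Engel structures -/

/-- A Lagrangian Engel structure on `M`: a symplectic form `Ω` together with an Engel 2-plane field
`D = I^⊥` that is Lagrangian for `Ω`. -/
structure LagrangianEngel (M : Type u) [TopologicalSpace M] [ChartedSpace E4 M] where
  Ω : Form M 2
  I : PfaffianSystem M
  symplectic : Ω.IsSymplectic
  engel : I.IsEngel
  lagrangian : ∀ x, ∀ v ∈ I.perp x, ∀ w ∈ I.perp x, Ω x ![v, w] = 0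

section Structures

variable {M : Type u} [TopologicalSpace M] [ChartedSpace E4 M]

/-- `f` pulls the Lagrangian Engel structure `S'` back to `S` (used for local
diffeomorphisms `f`). -/
def Preserves {M' : Type u} [TopologicalSpace M'] [ChartedSpace E4 M']
    (S : LagrangianEngel M) (S' : LagrangianEngel M') (f : M → M') : Prop :=
  (∀ x, (S'.Ω (f x)).compContinuousLinearMap (mfderiv 𝓘(ℝ, E4) 𝓘(ℝ, E4) f x) = S.Ω x) ∧
  ∀ (x : M) (α : TangentSpace 𝓘(ℝ, E4) (f x) →L[ℝ] ℝ),
    α ∈ S'.I (f x) ↔ α.comp (mfderiv 𝓘(ℝ, E4) 𝓘(ℝ, E4) f x) ∈ S.I x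

/-- The group of symmetries (diffeomorphisms preserving the structure) acts transitively. -/
def LagrangianEngel.IsHomogeneous (S : LagrangianEngel M) : Prop :=
  ∀ x y : M, ∃ φ : M ≃ₘ⟮𝓘(ℝ, E4), 𝓘(ℝ, E4)⟯ M, Preserves S S φ ∧ φ x = y

/-- `S` has a compact quotient manifold: there are a compact 4-manifold `N` with a Lagrangian Engel
structure and a surjective local diffeomorphism `π : M → N` pulling that structure back to `S`,
whose fibres are the orbits of the group of those symmetries `φ` of `S` for which `π ∘ φ = π`. -/
def LagrangianEngel.HasCompactQuotient (S : LagrangianEngel M) : Prop :=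
  ∃ (N : Type u) (_ : TopologicalSpace N) (_ : ChartedSpace E4 N)
    (_ : IsManifold 𝓘(ℝ, E4) ∞ N) (_ : T2Space N) (_ : CompactSpace N)
    (S' : LagrangianEngel N) (π : M → N),
    IsLocalDiffeomorph 𝓘(ℝ, E4) 𝓘(ℝ, E4) ∞ π ∧ Function.Surjective π ∧ Preserves S S' π ∧
    ∀ x y : M, π x = π y → ∃ φ : M ≃ₘ⟮𝓘(ℝ, E4), 𝓘(ℝ, E4)⟯ M,
      Preserves S S φ ∧ (∀ z, π (φ z) = π z) ∧ φ x = y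

/-- A smooth global coframing `(θ₁, θ₂, θ₃, θ₄)`, indexed by `0, 1, 2, 3`. -/
structure IsCoframing (θ : Fin 4 → CovectorField M) : Prop where
  smooth : ∀ i, (θ i).toForm.SmoothOn Set.univ
  linearIndependent : ∀ x, LinearIndependent ℝ (fun i => θ i x)

/-- The coframing is 0-adapted to the structure: `Ω = θ₁ ∧ θ₃ + θ₂ ∧ θ₄`, `I = ⟨θ₁, θ₂⟩` and
`I⁽¹⁾ = ⟨θ₁⟩`. -/
structure LagrangianEngel.IsZeroAdapted (S : LagrangianEngel M)
    (θ : Fin 4 → CovectorField M) : Prop where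
  coframing : IsCoframing θ
  symplectic : ∀ x, S.Ω x = wedge (θ 0 x) (θ 2 x) + wedge (θ 1 x) (θ 3 x)
  system : ∀ x, S.I x = Submodule.span ℝ {θ 0 x, θ 1 x}
  derived : ∀ x, S.I.derived x = Submodule.span ℝ {θ 0 x}

end Structures

/-! ### Structure equations with constant coefficients -/

/-- The ordered list `12, 13, 14, 23, 24, 34` of pairs of indices (shifted to start from `0`). -/
def pair : Fin 6 → Fin 4 × Fin 4 := ![(0, 1), (0, 2), (0, 3), (1, 2), (1, 3), (2, 3)]

/-- The structure equations `dθ = C (θ₁₂, θ₁₃, θ₁₄, θ₂₃, θ₂₄, θ₃₄)ᵀ`, with `θᵢⱼ = θᵢ ∧ θⱼ`. -/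
def SatisfiesStructureEq {M : Type u} [TopologicalSpace M] [ChartedSpace E4 M]
    (θ : Fin 4 → CovectorField M) (C : Matrix (Fin 4) (Fin 6) ℝ) : Prop :=
  ∀ (i : Fin 4) (x : M),
    (θ i).d x = ∑ p : Fin 6, C i p • wedge (θ (pair p).1 x) (θ (pair p).2 x)

/-- The constants `C` are those of a 4-dimensional real Lie algebra: for the dual basis `(eᵢ)` of
left-invariant vector fields, `dθᵢ(e_j, e_k) = -θᵢ([e_j, e_k])`. -/
def IsLieAlgebraStructure (C : Matrix (Fin 4) (Fin 6) ℝ) : Prop :=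
  ∃ (L : Type) (_ : LieRing L) (_ : LieAlgebra ℝ L) (e : Module.Basis (Fin 4) ℝ L),
    ∀ (i : Fin 4) (p : Fin 6), e.repr ⁅e (pair p).1, e (pair p).2⁆ i = -C i p

/-- The coefficients of the six families of structure equations; the rows are `dθ₁, …, dθ₄` and the
columns are `θ₁₂, θ₁₃, θ₁₄, θ₂₃, θ₂₄, θ₃₄`. -/
def family (a b : ℝ) : Fin 6 → Matrix (Fin 4) (Fin 6) ℝ :=
  ![ -- Case 1
    !![0, a, 0, 1, 0, 0;
       0, 0, 0, 0, 0, 1;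
       0, 0, 0, 0, 0, 0;
       0, 0, 0, b, 0, 0],
    -- Case 2
    !![0, a, b, 1, 0, 0;
       0, b, 0, 0, b, 1;
       0, 0, 0, 0, 0, 0;
       0, 0, 0, 0, 0, 0],
    -- Case 3
    !![0, a, -(a ^ 2 / 4), 1, 0, 0;
       0, -(a ^ 2 / 4), 0, 0, -(a ^ 2 / 4), 1;
       0, a ^ 2 * b / 2, -(a ^ 3 * b / 4), a * b, -(a ^ 2 * b / 2), 0;
       0, a * b, -(a ^ 2 * b / 2), 2 * b, -(a * b), 0],
    -- Case 4
    !![0, b, a, 1, 0, 0;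
       a ^ 2 + a * b ^ 2 / 4, a, 0, 0, a, 1;
       2 * a ^ 3 + a ^ 2 * b ^ 2 / 2, a * b ^ 2 / 2, a ^ 2 * b, a * b, 2 * a ^ 2, 0;
       a * b * (-a - b ^ 2 / 4), a * b, a ^ 2 - a * b ^ 2 / 4, a - b ^ 2 / 4, -(a * b), 0],
    -- Case 5
    !![0, 1, 0, 0, 1, 0;
       a, 0, 0, 0, 0, 1;
       0, a, 0, 0, a, 0;
       -a, 0, 0, 0, 0, -1],
    -- Case 6
    !![0, 1, 0, 0, 1, 0;
       0, 0, 0, 0, 0, 1;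
       0, 0, 0, 0, 0, 0;
       0, 0, 0, a, 0, -1] ]

end LagEngel

end

open scoped Manifold ContDiff Topology

universe v w

noncomputable section

namespace LagEngel

/-! ### Pullback and naturality of the exterior derivative -/

/-! Indices run from 0 to 3 as in the code, `e` is the frame dual to `θ`, and c^i_jk = dθ_i(e_j,
e_k).

Compactness enters through one principle (`exists_d_mul_eq_zero`, from Stokes): on a nonempty
compact 4-manifold the product of an exact 2-form with a closed 2-form cannot be a volume form, so
it vanishes somewhere. If its coefficient in a global coframe is constant, it vanishes identically.
Homogeneity of M makes the quotient N locally homogeneous (`IsHomogeneous.quotient`), so the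
principle applies to invariantly defined forms on N.

Two 0-adapted coframes are related by θ₀' = aθ₀, θ₁' = kθ₀ + mθ₁ and corresponding changes of θ₂,
θ₃. With A = c^0_12, B = c^0_13, C = c^1_23, `structFun_change` gives mA' = a²A, mB' = a(kA + mB),
C' = m²aC. The Engel conditions say that C ≠ 0 and that A, B are not both zero.

Vanishing of A everywhere is impossible on N (`exists_generic`): normalising B = 1 would determine
θ₀ globally; dθ₀ ∧ Ω must vanish somewhere, which forces c^0_02 = -1 there and hence, by
homogeneity, everywhere; but then dθ₀ ∧ dθ₀ never vanishes.

So A ≠ 0 at some point and, by homogeneity, everywhere. The normalisation A = 1, B = 0, C = 1 fixes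
θ₀ and θ₁, with a the real number such that a⁵A²C = 1. The remaining freedom is a symmetric shear of
θ₂, θ₃ by θ₀, θ₁, removed by three further linear conditions (`IsNormalAt`). The resulting coframe
is unique, hence global and preserved by local symmetries, and its structure functions are constant.

Now dθ_i ∧ Ω = 0 and dθ_i ∧ dθ_j = 0 for all i, j. Together with dΩ = 0 and the normalisation these
kill every coefficient except c^0_12 = c^1_23 = 1 and one free constant b = c^3_12. This is Case 1
with a = 0, and it pulls back to M. Thus a sharper conclusion than the disjunction of six cases is
obtained in part (i).

Part (ii) is a verification: the Jacobi identity and the closedness of θ₀ ∧ θ₂ + θ₁ ∧ θ₃ are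
polynomial identities in a, b, and the Engel conditions are read off from coefficients equal to 0 or
1. -/

theorem minSmoothness_two_le_infty : minSmoothness ℝ 2 ≤ ∞ := by
  rw [minSmoothness_of_isRCLikeNormedField]
  exact WithTop.coe_le_coe.2 (le_top : (2 : ℕ∞) ≤ ⊤)

section Pull

variable {X : Type u} [TopologicalSpace X] [ChartedSpace E4 X]
  {Y : Type v} [TopologicalSpace Y] [ChartedSpace E4 Y]
  {Z : Type w} [TopologicalSpace Z] [ChartedSpace E4 Z] {n : ℕ}

/-- The pullback of a form. -/
def Form.pull (η : Form Y n) (f : X → Y) : Form X n := fun x =>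
  (η (f x)).compContinuousLinearMap (mfderiv 𝓘(ℝ, E4) 𝓘(ℝ, E4) f x)

theorem Form.pull_congr (η : Form Y n) {f g : X → Y} {x : X} (h : f =ᶠ[𝓝 x] g) :
    η.pull f x = η.pull g x := by
  have h1 : mfderiv 𝓘(ℝ, E4) 𝓘(ℝ, E4) f x = mfderiv 𝓘(ℝ, E4) 𝓘(ℝ, E4) g x := h.mfderiv_eq
  have h2 : f x = g x := h.self_of_nhds
  -- Every tangent space is the model `E4`; with these fixed types the equality of base points can
  -- be substituted.
  let η' : Y → E4 [⋀^Fin n]→L[ℝ] ℝ := η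
  let a : E4 →L[ℝ] E4 := mfderiv 𝓘(ℝ, E4) 𝓘(ℝ, E4) f x
  let b : E4 →L[ℝ] E4 := mfderiv 𝓘(ℝ, E4) 𝓘(ℝ, E4) g x
  have h3 : a = b := h1
  change (η' (f x)).compContinuousLinearMap a = (η' (g x)).compContinuousLinearMap b
  rw [h2, h3]

theorem Form.pull_pull (η : Form Z n) {f : X → Y} {g : Y → Z} {x : X}
    (hf : MDifferentiableAt 𝓘(ℝ, E4) 𝓘(ℝ, E4) f x)
    (hg : MDifferentiableAt 𝓘(ℝ, E4) 𝓘(ℝ, E4) g (f x)) :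
    (η.pull g).pull f x = η.pull (g ∘ f) x := by
  unfold Form.pull
  rw [mfderiv_comp x hg hf]
  rfl

theorem Form.inChart_eq_pull (η : Form X n) (x₀ : X) :
    η.inChart x₀ = η.pull (extChartAt 𝓘(ℝ, E4) x₀).symm := rfl

variable [IsManifold 𝓘(ℝ, E4) ∞ X] [IsManifold 𝓘(ℝ, E4) ∞ Y]

theorem contMDiffAt_extChartAt_symm (x₀ : X) {y : E4} (hy : y ∈ (extChartAt 𝓘(ℝ, E4) x₀).target) :
    ContMDiffAt 𝓘(ℝ, E4) 𝓘(ℝ, E4) ∞ (extChartAt 𝓘(ℝ, E4) x₀).symm y :=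
  (contMDiffOn_extChartAt_symm (n := ∞) x₀ y hy).contMDiffAt
    ((isOpen_extChartAt_target x₀).mem_nhds hy)

theorem contMDiffAt_extChartAt_of_mem (x₀ : X) {x : X}
    (hx : x ∈ (extChartAt 𝓘(ℝ, E4) x₀).source) :
    ContMDiffAt 𝓘(ℝ, E4) 𝓘(ℝ, E4) ∞ (extChartAt 𝓘(ℝ, E4) x₀) x :=
  contMDiffAt_extChartAt' (by simpa using hx)

theorem eventually_mdifferentiableAt {f : X → Y} {x : X}
    (hf : ContMDiffAt 𝓘(ℝ, E4) 𝓘(ℝ, E4) ∞ f x) :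
    ∀ᶠ z in 𝓝 x, MDifferentiableAt 𝓘(ℝ, E4) 𝓘(ℝ, E4) f z := by
  have : IsManifold 𝓘(ℝ, E4) 1 X := IsManifold.of_le (n := ∞) (by exact_mod_cast le_top)
  have : IsManifold 𝓘(ℝ, E4) 1 Y := IsManifold.of_le (n := ∞) (by exact_mod_cast le_top)
  have h1 : ContMDiffAt 𝓘(ℝ, E4) 𝓘(ℝ, E4) 1 f x := hf.of_le (by exact_mod_cast le_top)
  filter_upwards [(contMDiffAt_iff_contMDiffAt_nhds (by simp)).1 h1] with z hz
  exact hz.mdifferentiableAt (by simp)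

omit [IsManifold 𝓘(ℝ, E4) ∞ X] in
theorem isOpen_chart_preimage (x₀ : X) {U : Set X} (hU : IsOpen U) :
    IsOpen ((extChartAt 𝓘(ℝ, E4) x₀).target ∩ (extChartAt 𝓘(ℝ, E4) x₀).symm ⁻¹' U) :=
  (continuousOn_extChartAt_symm x₀).isOpen_inter_preimage (isOpen_extChartAt_target x₀) hU

omit [IsManifold 𝓘(ℝ, E4) ∞ X] in
theorem Form.SmoothOn.contDiffAt {η : Form X n} {U : Set X} (hη : η.SmoothOn U) (hU : IsOpen U)
    {x₀ : X} {y : E4} (hy : y ∈ (extChartAt 𝓘(ℝ, E4) x₀).target)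
    (hyU : (extChartAt 𝓘(ℝ, E4) x₀).symm y ∈ U) : ContDiffAt ℝ ∞ (η.inChart x₀) y :=
  (hη x₀).contDiffAt ((isOpen_chart_preimage x₀ hU).mem_nhds ⟨hy, hyU⟩)

/-- Near `y`, the pullback by `h` of a form on `Y` is the pullback of its coordinate expression by
the coordinate expression of `h`. -/
theorem Form.pull_eventuallyEq (η : Form Y n) {h : E4 → Y} {y : E4}
    (hh : ContMDiffAt 𝓘(ℝ, E4) 𝓘(ℝ, E4) ∞ h y) (y₀ : Y)
    (hy : h y ∈ (extChartAt 𝓘(ℝ, E4) y₀).source) :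
    (η.pull h : E4 → E4 [⋀^Fin n]→L[ℝ] ℝ) =ᶠ[𝓝 y] fun z =>
      (η.inChart y₀ (extChartAt 𝓘(ℝ, E4) y₀ (h z))).compContinuousLinearMap
        (fderiv ℝ (extChartAt 𝓘(ℝ, E4) y₀ ∘ h) z) := by
  have h1 := eventually_mdifferentiableAt hh
  have h2 : ∀ᶠ z in 𝓝 y, h z ∈ (extChartAt 𝓘(ℝ, E4) y₀).source :=
    hh.continuousAt.eventually ((isOpen_extChartAt_source y₀).mem_nhds hy)
  filter_upwards [h1, h2, h2.eventually_nhds] with z hz1 hz2 hz3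
  have e1 : h =ᶠ[𝓝 z] (extChartAt 𝓘(ℝ, E4) y₀).symm ∘ (extChartAt 𝓘(ℝ, E4) y₀ ∘ h) := by
    filter_upwards [hz3] with t ht
    exact ((extChartAt 𝓘(ℝ, E4) y₀).left_inv ht).symm
  have hd : MDifferentiableAt 𝓘(ℝ, E4) 𝓘(ℝ, E4) (extChartAt 𝓘(ℝ, E4) y₀ ∘ h) z :=
    ((contMDiffAt_extChartAt_of_mem y₀ hz2).mdifferentiableAt (by simp)).comp z
      hz1
  have hs : MDifferentiableAt 𝓘(ℝ, E4) 𝓘(ℝ, E4) (extChartAt 𝓘(ℝ, E4) y₀).symm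
      ((extChartAt 𝓘(ℝ, E4) y₀ ∘ h) z) :=
    (contMDiffAt_extChartAt_symm y₀ ((extChartAt 𝓘(ℝ, E4) y₀).map_source hz2)).mdifferentiableAt
      (by simp)
  rw [η.pull_congr e1, ← η.pull_pull hd hs, ← Form.inChart_eq_pull]
  simp only [Form.pull, mfderiv_eq_fderiv]
  rfl

/-- By `Form.pull_eventuallyEq`, the pullback factors through the chart centred at `h y`, which is
the chart defining `η.d` at that point. Naturality of `extDeriv` on `ℝ⁴` then applies. -/
theorem extDeriv_pull {η : Form Y n} {V : Set Y} (hη : η.SmoothOn V) (hV : IsOpen V)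
    {h : E4 → Y} {y : E4} (hh : ContMDiffAt 𝓘(ℝ, E4) 𝓘(ℝ, E4) ∞ h y) (hy : h y ∈ V) :
    extDeriv (η.pull h : E4 → E4 [⋀^Fin n]→L[ℝ] ℝ) y = η.d.pull h y := by
  have hm := mem_extChartAt_source (I := 𝓘(ℝ, E4)) (h y)
  rw [(η.pull_eventuallyEq hh (h y) hm).extDeriv_eq]
  have hc : ContMDiffAt 𝓘(ℝ, E4) 𝓘(ℝ, E4) ∞ (extChartAt 𝓘(ℝ, E4) (h y) ∘ h) y :=
    (contMDiffAt_extChartAt_of_mem (h y) hm).comp y hh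
  have hc' : ContDiffAt ℝ ∞ (extChartAt 𝓘(ℝ, E4) (h y) ∘ h) y := hc.contDiffAt
  have hω : DifferentiableAt ℝ (η.inChart (h y)) ((extChartAt 𝓘(ℝ, E4) (h y) ∘ h) y) :=
    (hη.contDiffAt hV ((extChartAt 𝓘(ℝ, E4) (h y)).map_source hm)
      (by simpa [(extChartAt 𝓘(ℝ, E4) (h y)).left_inv hm] using hy)).differentiableAt (by simp)
  rw [show (fun z => (η.inChart (h y) (extChartAt 𝓘(ℝ, E4) (h y) (h z))).compContinuousLinearMap
        (fderiv ℝ (extChartAt 𝓘(ℝ, E4) (h y) ∘ h) z)) =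
      (fun z => (η.inChart (h y) ((extChartAt 𝓘(ℝ, E4) (h y) ∘ h) z)).compContinuousLinearMap
        (fderiv ℝ (extChartAt 𝓘(ℝ, E4) (h y) ∘ h) z)) from rfl,
    extDeriv_pullback hω hc' minSmoothness_two_le_infty]
  unfold Form.pull Form.d
  rw [← mfderiv_eq_fderiv, mfderiv_comp y
    ((contMDiffAt_extChartAt_of_mem (h y) hm).mdifferentiableAt (by simp))
    (hh.mdifferentiableAt (by simp))]
  rfl

/-- The exterior derivative may be computed in any chart. -/
theorem Form.inChart_d {η : Form X n} {U : Set X} (hη : η.SmoothOn U) (hU : IsOpen U)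
    (x₀ : X) {y : E4} (hy : y ∈ (extChartAt 𝓘(ℝ, E4) x₀).target)
    (hyU : (extChartAt 𝓘(ℝ, E4) x₀).symm y ∈ U) :
    η.d.inChart x₀ y = extDeriv (η.inChart x₀) y :=
  (extDeriv_pull hη hU (contMDiffAt_extChartAt_symm x₀ hy) hyU).symm

theorem mfderiv_symm_comp_mfderiv (x₀ : X) {x : X} (hx : x ∈ (extChartAt 𝓘(ℝ, E4) x₀).source)
    (v : TangentSpace 𝓘(ℝ, E4) x) :
    mfderiv 𝓘(ℝ, E4) 𝓘(ℝ, E4) (extChartAt 𝓘(ℝ, E4) x₀).symm (extChartAt 𝓘(ℝ, E4) x₀ x)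
      (mfderiv 𝓘(ℝ, E4) 𝓘(ℝ, E4) (extChartAt 𝓘(ℝ, E4) x₀) x v) = v := by
  have := mfderivWithin_extChartAt_symm_comp_mfderiv_extChartAt' (I := 𝓘(ℝ, E4)) hx
  rw [ModelWithCorners.range_eq_univ, mfderivWithin_univ] at this
  exact congrArg (fun L => L v) this

/-- The exterior derivative commutes with pullback. -/
theorem Form.d_pull {η : Form Y n} {V : Set Y} (hη : η.SmoothOn V) (hV : IsOpen V)
    {f : X → Y} {x : X} (hf : ContMDiffAt 𝓘(ℝ, E4) 𝓘(ℝ, E4) ∞ f x) (hx : f x ∈ V) :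
    (η.pull f).d x = η.d.pull f x := by
  have hm := mem_extChartAt_source (I := 𝓘(ℝ, E4)) x
  have hmt := (extChartAt 𝓘(ℝ, E4) x).map_source hm
  have hl := (extChartAt 𝓘(ℝ, E4) x).left_inv hm
  set φ := extChartAt 𝓘(ℝ, E4) x with hφ
  have hs : ContMDiffAt 𝓘(ℝ, E4) 𝓘(ℝ, E4) ∞ φ.symm (φ x) := contMDiffAt_extChartAt_symm x hmt
  have hf' : ContMDiffAt 𝓘(ℝ, E4) 𝓘(ℝ, E4) ∞ f (φ.symm (φ x)) := by rwa [hl]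
  have hc : ContMDiffAt 𝓘(ℝ, E4) 𝓘(ℝ, E4) ∞ (f ∘ φ.symm) (φ x) := hf'.comp (φ x) hs
  have e : ((η.pull f).inChart x : E4 → E4 [⋀^Fin n]→L[ℝ] ℝ) =ᶠ[𝓝 (φ x)]
      η.pull (f ∘ φ.symm) := by
    have h1 : ∀ᶠ z in 𝓝 (φ x), MDifferentiableAt 𝓘(ℝ, E4) 𝓘(ℝ, E4) f (φ.symm z) :=
      hs.continuousAt.eventually (eventually_mdifferentiableAt hf')
    filter_upwards [h1, (isOpen_extChartAt_target x).mem_nhds hmt] with z hz1 hz2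
    exact η.pull_pull ((contMDiffAt_extChartAt_symm x hz2).mdifferentiableAt (by simp))
      hz1
  have e2 : (f ∘ φ.symm) ∘ φ =ᶠ[𝓝 x] f := by
    filter_upwards [(isOpen_extChartAt_source (I := 𝓘(ℝ, E4)) x).mem_nhds hm] with z hz
    exact congrArg f ((extChartAt 𝓘(ℝ, E4) x).left_inv hz)
  rw [← η.d.pull_congr e2, ← η.d.pull_pull
    ((contMDiffAt_extChartAt_of_mem x hm).mdifferentiableAt (by simp))
    (hc.mdifferentiableAt (by simp))]
  rw [Form.d, e.extDeriv_eq, extDeriv_pull hη hV hc (by simpa [hl] using hx)]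
  rfl

end Pull

/-! ### Coframes and dual frames of a 4-dimensional space -/

section LinearAlgebra

theorem finrank_dual_E4 : Module.finrank ℝ (E4 →L[ℝ] ℝ) = 4 := by
  rw [← (LinearMap.toContinuousLinearMap (𝕜 := ℝ) (E := E4) (F' := ℝ)).finrank_eq,
    Module.finrank_linearMap]
  simp

theorem span_coframe_eq_top {θ : Fin 4 → E4 →L[ℝ] ℝ} (h : LinearIndependent ℝ θ) :
    Submodule.span ℝ (Set.range θ) = ⊤ :=
  have : Nonempty (Fin 4) := ⟨0⟩
  have : FiniteDimensional ℝ (E4 →L[ℝ] ℝ) := .of_finrank_pos (by rw [finrank_dual_E4]; norm_num)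
  h.span_eq_top_of_card_eq_finrank (by rw [finrank_dual_E4]; simp)

/-- A coframe spans the dual space, and covectors separate vectors. -/
theorem coframe_ext {θ : Fin 4 → E4 →L[ℝ] ℝ} (h : LinearIndependent ℝ θ) {v w : E4}
    (hvw : ∀ i, θ i v = θ i w) : v = w := by
  have key : ∀ f : E4 →L[ℝ] ℝ, f v = f w := fun f => by
    have hf : f ∈ Submodule.span ℝ (Set.range θ) := by
      rw [span_coframe_eq_top h]; trivial
    induction hf using Submodule.span_induction with
    | mem x hx => obtain ⟨i, rfl⟩ := hx; exact hvw i
    | zero => simp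
    | add x y _ _ hx hy => simp [hx, hy]
    | smul a x _ hx => simp [hx]
  ext j
  exact key (EuclideanSpace.proj j)

theorem exists_dual_frame {θ : Fin 4 → E4 →L[ℝ] ℝ} (h : LinearIndependent ℝ θ) :
    ∃ e : Fin 4 → E4, ∀ i j, θ i (e j) = if i = j then 1 else 0 := by
  let Φ : E4 →ₗ[ℝ] (Fin 4 → ℝ) := LinearMap.pi fun i => (θ i).toLinearMap
  have hΦ : Function.Injective Φ := fun v w hvw => coframe_ext h fun i => congrFun hvw i
  have hs : Function.Surjective Φ := (LinearMap.injective_iff_surjective_of_finrank_eq_finrank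
    (by simp)).1 hΦ
  choose e he using fun j => hs (Pi.single j 1)
  refine ⟨e, fun i j => ?_⟩
  have := congrFun (he j) i
  simpa [Φ, Pi.single_apply] using this

variable {V : Type*} [AddCommGroup V] [Module ℝ V] [TopologicalSpace V]

theorem linearIndependent_of_dual {θ : Fin 4 → V →L[ℝ] ℝ} {e : Fin 4 → V}
    (h : ∀ i j, θ i (e j) = if i = j then 1 else 0) : LinearIndependent ℝ θ := by
  rw [Fintype.linearIndependent_iff]
  intro g hg j
  have := congrArg (fun L : V →L[ℝ] ℝ => L (e j)) hg
  simpa [h] using this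

theorem twoForm_swap (β : V [⋀^Fin 2]→L[ℝ] ℝ) (v w : V) : β ![w, v] = -β ![v, w] := by
  have h := β.toAlternatingMap.map_swap ![v, w] (i := 0) (j := 1) (by decide)
  have e : (![v, w] ∘ Equiv.swap (0 : Fin 2) 1 : Fin 2 → V) = ![w, v] := by
    ext i; fin_cases i <;> rfl
  rw [e] at h
  exact h

/-- The bilinear form underlying a 2-form. -/
def bilin (β : V [⋀^Fin 2]→L[ℝ] ℝ) : V →ₗ[ℝ] V →ₗ[ℝ] ℝ :=
  LinearMap.mk₂ ℝ (fun v w => β ![v, w])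
    (fun x y w => β.vecCons_add ![w] x y) (fun c x w => β.vecCons_smul ![w] c x)
    (fun v x y => by
      rw [twoForm_swap β (x + y), twoForm_swap β x, twoForm_swap β y]
      linarith [β.vecCons_add ![v] x y])
    (fun c v x => by
      have : β ![c • x, v] = c • β ![x, v] := β.vecCons_smul ![v] c x
      rw [twoForm_swap β (c • x), twoForm_swap β x, this, smul_neg])

theorem bilin_apply (β : V [⋀^Fin 2]→L[ℝ] ℝ) (v w : V) : bilin β v w = β ![v, w] := rfl

theorem twoForm_self (β : V [⋀^Fin 2]→L[ℝ] ℝ) (v : V) : β ![v, v] = 0 :=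
  β.map_eq_zero_of_eq ![v, v] (i := 0) (j := 1) rfl (by decide)

theorem twoForm_ext {α β : V [⋀^Fin 2]→L[ℝ] ℝ} (h : ∀ v w, α ![v, w] = β ![v, w]) : α = β := by
  ext v
  have : v = ![v 0, v 1] := by ext i; fin_cases i <;> rfl
  rw [this, h]

/-- Expansion of a 2-form in a frame. -/
theorem twoForm_eq_sum (β : E4 [⋀^Fin 2]→L[ℝ] ℝ) {θ : Fin 4 → E4 →L[ℝ] ℝ} {e : Fin 4 → E4}
    (he : ∀ i j, θ i (e j) = if i = j then 1 else 0) :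
    β = ∑ p : Fin 6, β ![e (pair p).1, e (pair p).2] • wedge (θ (pair p).1) (θ (pair p).2) := by
  have hv : ∀ v, v = ∑ i, θ i v • e i := fun v => by
    refine coframe_ext (linearIndependent_of_dual he) fun i => ?_
    simp [he]
  refine twoForm_ext fun v w => ?_
  have h1 : β ![v, w] = bilin β (∑ i, θ i v • e i) (∑ i, θ i w • e i) := by
    rw [← hv v, ← hv w, bilin_apply]
  have s1 := twoForm_swap β (e 0) (e 1)
  have s2 := twoForm_swap β (e 0) (e 2)
  have s3 := twoForm_swap β (e 0) (e 3)
  have s4 := twoForm_swap β (e 1) (e 2)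
  have s5 := twoForm_swap β (e 1) (e 3)
  have s6 := twoForm_swap β (e 2) (e 3)
  rw [h1]
  simp only [Fin.sum_univ_four, Fin.sum_univ_six, map_add, map_smul, LinearMap.add_apply,
    LinearMap.smul_apply, bilin_apply, twoForm_self, s1, s2, s3, s4, s5, s6, smul_eq_mul, pair,
    ContinuousAlternatingMap.add_apply, ContinuousAlternatingMap.smul_apply, wedge_apply,
    Matrix.cons_val]
  ring

end LinearAlgebra

/-! ### Smoothness of forms and functions -/

section Smooth

/-- Evaluation on tuples of basis vectors embeds the forms linearly in a finite-dimensional space. A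
linear left inverse recovers the form smoothly from its values. -/
theorem contDiffAt_form_of_apply {n : ℕ} {η : E4 → E4 [⋀^Fin n]→L[ℝ] ℝ} {y : E4}
    (h : ∀ v, ContDiffAt ℝ ∞ (fun z => η z v) y) : ContDiffAt ℝ ∞ η y := by
  let b := (EuclideanSpace.basisFun (Fin 4) ℝ).toBasis
  let L : (E4 [⋀^Fin n]→L[ℝ] ℝ) →ₗ[ℝ] ((Fin n → Fin 4) → ℝ) :=
    { toFun := fun f r => f fun i => b (r i)
      map_add' := fun _ _ => rfl
      map_smul' := fun _ _ => rfl }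
  have hL : LinearMap.ker L = ⊥ := by
    rw [LinearMap.ker_eq_bot]
    intro f g hfg
    apply ContinuousAlternatingMap.toAlternatingMap_injective
    refine AlternatingMap.coe_multilinearMap_injective ?_
    exact Module.Basis.ext_multilinear (fun _ => b) fun r => congrFun hfg r
  obtain ⟨R, hR⟩ := L.exists_leftInverse_of_injective hL
  have e : η = fun z => (LinearMap.toContinuousLinearMap R) (L (η z)) := by
    funext z
    exact (LinearMap.congr_fun hR (η z)).symm
  rw [e]
  exact (LinearMap.toContinuousLinearMap R).contDiff.contDiffAt.comp y
    (contDiffAt_pi.2 fun r => h _)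

theorem contDiffAt_clm_of_apply {a : E4 → E4 →L[ℝ] ℝ} {y : E4}
    (h : ∀ v, ContDiffAt ℝ ∞ (fun z => a z v) y) : ContDiffAt ℝ ∞ a y := by
  let e := ContinuousAlternatingMap.ofSubsingletonLIE (𝕜 := ℝ) (E := E4) (F := ℝ) (0 : Fin 1)
  have h2 : ContDiffAt ℝ ∞ (fun z => e (a z)) y := contDiffAt_form_of_apply fun v => h (v 0)
  have h3 : a = e.symm ∘ fun z => e (a z) := funext fun z => (e.symm_apply_apply (a z)).symm
  rw [h3]
  exact e.symm.contDiff.contDiffAt.comp y h2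

/-- By multilinearity the value is a polynomial in the coordinates of the vectors and the values of
the form on basis tuples. -/
theorem ContDiffAt.form_apply {n : ℕ} {η : E4 → E4 [⋀^Fin n]→L[ℝ] ℝ} {v : Fin n → E4 → E4}
    {y : E4} (hη : ContDiffAt ℝ ∞ η y) (hv : ∀ i, ContDiffAt ℝ ∞ (v i) y) :
    ContDiffAt ℝ ∞ (fun z => η z fun i => v i z) y := by
  let b := (EuclideanSpace.basisFun (Fin 4) ℝ).toBasis
  have e : (fun z => η z fun i => v i z) =
      fun z => ∑ r : Fin n → Fin 4, (∏ i, v i z (r i)) * η z fun i => b (r i) := by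
    funext z
    have hvz : (fun i => v i z) = fun i => ∑ j, v i z j • b j := by
      funext i
      conv_lhs => rw [← b.sum_repr (v i z)]
      simp [b]
    rw [hvz]
    have := (η z).toMultilinearMap.map_sum (fun i j => v i z j • b j)
    refine this.trans (Finset.sum_congr rfl fun r _ => ?_)
    exact (η z).toMultilinearMap.map_smul_univ _ _
  rw [e]
  refine ContDiffAt.sum fun r _ => ContDiffAt.mul (contDiffAt_prod fun i _ => ?_) ?_
  · exact (EuclideanSpace.proj (𝕜 := ℝ) (r i)).contDiff.contDiffAt.comp y (hv i)
  · let L := ContinuousMultilinearMap.apply ℝ (fun _ : Fin n => E4) ℝ (fun i => b (r i)) ∘L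
      ContinuousAlternatingMap.toContinuousMultilinearMapCLM ℝ
    exact L.contDiff.contDiffAt.comp y hη

end Smooth

theorem contDiffAt_extDeriv {n : ℕ} {f : E4 → E4 [⋀^Fin n]→L[ℝ] ℝ} {y : E4}
    (h : ContDiffAt ℝ ∞ f y) : ContDiffAt ℝ ∞ (extDeriv f) y := by
  refine contDiffAt_form_of_apply fun v => ?_
  have h0 : ContDiffAt ℝ ∞ (fderiv ℝ f) y := h.fderiv_right (m := ∞) (by simp)
  simp only [extDeriv, ContinuousAlternatingMap.alternatizeUncurryFin_apply]
  refine ContDiffAt.sum fun i _ => ContDiffAt.const_smul _ ?_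
  exact ContDiffAt.form_apply (h0.clm_apply contDiffAt_const) (fun _ => contDiffAt_const)

/-! ### Smoothness under algebraic operations, locality of d, and d² = 0. -/

section Closure

variable {X : Type u} [TopologicalSpace X] [ChartedSpace E4 X]

/-- The coordinate expression of a covector field in the chart centred at `x₀`. -/
def CovectorField.inChart (α : CovectorField X) (x₀ : X) : E4 → E4 →L[ℝ] ℝ := fun y =>
  (α ((extChartAt 𝓘(ℝ, E4) x₀).symm y)).comp
    (mfderiv 𝓘(ℝ, E4) 𝓘(ℝ, E4) (extChartAt 𝓘(ℝ, E4) x₀).symm y)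

theorem CovectorField.toForm_inChart (α : CovectorField X) (x₀ : X) :
    α.toForm.inChart x₀ =
      fun y => ContinuousAlternatingMap.ofSubsingleton ℝ E4 ℝ (0 : Fin 1) (α.inChart x₀ y) := rfl

/-- A real function is smooth on `U` if its coordinate expressions are. -/
def SmoothFun (f : X → ℝ) (U : Set X) : Prop :=
  ∀ (x₀ : X), ∀ y ∈ (extChartAt 𝓘(ℝ, E4) x₀).target, (extChartAt 𝓘(ℝ, E4) x₀).symm y ∈ U →
    ContDiffAt ℝ ∞ (f ∘ (extChartAt 𝓘(ℝ, E4) x₀).symm) y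

theorem Form.smoothOn_of_contDiffAt {n : ℕ} {η : Form X n} {U : Set X}
    (h : ∀ (x₀ : X), ∀ y ∈ (extChartAt 𝓘(ℝ, E4) x₀).target,
      (extChartAt 𝓘(ℝ, E4) x₀).symm y ∈ U → ContDiffAt ℝ ∞ (η.inChart x₀) y) : η.SmoothOn U :=
  fun x₀ y hy => (h x₀ y hy.1 hy.2).contDiffWithinAt

theorem CovectorField.smoothOn_of_contDiffAt {α : CovectorField X} {U : Set X}
    (h : ∀ (x₀ : X), ∀ y ∈ (extChartAt 𝓘(ℝ, E4) x₀).target,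
      (extChartAt 𝓘(ℝ, E4) x₀).symm y ∈ U → ContDiffAt ℝ ∞ (α.inChart x₀) y) :
    α.toForm.SmoothOn U := by
  refine Form.smoothOn_of_contDiffAt fun x₀ y hy hyU => ?_
  rw [α.toForm_inChart]
  exact (ContinuousAlternatingMap.ofSubsingletonLIE (𝕜 := ℝ) (E := E4) (F := ℝ)
    (0 : Fin 1)).contDiff.contDiffAt.comp y (h x₀ y hy hyU)

theorem CovectorField.contDiffAt {α : CovectorField X} {U : Set X} (hα : α.toForm.SmoothOn U)
    (hU : IsOpen U) {x₀ : X} {y : E4} (hy : y ∈ (extChartAt 𝓘(ℝ, E4) x₀).target)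
    (hyU : (extChartAt 𝓘(ℝ, E4) x₀).symm y ∈ U) : ContDiffAt ℝ ∞ (α.inChart x₀) y := by
  refine contDiffAt_clm_of_apply fun v => ?_
  have := ContDiffAt.form_apply (v := fun _ _ => v) (hα.contDiffAt hU hy hyU)
    (fun _ => contDiffAt_const)
  exact this

theorem Form.SmoothOn.mono {n : ℕ} {η : Form X n} {U V : Set X} (h : η.SmoothOn U) (hVU : V ⊆ U) :
    η.SmoothOn V :=
  fun x₀ => (h x₀).mono fun _ hy => ⟨hy.1, hVU hy.2⟩

theorem Form.SmoothOn.congr {n : ℕ} {η η' : Form X n} {U : Set X} (h : η.SmoothOn U)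
    (he : ∀ x ∈ U, η' x = η x) : η'.SmoothOn U := fun x₀ => by
  refine (h x₀).congr fun y hy => ?_
  simp only [Form.inChart]
  rw [he _ hy.2]

theorem Form.smoothOn_of_locally {n : ℕ} {η : Form X n} {U : Set X}
    (h : ∀ x ∈ U, ∃ V, IsOpen V ∧ x ∈ V ∧ η.SmoothOn V) : η.SmoothOn U := by
  refine Form.smoothOn_of_contDiffAt fun x₀ y hy hyU => ?_
  obtain ⟨V, hV, hxV, hs⟩ := h _ hyU
  exact hs.contDiffAt hV hy hxV

theorem eventually_symm_mem {U : Set X} (hU : IsOpen U) {x₀ : X} {y : E4}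
    (hy : y ∈ (extChartAt 𝓘(ℝ, E4) x₀).target) (hyU : (extChartAt 𝓘(ℝ, E4) x₀).symm y ∈ U) :
    ∀ᶠ z in 𝓝 y, z ∈ (extChartAt 𝓘(ℝ, E4) x₀).target ∧ (extChartAt 𝓘(ℝ, E4) x₀).symm z ∈ U :=
  (isOpen_chart_preimage x₀ hU).mem_nhds ⟨hy, hyU⟩

theorem Form.inChart_eventuallyEq {n : ℕ} {η η' : Form X n} {U : Set X} (hU : IsOpen U)
    (he : ∀ x ∈ U, η' x = η x) {x₀ : X} {y : E4} (hy : y ∈ (extChartAt 𝓘(ℝ, E4) x₀).target)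
    (hyU : (extChartAt 𝓘(ℝ, E4) x₀).symm y ∈ U) : η'.inChart x₀ =ᶠ[𝓝 y] η.inChart x₀ := by
  filter_upwards [eventually_symm_mem hU hy hyU] with z hz
  simp only [Form.inChart]
  rw [he _ hz.2]

theorem Form.d_congr {n : ℕ} {η η' : Form X n} {U : Set X} (hU : IsOpen U)
    (he : ∀ x ∈ U, η' x = η x) {x : X} (hx : x ∈ U) : η'.d x = η.d x := by
  have hm := mem_extChartAt_source (I := 𝓘(ℝ, E4)) x
  have := Form.inChart_eventuallyEq hU he ((extChartAt 𝓘(ℝ, E4) x).map_source hm)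
    (by rwa [(extChartAt 𝓘(ℝ, E4) x).left_inv hm])
  simp only [Form.d]
  rw [this.extDeriv_eq]

theorem CovectorField.d_congr {α β : CovectorField X} {U : Set X} (hU : IsOpen U)
    (he : ∀ x ∈ U, α x = β x) {x : X} (hx : x ∈ U) : α.d x = β.d x :=
  Form.d_congr hU (fun y hy => by simp only [CovectorField.toForm]; rw [he y hy]) hx

theorem SmoothFun.continuousAt {f : X → ℝ} {U : Set X} (h : SmoothFun f U) {x : X} (hx : x ∈ U) :
    ContinuousAt f x := by
  have hm := mem_extChartAt_source (I := 𝓘(ℝ, E4)) x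
  have hl := (extChartAt 𝓘(ℝ, E4) x).left_inv hm
  have h1 := (h x _ ((extChartAt 𝓘(ℝ, E4) x).map_source hm) (by rwa [hl])).continuousAt
  have h2 : ContinuousAt ((f ∘ (extChartAt 𝓘(ℝ, E4) x).symm) ∘ extChartAt 𝓘(ℝ, E4) x) x :=
    ContinuousAt.comp h1 (continuousAt_extChartAt x)
  refine h2.congr ?_
  filter_upwards [(isOpen_extChartAt_source (I := 𝓘(ℝ, E4)) x).mem_nhds hm] with z hz
  exact congrArg f ((extChartAt 𝓘(ℝ, E4) x).left_inv hz)

theorem smoothFun_const (c : ℝ) (U : Set X) : SmoothFun (fun _ : X => c) U :=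
  fun _ _ _ _ => contDiffAt_const

theorem SmoothFun.add {f g : X → ℝ} {U : Set X} (hf : SmoothFun f U) (hg : SmoothFun g U) :
    SmoothFun (fun x => f x + g x) U :=
  fun x₀ y hy hyU => (hf x₀ y hy hyU).add (hg x₀ y hy hyU)

theorem SmoothFun.sub {f g : X → ℝ} {U : Set X} (hf : SmoothFun f U) (hg : SmoothFun g U) :
    SmoothFun (fun x => f x - g x) U :=
  fun x₀ y hy hyU => (hf x₀ y hy hyU).sub (hg x₀ y hy hyU)

theorem SmoothFun.mul {f g : X → ℝ} {U : Set X} (hf : SmoothFun f U) (hg : SmoothFun g U) :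
    SmoothFun (fun x => f x * g x) U :=
  fun x₀ y hy hyU => (hf x₀ y hy hyU).mul (hg x₀ y hy hyU)

theorem SmoothFun.comp {f : X → ℝ} {U : Set X} (hf : SmoothFun f U) {F : ℝ → ℝ}
    (hF : ∀ x ∈ U, ContDiffAt ℝ ∞ F (f x)) : SmoothFun (fun x => F (f x)) U :=
  fun x₀ y hy hyU => ContDiffAt.comp (g := F) (f := f ∘ (extChartAt 𝓘(ℝ, E4) x₀).symm) y
    (hF _ hyU) (hf x₀ y hy hyU)

theorem SmoothFun.neg {f : X → ℝ} {U : Set X} (hf : SmoothFun f U) :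
    SmoothFun (fun x => -f x) U :=
  hf.comp fun _ _ => contDiff_neg.contDiffAt

theorem SmoothFun.inv {f : X → ℝ} {U : Set X} (hf : SmoothFun f U) (h0 : ∀ x ∈ U, f x ≠ 0) :
    SmoothFun (fun x => (f x)⁻¹) U :=
  hf.comp fun x hx => contDiffAt_inv ℝ (h0 x hx)

theorem CovectorField.smoothOn_smul {f : X → ℝ} {α : CovectorField X} {U : Set X} (hU : IsOpen U)
    (hf : SmoothFun f U) (hα : α.toForm.SmoothOn U) :
    (CovectorField.toForm fun x => f x • α x).SmoothOn U :=
  CovectorField.smoothOn_of_contDiffAt fun x₀ y hy hyU =>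
    (hf x₀ y hy hyU).smul (CovectorField.contDiffAt hα hU hy hyU)

theorem CovectorField.smoothOn_add {α β : CovectorField X} {U : Set X} (hU : IsOpen U)
    (hα : α.toForm.SmoothOn U) (hβ : β.toForm.SmoothOn U) :
    (CovectorField.toForm fun x => α x + β x).SmoothOn U :=
  CovectorField.smoothOn_of_contDiffAt fun x₀ y hy hyU => by
    have : CovectorField.inChart (fun x => α x + β x) x₀ = fun y => α.inChart x₀ y + β.inChart x₀ y :=
      funext fun y => ContinuousLinearMap.add_comp _ _ _
    rw [this]
    exact (CovectorField.contDiffAt hα hU hy hyU).add (CovectorField.contDiffAt hβ hU hy hyU)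

theorem Form.smoothOn_add {n : ℕ} {α β : Form X n} {U : Set X} (hU : IsOpen U)
    (hα : α.SmoothOn U) (hβ : β.SmoothOn U) : (Form.SmoothOn (fun x => α x + β x) U) :=
  Form.smoothOn_of_contDiffAt fun _ _ hy hyU =>
    (hα.contDiffAt hU hy hyU).add (hβ.contDiffAt hU hy hyU)

theorem Form.inChart_wedge (α β : CovectorField X) (x₀ : X) :
    Form.inChart (fun x => wedge (α x) (β x)) x₀ =
      fun z => wedge (α.inChart x₀ z) (β.inChart x₀ z) := by
  funext z
  refine twoForm_ext fun v w => ?_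
  rw [wedge_apply]
  have e : ((mfderiv 𝓘(ℝ, E4) 𝓘(ℝ, E4) (extChartAt 𝓘(ℝ, E4) x₀).symm z : E4 → E4) ∘ ![v, w])
    = ![mfderiv 𝓘(ℝ, E4) 𝓘(ℝ, E4) (extChartAt 𝓘(ℝ, E4) x₀).symm z v,
      mfderiv 𝓘(ℝ, E4) 𝓘(ℝ, E4) (extChartAt 𝓘(ℝ, E4) x₀).symm z w] := by
    ext i; fin_cases i <;> rfl
  simp only [Form.inChart]
  exact (congrArg _ e).trans (wedge_apply _ _ _ _)

theorem Form.smoothOn_wedge {α β : CovectorField X} {U : Set X} (hU : IsOpen U)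
    (hα : α.toForm.SmoothOn U) (hβ : β.toForm.SmoothOn U) :
    Form.SmoothOn (fun x => wedge (α x) (β x)) U := by
  refine Form.smoothOn_of_contDiffAt fun x₀ y hy hyU => ?_
  have ha := CovectorField.contDiffAt hα hU hy hyU
  have hb := CovectorField.contDiffAt hβ hU hy hyU
  rw [Form.inChart_wedge]
  refine contDiffAt_form_of_apply fun v => ?_
  have hv : v = ![v 0, v 1] := by ext i; fin_cases i <;> rfl
  rw [hv]
  simp only [wedge_apply]
  exact ((ha.clm_apply contDiffAt_const).mul (hb.clm_apply contDiffAt_const)).sub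
    ((ha.clm_apply contDiffAt_const).mul (hb.clm_apply contDiffAt_const))

variable [IsManifold 𝓘(ℝ, E4) ∞ X]

/-- The chart used to define `η.d` varies with the point. Naturality (`Form.inChart_d`) replaces it
by one fixed chart, where `extDeriv` preserves smoothness. -/
theorem Form.SmoothOn.d {n : ℕ} {η : Form X n} {U : Set X} (hη : η.SmoothOn U) (hU : IsOpen U) :
    η.d.SmoothOn U := by
  refine Form.smoothOn_of_contDiffAt fun x₀ y hy hyU => ?_
  have h := contDiffAt_extDeriv (hη.contDiffAt hU hy hyU)
  refine h.congr_of_eventuallyEq ?_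
  filter_upwards [eventually_symm_mem hU hy hyU] with z hz
  exact Form.inChart_d hη hU x₀ hz.1 hz.2

theorem Form.d_d {n : ℕ} {η : Form X n} {U : Set X} (hη : η.SmoothOn U) (hU : IsOpen U)
    {x : X} (hx : x ∈ U) : η.d.d x = 0 := by
  have hm := mem_extChartAt_source (I := 𝓘(ℝ, E4)) x
  have ht := (extChartAt 𝓘(ℝ, E4) x).map_source hm
  have hxU : (extChartAt 𝓘(ℝ, E4) x).symm (extChartAt 𝓘(ℝ, E4) x x) ∈ U := by
    rwa [(extChartAt 𝓘(ℝ, E4) x).left_inv hm]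
  have e : η.d.inChart x =ᶠ[𝓝 (extChartAt 𝓘(ℝ, E4) x x)] extDeriv (η.inChart x) := by
    filter_upwards [eventually_symm_mem hU ht hxU] with z hz
    exact Form.inChart_d hη hU x hz.1 hz.2
  rw [Form.d, e.extDeriv_eq, extDeriv_extDeriv_apply (hη.contDiffAt hU ht hxU)
    minSmoothness_two_le_infty]
  rfl

end Closure

/-! ### Exterior derivatives of combinations of 1-forms -/

theorem extDeriv_ofSubsingleton {a : E4 → E4 →L[ℝ] ℝ} {y : E4} (ha : DifferentiableAt ℝ a y)
    (v w : E4) :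
    extDeriv (fun z => ContinuousAlternatingMap.ofSubsingleton ℝ E4 ℝ (0 : Fin 1) (a z)) y ![v, w] =
      fderiv ℝ a y v w - fderiv ℝ a y w v := by
  have hd : DifferentiableAt ℝ
      (fun z => ContinuousAlternatingMap.ofSubsingleton ℝ E4 ℝ (0 : Fin 1) (a z)) y :=
    (ContinuousAlternatingMap.ofSubsingletonLIE (𝕜 := ℝ) (E := E4) (F := ℝ)
      (0 : Fin 1)).differentiableAt.comp y ha
  have key : ∀ s t : E4, fderiv ℝ (fun z => a z t) y s = fderiv ℝ a y s t := fun s t => by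
    rw [fderiv_clm_apply ha (differentiableAt_const t)]
    simp
  rw [extDeriv_apply hd, Fin.sum_univ_two]
  have e0 : (fun z => ContinuousAlternatingMap.ofSubsingleton ℝ E4 ℝ (0 : Fin 1) (a z)
      ((0 : Fin 2).removeNth ![v, w])) = fun z => a z w := rfl
  have e1 : (fun z => ContinuousAlternatingMap.ofSubsingleton ℝ E4 ℝ (0 : Fin 1) (a z)
      ((1 : Fin 2).removeNth ![v, w])) = fun z => a z v := rfl
  rw [e0, e1, key, key]
  simp [sub_eq_add_neg]

/-! ### Coframes on open sets, their dual frames, and the Leibniz rule for combinations of 1-forms.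
-/

section Frames

variable {X : Type u} [TopologicalSpace X] [ChartedSpace E4 X]

/-- A smooth coframing on `U`. -/
structure CoframeOn (θ : Fin 4 → CovectorField X) (U : Set X) : Prop where
  isOpen : IsOpen U
  smooth : ∀ i, (θ i).toForm.SmoothOn U
  linearIndependent : ∀ x ∈ U, LinearIndependent ℝ (fun i => θ i x)

open Classical in
/-- The frame dual to a coframe. -/
def dualFrame (θ : Fin 4 → CovectorField X) (x : X) : Fin 4 → TangentSpace 𝓘(ℝ, E4) x :=
  if h : ∃ e : Fin 4 → TangentSpace 𝓘(ℝ, E4) x, ∀ i j, θ i x (e j) = if i = j then 1 else 0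
  -- The default value occurs only where the covectors are linearly dependent.
  then h.choose else 0

theorem dualFrame_apply {θ : Fin 4 → CovectorField X} {x : X}
    (h : LinearIndependent ℝ (fun i => θ i x)) (i j : Fin 4) :
    θ i x (dualFrame θ x j) = if i = j then 1 else 0 := by
  have h' : ∃ e : Fin 4 → TangentSpace 𝓘(ℝ, E4) x,
      ∀ i j, θ i x (e j) = if i = j then 1 else 0 := exists_dual_frame h
  rw [dualFrame, dif_pos h']
  exact h'.choose_spec i j

theorem tangent_ext {θ : Fin 4 → CovectorField X} {x : X}
    (h : LinearIndependent ℝ (fun i => θ i x)) {v w : TangentSpace 𝓘(ℝ, E4) x}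
    (hvw : ∀ i, θ i x v = θ i x w) : v = w :=
  coframe_ext (θ := fun i => θ i x) h hvw

theorem tangent_eq_sum {θ : Fin 4 → CovectorField X} {x : X}
    (h : LinearIndependent ℝ (fun i => θ i x)) (v : TangentSpace 𝓘(ℝ, E4) x) :
    v = ∑ i, θ i x v • dualFrame θ x i :=
  tangent_ext h fun i => by simp [dualFrame_apply h]

theorem covector_eq_sum {θ : Fin 4 → CovectorField X} {x : X}
    (h : LinearIndependent ℝ (fun i => θ i x)) (α : TangentSpace 𝓘(ℝ, E4) x →L[ℝ] ℝ) :
    α = ∑ i, α (dualFrame θ x i) • θ i x := by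
  ext v
  conv_lhs => rw [tangent_eq_sum h v]
  simp [mul_comm]

theorem covector_ext {θ : Fin 4 → CovectorField X} {x : X}
    (h : LinearIndependent ℝ (fun i => θ i x)) {α β : TangentSpace 𝓘(ℝ, E4) x →L[ℝ] ℝ}
    (he : ∀ i, α (dualFrame θ x i) = β (dualFrame θ x i)) : α = β := by
  rw [covector_eq_sum h α, covector_eq_sum h β]
  simp only [he]

variable [IsManifold 𝓘(ℝ, E4) ∞ X]

theorem mfderiv_symm_comp_mfderiv_symm (x₀ : X) {y : E4}
    (hy : y ∈ (extChartAt 𝓘(ℝ, E4) x₀).target)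
    (v : TangentSpace 𝓘(ℝ, E4) ((extChartAt 𝓘(ℝ, E4) x₀).symm y)) :
    mfderiv 𝓘(ℝ, E4) 𝓘(ℝ, E4) (extChartAt 𝓘(ℝ, E4) x₀).symm y
      (mfderiv 𝓘(ℝ, E4) 𝓘(ℝ, E4) (extChartAt 𝓘(ℝ, E4) x₀) ((extChartAt 𝓘(ℝ, E4) x₀).symm y) v)
      = v := by
  have := mfderivWithin_extChartAt_symm_comp_mfderiv_extChartAt (I := 𝓘(ℝ, E4)) hy
  rw [ModelWithCorners.range_eq_univ, mfderivWithin_univ] at this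
  exact congrArg (fun L => L v) this

/-- The coordinate expression of a vector field. -/
def vectorInChart (e : ∀ x : X, TangentSpace 𝓘(ℝ, E4) x) (x₀ : X) : E4 → E4 := fun z =>
  mfderiv 𝓘(ℝ, E4) 𝓘(ℝ, E4) (extChartAt 𝓘(ℝ, E4) x₀) ((extChartAt 𝓘(ℝ, E4) x₀).symm z)
    (e ((extChartAt 𝓘(ℝ, E4) x₀).symm z))

/-- The dual frame consists of the images of the standard basis under the inverse of the linear
isomorphism `Θ`, and inversion of operators is smooth. -/
theorem contDiffAt_dual {Θ : Fin 4 → E4 → E4 →L[ℝ] ℝ} {F : Fin 4 → E4 → E4} {y : E4}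
    (hΘ : ∀ i, ContDiffAt ℝ ∞ (Θ i) y)
    (h : ∀ᶠ z in 𝓝 y, ∀ i j, Θ i z (F j z) = if i = j then 1 else 0) (j : Fin 4) :
    ContDiffAt ℝ ∞ (F j) y := by
  let Φ : E4 → E4 →L[ℝ] (Fin 4 → ℝ) := fun z => ContinuousLinearMap.pi fun i => Θ i z
  have hΦ : ContDiffAt ℝ ∞ Φ y := by
    have : ContDiffAt ℝ ∞ (fun z => ∑ i, (ContinuousLinearMap.smulRightL ℝ E4 (Fin 4 → ℝ) (Θ i z))
        (Pi.single i (1 : ℝ))) y :=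
      ContDiffAt.sum fun i _ =>
        (((ContinuousLinearMap.smulRightL ℝ E4 (Fin 4 → ℝ)).contDiff.contDiffAt.comp y
          (hΘ i)).clm_apply contDiffAt_const)
    refine this.congr_of_eventuallyEq (Filter.Eventually.of_forall fun z => ?_)
    ext v i
    simp [Φ, Pi.single_apply]
  have hinv : ∀ z, (∀ i j, Θ i z (F j z) = if i = j then 1 else 0) →
      ∃ L : E4 ≃L[ℝ] (Fin 4 → ℝ), (L : E4 →L[ℝ] (Fin 4 → ℝ)) = Φ z := fun z hz => by
    have hi := linearIndependent_of_dual hz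
    have hinj : Function.Injective (Φ z).toLinearMap := fun v w hvw =>
      coframe_ext hi fun i => congrFun hvw i
    exact ⟨(LinearEquiv.ofInjectiveOfFinrankEq (Φ z).toLinearMap hinj
      (by simp)).toContinuousLinearEquiv, by ext v; rfl⟩
  obtain ⟨L, hL⟩ := hinv y h.self_of_nhds
  have h1 : ContDiffAt ℝ ∞ (fun z => (Φ z).inverse (Pi.single j 1)) y := by
    have h2 : ContDiffAt ℝ ∞ (ContinuousLinearMap.inverse : (E4 →L[ℝ] (Fin 4 → ℝ)) → _) (Φ y) := by
      rw [← hL]; exact contDiffAt_map_inverse L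
    exact (h2.comp y hΦ).clm_apply contDiffAt_const
  refine h1.congr_of_eventuallyEq ?_
  filter_upwards [h] with z hz
  obtain ⟨L, hL⟩ := hinv z hz
  rw [← hL, ContinuousLinearMap.inverse_equiv]
  refine L.injective ?_
  have : (L : E4 →L[ℝ] (Fin 4 → ℝ)) (F j z) = Pi.single j 1 := by
    rw [hL]
    ext i
    simp [Φ, hz, Pi.single_apply]
  simpa using this

theorem CoframeOn.contDiffAt_dualFrame {θ : Fin 4 → CovectorField X} {U : Set X}
    (hθ : CoframeOn θ U) {x₀ : X} {y : E4} (hy : y ∈ (extChartAt 𝓘(ℝ, E4) x₀).target)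
    (hyU : (extChartAt 𝓘(ℝ, E4) x₀).symm y ∈ U) (j : Fin 4) :
    ContDiffAt ℝ ∞ (vectorInChart (fun x => dualFrame θ x j) x₀) y := by
  refine contDiffAt_dual (Θ := fun i => (θ i).inChart x₀)
    (F := fun j => vectorInChart (fun x => dualFrame θ x j) x₀)
    (fun i => CovectorField.contDiffAt (hθ.smooth i) hθ.isOpen hy hyU) ?_ j
  filter_upwards [eventually_symm_mem hθ.isOpen hy hyU] with z hz i j
  rw [← dualFrame_apply (hθ.linearIndependent _ hz.2) i j]
  exact congrArg (θ i _) (mfderiv_symm_comp_mfderiv_symm x₀ hz.1 _)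

theorem CoframeOn.smoothFun_covector {θ : Fin 4 → CovectorField X} {U : Set X}
    (hθ : CoframeOn θ U) {α : CovectorField X} (hα : α.toForm.SmoothOn U) (j : Fin 4) :
    SmoothFun (fun x => α x (dualFrame θ x j)) U := fun x₀ y hy hyU => by
  refine ((CovectorField.contDiffAt hα hθ.isOpen hy hyU).clm_apply
    (hθ.contDiffAt_dualFrame hy hyU j)).congr_of_eventuallyEq ?_
  filter_upwards [eventually_symm_mem hθ.isOpen hy hyU] with z hz
  exact congrArg (α _) (mfderiv_symm_comp_mfderiv_symm x₀ hz.1 _).symm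

theorem CoframeOn.smoothFun_twoForm {θ : Fin 4 → CovectorField X} {U : Set X}
    (hθ : CoframeOn θ U) {β : Form X 2} (hβ : β.SmoothOn U) (i j : Fin 4) :
    SmoothFun (fun x => β x ![dualFrame θ x i, dualFrame θ x j]) U := fun x₀ y hy hyU => by
  refine (ContDiffAt.form_apply (v := ![vectorInChart (fun x => dualFrame θ x i) x₀,
    vectorInChart (fun x => dualFrame θ x j) x₀]) (hβ.contDiffAt hθ.isOpen hy hyU) (fun k => by
      fin_cases k
      · exact hθ.contDiffAt_dualFrame hy hyU i
      · exact hθ.contDiffAt_dualFrame hy hyU j)).congr_of_eventuallyEq ?_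
  filter_upwards [eventually_symm_mem hθ.isOpen hy hyU] with z hz
  refine congrArg (β _) ?_
  ext k
  fin_cases k
  · exact (mfderiv_symm_comp_mfderiv_symm x₀ hz.1 _).symm
  · exact (mfderiv_symm_comp_mfderiv_symm x₀ hz.1 _).symm

/-- The derivative at `x` of the chart centred at `x`. -/
def chartDeriv (x : X) : TangentSpace 𝓘(ℝ, E4) x →L[ℝ] E4 :=
  mfderiv 𝓘(ℝ, E4) 𝓘(ℝ, E4) (extChartAt 𝓘(ℝ, E4) x) x

theorem CovectorField.inChart_chartDeriv (β : CovectorField X) (x : X)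
    (w : TangentSpace 𝓘(ℝ, E4) x) :
    β.inChart x (extChartAt 𝓘(ℝ, E4) x x) (chartDeriv x w) = β x w := by
  have hm := mem_extChartAt_source (I := 𝓘(ℝ, E4)) x
  have h1 := mfderiv_symm_comp_mfderiv x hm w
  have h2 : ∀ x' : X, x' = x → ∀ u : E4, u = w →
      (show E4 →L[ℝ] ℝ from β x') u = (show E4 →L[ℝ] ℝ from β x) w := by
    rintro x' rfl u rfl
    rfl
  exact h2 _ ((extChartAt 𝓘(ℝ, E4) x).left_inv hm) _ h1

omit [IsManifold 𝓘(ℝ, E4) ∞ X] in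
theorem CovectorField.d_apply {β : CovectorField X} {x : X}
    (hβ : DifferentiableAt ℝ (β.inChart x) (extChartAt 𝓘(ℝ, E4) x x))
    (v w : TangentSpace 𝓘(ℝ, E4) x) :
    β.d x ![v, w] =
      fderiv ℝ (β.inChart x) (extChartAt 𝓘(ℝ, E4) x x) (chartDeriv x v) (chartDeriv x w)
      - fderiv ℝ (β.inChart x) (extChartAt 𝓘(ℝ, E4) x x) (chartDeriv x w) (chartDeriv x v) := by
  rw [← extDeriv_ofSubsingleton hβ, ← CovectorField.toForm_inChart]
  refine congrArg (extDeriv (β.toForm.inChart x) _) ?_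
  ext i; fin_cases i <;> rfl

/-- The exterior derivative of a combination of 1-forms. -/
theorem CovectorField.d_sum {ι : Type*} [Fintype ι] {θ : ι → CovectorField X} {f : ι → X → ℝ}
    {α : CovectorField X} {U : Set X} (hU : IsOpen U) (hθ : ∀ i, (θ i).toForm.SmoothOn U)
    (hf : ∀ i, SmoothFun (f i) U) (hα : ∀ x ∈ U, α x = ∑ i, f i x • θ i x) {x : X} (hx : x ∈ U) :
    ∃ g : ι → TangentSpace 𝓘(ℝ, E4) x →L[ℝ] ℝ, ∀ v w, α.d x ![v, w] =
      ∑ i, (f i x * (θ i).d x ![v, w] + g i v * θ i x w - g i w * θ i x v) := by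
  have hm := mem_extChartAt_source (I := 𝓘(ℝ, E4)) x
  have hl := (extChartAt 𝓘(ℝ, E4) x).left_inv hm
  have ht := (extChartAt 𝓘(ℝ, E4) x).map_source hm
  have hxU : (extChartAt 𝓘(ℝ, E4) x).symm (extChartAt 𝓘(ℝ, E4) x x) ∈ U := by rwa [hl]
  set y := extChartAt 𝓘(ℝ, E4) x x with hy
  have hθd : ∀ i, DifferentiableAt ℝ ((θ i).inChart x) y := fun i =>
    (CovectorField.contDiffAt (hθ i) hU ht hxU).differentiableAt (by simp)
  have hfd : ∀ i, DifferentiableAt ℝ (f i ∘ (extChartAt 𝓘(ℝ, E4) x).symm) y := fun i =>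
    (hf i x y ht hxU).differentiableAt (by simp)
  have heq : α.inChart x =ᶠ[𝓝 y]
      fun z => ∑ i, (f i ∘ (extChartAt 𝓘(ℝ, E4) x).symm) z • (θ i).inChart x z := by
    filter_upwards [eventually_symm_mem hU ht hxU] with z hz
    ext v
    rw [sum_apply]
    refine (congrArg (fun L => L (mfderiv 𝓘(ℝ, E4) 𝓘(ℝ, E4) (extChartAt 𝓘(ℝ, E4) x).symm z v))
      (hα _ hz.2)).trans ?_
    exact sum_apply _ _ _
  have hs : ∀ i, DifferentiableAt ℝ
      (fun z => (f i ∘ (extChartAt 𝓘(ℝ, E4) x).symm) z • (θ i).inChart x z) y :=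
    fun i => (hfd i).smul (hθd i)
  have hfα : ∀ v w : E4, fderiv ℝ (α.inChart x) y v w =
      ∑ i, (f i x * fderiv ℝ ((θ i).inChart x) y v w
        + fderiv ℝ (f i ∘ (extChartAt 𝓘(ℝ, E4) x).symm) y v * (θ i).inChart x y w) := fun v w => by
    rw [heq.fderiv_eq, fderiv_fun_sum fun i _ => hs i]
    simp only [sum_apply]
    refine Finset.sum_congr rfl fun i _ => ?_
    rw [fderiv_fun_smul (hfd i) (hθd i)]
    simp only [add_apply, smul_apply,
      ContinuousLinearMap.smulRight_apply, Function.comp_apply, smul_eq_mul, hl]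
  have hαd : DifferentiableAt ℝ (α.inChart x) y :=
    (DifferentiableAt.fun_sum fun i _ => hs i).congr_of_eventuallyEq heq
  -- The covector `g i` is the differential of `f i` at `x`.
  refine ⟨fun i => (fderiv ℝ (f i ∘ (extChartAt 𝓘(ℝ, E4) x).symm) y).comp (chartDeriv x), fun v w => ?_⟩
  rw [CovectorField.d_apply hαd, hfα, hfα, ← Finset.sum_sub_distrib]
  refine Finset.sum_congr rfl fun i _ => ?_
  rw [CovectorField.d_apply (hθd i), CovectorField.inChart_chartDeriv,
    CovectorField.inChart_chartDeriv]
  simp only [ContinuousLinearMap.comp_apply]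
  ring

end Frames

/-! ### Derived systems -/

section Derived

variable {X : Type u} [TopologicalSpace X] [ChartedSpace E4 X]

theorem mem_span_image_iff {θ : Fin 4 → CovectorField X} {x : X}
    (h : LinearIndependent ℝ (fun i => θ i x)) (s : Finset (Fin 4))
    (α : TangentSpace 𝓘(ℝ, E4) x →L[ℝ] ℝ) :
    α ∈ Submodule.span ℝ ((fun i => θ i x) '' s) ↔ ∀ i ∉ s, α (dualFrame θ x i) = 0 := by
  constructor
  · intro hα i hi
    induction hα using Submodule.span_induction with
    | mem β hβ =>
      obtain ⟨j, hj, rfl⟩ := hβ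
      rw [dualFrame_apply h, if_neg]
      rintro rfl
      exact hi hj
    | zero => rfl
    | add β γ _ _ hβ hγ => rw [add_apply, hβ, hγ, add_zero]
    | smul c β _ hβ => rw [smul_apply, hβ, smul_zero]
  · intro hα
    rw [covector_eq_sum h α]
    refine Submodule.sum_mem _ fun i _ => ?_
    by_cases hi : i ∈ s
    · exact Submodule.smul_mem _ _ (Submodule.subset_span ⟨i, hi, rfl⟩)
    · rw [hα i hi, zero_smul]
      exact Submodule.zero_mem _

variable {J : PfaffianSystem X} {θ : Fin 4 → CovectorField X} {U : Set X} {s : Finset (Fin 4)}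

theorem mem_perp_iff {x : X} (hJ : J x = Submodule.span ℝ ((fun i => θ i x) '' s))
    (v : TangentSpace 𝓘(ℝ, E4) x) : v ∈ J.perp x ↔ ∀ i ∈ s, θ i x v = 0 := by
  constructor
  · intro hv i hi
    exact hv _ (hJ ▸ Submodule.subset_span ⟨i, hi, rfl⟩)
  · intro hv α hα
    rw [hJ] at hα
    induction hα using Submodule.span_induction with
    | mem β hβ => obtain ⟨j, hj, rfl⟩ := hβ; exact hv j hj
    | zero => rfl
    | add β γ _ _ hβ hγ => rw [add_apply, hβ, hγ, add_zero]
    | smul c β _ hβ => rw [smul_apply, hβ, smul_zero]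

variable [IsManifold 𝓘(ℝ, E4) ∞ X]

/-- Modulo `J`, the exterior derivative of a section of `J` depends only on its value. -/
theorem d_section (hθ : CoframeOn θ U)
    (hJ : ∀ y ∈ U, J y = Submodule.span ℝ ((fun i => θ i y) '' s)) {x : X} (hx : x ∈ U)
    {η : CovectorField X} {V : Set X} (hV : IsOpen V) (hxV : x ∈ V) (hη : η.toForm.SmoothOn V)
    (hηJ : ∀ y ∈ V, η y ∈ J y) {v w : TangentSpace 𝓘(ℝ, E4) x}
    (hv : ∀ i ∈ s, θ i x v = 0) (hw : ∀ i ∈ s, θ i x w = 0) :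
    η.d x ![v, w] = ∑ i ∈ s, η x (dualFrame θ x i) * (θ i).d x ![v, w] := by
  have hW : IsOpen (U ∩ V) := hθ.isOpen.inter hV
  have hθW : CoframeOn θ (U ∩ V) := ⟨hW, fun i => (hθ.smooth i).mono Set.inter_subset_left,
    fun y hy => hθ.linearIndependent y hy.1⟩
  -- Only the coefficients with index in `s` survive in η. The Leibniz terms df_i ∧ θ_i vanish on
  -- `v`, `w`, which are annihilated by these θ_i.
  obtain ⟨g, hg⟩ := CovectorField.d_sum (ι := s) (θ := fun i => θ i)
    (f := fun i y => η y (dualFrame θ y i)) (α := η) hW (fun i => hθW.smooth i)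
    (fun i => hθW.smoothFun_covector (hη.mono Set.inter_subset_right) i) (fun y hy => by
      have hm := hηJ y hy.2
      rw [hJ y hy.1, mem_span_image_iff (hθ.linearIndependent y hy.1)] at hm
      conv_lhs => rw [covector_eq_sum (hθ.linearIndependent y hy.1) (η y)]
      rw [Finset.sum_coe_sort s (fun i => η y (dualFrame θ y i) • θ i y)]
      refine (Finset.sum_subset (Finset.subset_univ s) fun i _ hi => ?_).symm
      rw [hm i hi, zero_smul]) (x := x) ⟨hx, hxV⟩
  rw [hg, ← Finset.sum_coe_sort s]
  refine Finset.sum_congr rfl fun i _ => ?_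
  rw [hv i i.2, hw i i.2]
  ring

/-- The map δ is tensorial by `d_section`, so it can be computed on coframe coefficients.
Conversely, a covector of `J x` extends to a section of `J` with constant coefficients in the
coframe, which supplies the required local section. -/
theorem mem_derived_iff (hθ : CoframeOn θ U)
    (hJ : ∀ y ∈ U, J y = Submodule.span ℝ ((fun i => θ i y) '' s)) {x : X} (hx : x ∈ U)
    (α : TangentSpace 𝓘(ℝ, E4) x →L[ℝ] ℝ) :
    α ∈ J.derived x ↔ α ∈ J x ∧ ∀ v w, (∀ i ∈ s, θ i x v = 0) → (∀ i ∈ s, θ i x w = 0) →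
      ∑ i ∈ s, α (dualFrame θ x i) * (θ i).d x ![v, w] = 0 := by
  constructor
  · intro hα
    induction hα using Submodule.span_induction with
    | mem β hβ =>
      obtain ⟨V, hV, hxV, η, hη, hηJ, rfl, hd⟩ := hβ
      refine ⟨hηJ x hxV, fun v w hv hw => ?_⟩
      rw [← d_section hθ hJ hx hV hxV hη hηJ hv hw]
      exact hd v ((mem_perp_iff (hJ x hx) v).2 hv) w ((mem_perp_iff (hJ x hx) w).2 hw)
    | zero => exact ⟨Submodule.zero_mem _, fun v w _ _ => by simp⟩
    | add β γ _ _ hβ hγ =>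
      refine ⟨Submodule.add_mem _ hβ.1 hγ.1, fun v w hv hw => ?_⟩
      simp only [add_apply, add_mul, Finset.sum_add_distrib]
      rw [hβ.2 v w hv hw, hγ.2 v w hv hw, add_zero]
    | smul c β _ hβ =>
      refine ⟨Submodule.smul_mem _ _ hβ.1, fun v w hv hw => ?_⟩
      simp only [smul_apply, smul_eq_mul, mul_assoc]
      rw [← Finset.mul_sum, hβ.2 v w hv hw, mul_zero]
  · rintro ⟨hα, hd⟩
    let c : Fin 4 → ℝ := fun i => α (dualFrame θ x i)
    let η : CovectorField X := fun y => c 0 • θ 0 y + (c 1 • θ 1 y + (c 2 • θ 2 y + c 3 • θ 3 y))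
    have hη4 : ∀ y, η y = ∑ i, c i • θ i y := fun y => by
      simp only [Fin.sum_univ_four, η]; abel
    have hηx : η x = α := by
      rw [hη4, ← covector_eq_sum (hθ.linearIndependent x hx) α]
    have hs : ∀ i, (CovectorField.toForm fun y => c i • θ i y).SmoothOn U := fun i =>
      CovectorField.smoothOn_smul (f := fun _ => c i) hθ.isOpen (smoothFun_const _ _) (hθ.smooth i)
    have hη : η.toForm.SmoothOn U :=
      CovectorField.smoothOn_add hθ.isOpen (hs 0) (CovectorField.smoothOn_add hθ.isOpen (hs 1)
        (CovectorField.smoothOn_add hθ.isOpen (hs 2) (hs 3)))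
    have hηJ : ∀ y ∈ U, η y ∈ J y := fun y hy => by
      rw [hJ x hx, mem_span_image_iff (hθ.linearIndependent x hx)] at hα
      rw [hJ y hy, mem_span_image_iff (hθ.linearIndependent y hy)]
      intro i hi
      rw [hη4, sum_apply]
      refine Finset.sum_eq_zero fun j _ => ?_
      rw [smul_apply, dualFrame_apply (hθ.linearIndependent y hy)]
      split_ifs with h
      · simp [c, h, hα i hi]
      · simp
    refine Submodule.subset_span ⟨U, hθ.isOpen, hx, η, hη, hηJ, hηx, fun v hv w hw => ?_⟩
    rw [mem_perp_iff (hJ x hx)] at hv hw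
    rw [d_section hθ hJ hx hθ.isOpen hx hη hηJ hv hw, hηx, hd v w hv hw]

end Derived

/-! ### The exterior derivative of a wedge product of 1-forms -/

section DWedge

theorem extDeriv_wedge {a b : E4 → E4 →L[ℝ] ℝ} {y : E4} (ha : ContDiffAt ℝ ∞ a y)
    (hb : ContDiffAt ℝ ∞ b y) (t v w : E4) :
    extDeriv (fun z => wedge (a z) (b z)) y ![t, v, w] =
      (fderiv ℝ a y t v - fderiv ℝ a y v t) * b y w - (fderiv ℝ a y t w - fderiv ℝ a y w t) * b y v
      + (fderiv ℝ a y v w - fderiv ℝ a y w v) * b y t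
      - ((fderiv ℝ b y t v - fderiv ℝ b y v t) * a y w
      - (fderiv ℝ b y t w - fderiv ℝ b y w t) * a y v
      + (fderiv ℝ b y v w - fderiv ℝ b y w v) * a y t) := by
  have had := ha.differentiableAt (by simp)
  have hbd := hb.differentiableAt (by simp)
  have hd : DifferentiableAt ℝ (fun z => wedge (a z) (b z)) y := by
    refine ContDiffAt.differentiableAt (n := ∞) (contDiffAt_form_of_apply fun v => ?_) (by simp)
    have hv : v = ![v 0, v 1] := by ext i; fin_cases i <;> rfl
    rw [hv]
    simp only [wedge_apply]
    exact ((ha.clm_apply contDiffAt_const).mul (hb.clm_apply contDiffAt_const)).sub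
      ((ha.clm_apply contDiffAt_const).mul (hb.clm_apply contDiffAt_const))
  have key : ∀ {c : E4 → E4 →L[ℝ] ℝ}, DifferentiableAt ℝ c y → ∀ q : E4,
      HasFDerivAt (fun z => c z q) ((fderiv ℝ c y).flip q) y := fun {c} hc q => by
    have := hc.hasFDerivAt.clm_apply (hasFDerivAt_const q y)
    refine this.congr_fderiv ?_
    ext p; simp
  have key2 : ∀ p q r : E4, fderiv ℝ (fun z => wedge (a z) (b z) ![q, r]) y p =
      fderiv ℝ a y p q * b y r + a y q * fderiv ℝ b y p r
      - (fderiv ℝ a y p r * b y q + a y r * fderiv ℝ b y p q) := fun p q r => by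
    simp only [wedge_apply]
    have h : HasFDerivAt (fun z => a z q * b z r - a z r * b z q) _ y :=
      ((key had q).mul (key hbd r)).sub ((key had r).mul (key hbd q))
    rw [h.fderiv]
    simp only [sub_apply, add_apply, smul_apply, smul_eq_mul, ContinuousLinearMap.flip_apply]
    ring
  rw [extDeriv_apply hd, Fin.sum_univ_three]
  have e0 : (0 : Fin 3).removeNth ![t, v, w] = ![v, w] := rfl
  have e1 : (1 : Fin 3).removeNth ![t, v, w] = ![t, w] := by
    ext i; fin_cases i <;> rfl
  have e2 : (2 : Fin 3).removeNth ![t, v, w] = ![t, v] := by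
    ext i; fin_cases i <;> rfl
  rw [e0, e1, e2, key2, key2, key2]
  simp
  ring

variable {X : Type u} [TopologicalSpace X] [ChartedSpace E4 X] [IsManifold 𝓘(ℝ, E4) ∞ X]

theorem Form.d_wedge {α β : CovectorField X} {U : Set X} (hU : IsOpen U)
    (hα : α.toForm.SmoothOn U) (hβ : β.toForm.SmoothOn U) {x : X} (hx : x ∈ U)
    (t v w : TangentSpace 𝓘(ℝ, E4) x) :
    Form.d (fun y => wedge (α y) (β y)) x ![t, v, w] =
      α.d x ![t, v] * β x w - α.d x ![t, w] * β x v + α.d x ![v, w] * β x t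
      - (β.d x ![t, v] * α x w - β.d x ![t, w] * α x v + β.d x ![v, w] * α x t) := by
  have hm := mem_extChartAt_source (I := 𝓘(ℝ, E4)) x
  have hl := (extChartAt 𝓘(ℝ, E4) x).left_inv hm
  have ht := (extChartAt 𝓘(ℝ, E4) x).map_source hm
  have hxU : (extChartAt 𝓘(ℝ, E4) x).symm (extChartAt 𝓘(ℝ, E4) x x) ∈ U := by rwa [hl]
  have hac := CovectorField.contDiffAt hα hU ht hxU
  have hbc := CovectorField.contDiffAt hβ hU ht hxU
  simp only [CovectorField.d_apply (hac.differentiableAt (by simp)),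
    CovectorField.d_apply (hbc.differentiableAt (by simp)), ← CovectorField.inChart_chartDeriv]
  rw [← extDeriv_wedge hac hbc, ← Form.inChart_wedge]
  refine congrArg (extDeriv _ _) ?_
  ext i; fin_cases i <;> rfl

omit [IsManifold 𝓘(ℝ, E4) ∞ X] in
theorem Form.d_add {n : ℕ} {α β : Form X n} {U : Set X} (hU : IsOpen U) (hα : α.SmoothOn U)
    (hβ : β.SmoothOn U) {x : X} (hx : x ∈ U) :
    Form.d (fun y => α y + β y) x = α.d x + β.d x := by
  have hm := mem_extChartAt_source (I := 𝓘(ℝ, E4)) x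
  have hl := (extChartAt 𝓘(ℝ, E4) x).left_inv hm
  have ht := (extChartAt 𝓘(ℝ, E4) x).map_source hm
  have hxU : (extChartAt 𝓘(ℝ, E4) x).symm (extChartAt 𝓘(ℝ, E4) x x) ∈ U := by rwa [hl]
  have e : Form.inChart (fun y => α y + β y) x = fun z => α.inChart x z + β.inChart x z := rfl
  simp only [Form.d]
  rw [e, extDeriv_fun_add ((hα.contDiffAt hU ht hxU).differentiableAt (by simp))
    ((hβ.contDiffAt hU ht hxU).differentiableAt (by simp))]
  rfl

end DWedge

/-! ### The six families define Lie algebras -/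

/-- The bracket on `ℝ⁴` with structure constants `-C`. -/
def structBracket (C : Matrix (Fin 4) (Fin 6) ℝ) (x y : Fin 4 → ℝ) : Fin 4 → ℝ := fun i =>
  -∑ p : Fin 6, C i p * (x (pair p).1 * y (pair p).2 - x (pair p).2 * y (pair p).1)

/-- Bilinearity and antisymmetry are built into the formula for the bracket, so the Jacobi identity
is the only condition on the constants. -/
theorem isLieAlgebraStructure_of_jacobi {C : Matrix (Fin 4) (Fin 6) ℝ}
    (h : ∀ x y z, structBracket C x (structBracket C y z) =
      structBracket C (structBracket C x y) z + structBracket C y (structBracket C x z)) :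
    IsLieAlgebraStructure C := by
  let i1 : LieRing (Fin 4 → ℝ) :=
    { (inferInstance : AddCommGroup (Fin 4 → ℝ)) with
      bracket := structBracket C
      add_lie := fun x y z => by
        funext i
        change structBracket C (x + y) z i = structBracket C x z i + structBracket C y z i
        simp only [structBracket, Pi.add_apply]
        rw [← neg_add, ← Finset.sum_add_distrib]
        congr 1
        exact Finset.sum_congr rfl fun p _ => by ring
      lie_add := fun x y z => by
        funext i
        change structBracket C x (y + z) i = structBracket C x y i + structBracket C x z i
        simp only [structBracket, Pi.add_apply]
        rw [← neg_add, ← Finset.sum_add_distrib]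
        congr 1
        exact Finset.sum_congr rfl fun p _ => by ring
      lie_self := fun x => by
        funext i
        change structBracket C x x i = 0
        simp only [structBracket]
        rw [neg_eq_zero]
        exact Finset.sum_eq_zero fun p _ => by ring
      leibniz_lie := h }
  let i2 : LieAlgebra ℝ (Fin 4 → ℝ) :=
    { (inferInstance : Module ℝ (Fin 4 → ℝ)) with
      lie_smul := fun t x y => by
        funext i
        change structBracket C x (t • y) i = t * structBracket C x y i
        simp only [structBracket, Pi.smul_apply, smul_eq_mul]
        rw [mul_neg, Finset.mul_sum]
        congr 1
        exact Finset.sum_congr rfl fun p _ => by ring }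
  refine ⟨Fin 4 → ℝ, i1, i2, Pi.basisFun ℝ (Fin 4), fun i p => ?_⟩
  have hr : ∀ v : Fin 4 → ℝ, (Pi.basisFun ℝ (Fin 4)).repr v i = v i :=
    fun v => Pi.basisFun_repr ℝ (Fin 4) v i
  refine (hr _).trans ?_
  change structBracket C (Pi.basisFun ℝ (Fin 4) (pair p).1)
    (Pi.basisFun ℝ (Fin 4) (pair p).2) i = -C i p
  simp only [structBracket, neg_inj, Pi.basisFun_apply]
  rw [Finset.sum_eq_single p]
  · fin_cases p <;> simp [pair]
  · intro q _ hq
    fin_cases p <;> fin_cases q <;> simp [pair] at hq ⊢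
  · simp

/-- Each component of the Jacobi identity is a polynomial identity in `a`, `b` and the coordinates
of the three vectors. -/
theorem isLieAlgebraStructure_family (k : Fin 6) (a b : ℝ) :
    IsLieAlgebraStructure (family a b k) := by
  refine isLieAlgebraStructure_of_jacobi fun x y z => ?_
  funext i
  fin_cases k <;> fin_cases i <;>
  · simp only [structBracket, family, pair, Fin.sum_univ_six, Pi.add_apply, Fin.zero_eta,
      Fin.mk_one, Fin.reduceFinMk, Matrix.cons_val, Matrix.of_apply, Fin.isValue, zero_mul,
      add_zero, zero_add]
    ring

theorem twoForm_apply_eq_sum (β : E4 [⋀^Fin 2]→L[ℝ] ℝ) {θ : Fin 4 → E4 →L[ℝ] ℝ} {e : Fin 4 → E4}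
    (he : ∀ i j, θ i (e j) = if i = j then 1 else 0) (v w : E4) :
    β ![v, w] = ∑ p : Fin 6, β ![e (pair p).1, e (pair p).2] *
      (θ (pair p).1 v * θ (pair p).2 w - θ (pair p).1 w * θ (pair p).2 v) := by
  conv_lhs => rw [twoForm_eq_sum β he]
  simp only [Fin.sum_univ_six, ContinuousAlternatingMap.add_apply,
    ContinuousAlternatingMap.smul_apply, smul_eq_mul, wedge_apply]

/-! ### Coframings adapted to a Lagrangian Engel structure -/

section Adapted

variable {X : Type u} [TopologicalSpace X] [ChartedSpace E4 X]

theorem twoForm_apply_frame {θ : Fin 4 → CovectorField X} {x : X}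
    (h : LinearIndependent ℝ (fun i => θ i x))
    (β : TangentSpace 𝓘(ℝ, E4) x [⋀^Fin 2]→L[ℝ] ℝ) (v w : TangentSpace 𝓘(ℝ, E4) x) :
    β ![v, w] = ∑ p : Fin 6, β ![dualFrame θ x (pair p).1, dualFrame θ x (pair p).2] *
      (θ (pair p).1 x v * θ (pair p).2 x w - θ (pair p).1 x w * θ (pair p).2 x v) :=
  twoForm_apply_eq_sum (θ := fun i => θ i x) (e := dualFrame θ x) β (dualFrame_apply h) v w

theorem image_zero_one (θ : Fin 4 → CovectorField X) (x : X) :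
    (fun i => θ i x) '' (({0, 1} : Finset (Fin 4)) : Set (Fin 4)) = {θ 0 x, θ 1 x} := by
  simp [Set.image_pair]

theorem image_zero (θ : Fin 4 → CovectorField X) (x : X) :
    (fun i => θ i x) '' (({0} : Finset (Fin 4)) : Set (Fin 4)) = {θ 0 x} := by
  simp

variable [IsManifold 𝓘(ℝ, E4) ∞ X]

/-- On the plane spanned by e₂, e₃ there is, up to scale, one 2-form, so δ is a single linear
functional on `I x`. The hypotheses say that it kills θ₀ but not θ₁. -/
theorem derived_eq_span {θ : Fin 4 → CovectorField X} {U : Set X} (hθ : CoframeOn θ U)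
    {I : PfaffianSystem X} (hI : ∀ y ∈ U, I y = Submodule.span ℝ {θ 0 y, θ 1 y}) {x : X}
    (hx : x ∈ U) (h0 : (θ 0).d x ![dualFrame θ x 2, dualFrame θ x 3] = 0)
    (h1 : (θ 1).d x ![dualFrame θ x 2, dualFrame θ x 3] ≠ 0) :
    I.derived x = Submodule.span ℝ {θ 0 x} := by
  have hi := hθ.linearIndependent x hx
  have hI' : ∀ y ∈ U, I y = Submodule.span ℝ
      ((fun i => θ i y) '' (({0, 1} : Finset (Fin 4)) : Set (Fin 4))) := fun y hy => by
    rw [image_zero_one, hI y hy]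
  ext α
  rw [mem_derived_iff hθ hI' hx, hI' x hx, ← image_zero, mem_span_image_iff hi,
    mem_span_image_iff hi]
  constructor
  · rintro ⟨hα, hd⟩ i hi0
    have := hd (dualFrame θ x 2) (dualFrame θ x 3)
      (by simp [dualFrame_apply hi]) (by simp [dualFrame_apply hi])
    rw [Finset.sum_pair (by decide), h0, mul_zero, zero_add] at this
    have h1' := (mul_eq_zero.1 this).resolve_right h1
    by_cases hi1 : i = 1
    · rw [hi1, h1']
    · exact hα i (by simp_all)
  · intro hα
    refine ⟨fun i hi0 => hα i (by simp_all), fun v w hv hw => ?_⟩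
    rw [Finset.sum_pair (by decide), hα 1 (by decide), zero_mul, add_zero]
    have hv0 := hv 0 (by decide)
    have hv1 := hv 1 (by decide)
    rw [twoForm_apply_frame hi]
    simp only [Fin.sum_univ_six, pair, Matrix.cons_val, hv 0 (by decide), hv 1 (by decide),
      hw 0 (by decide), hw 1 (by decide), h0]
    ring

/-- Under either alternative dθ₀ is nonzero on the kernel of θ₀, so δ is injective on the line
spanned by θ₀. -/
theorem derived_eq_bot {θ : Fin 4 → CovectorField X} {U : Set X} (hθ : CoframeOn θ U)
    {J : PfaffianSystem X} (hJ : ∀ y ∈ U, J y = Submodule.span ℝ {θ 0 y}) {x : X}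
    (hx : x ∈ U) (h : (θ 0).d x ![dualFrame θ x 1, dualFrame θ x 2] ≠ 0 ∨
      (θ 0).d x ![dualFrame θ x 1, dualFrame θ x 3] ≠ 0) :
    J.derived x = ⊥ := by
  have hi := hθ.linearIndependent x hx
  have hJ' : ∀ y ∈ U, J y = Submodule.span ℝ
      ((fun i => θ i y) '' (({0} : Finset (Fin 4)) : Set (Fin 4))) := fun y hy => by
    rw [image_zero, hJ y hy]
  rw [eq_bot_iff]
  intro α hα
  rw [mem_derived_iff hθ hJ' hx, hJ' x hx, mem_span_image_iff hi] at hα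
  have h0 : α (dualFrame θ x 0) = 0 := by
    rcases h with h | h
    · have := hα.2 (dualFrame θ x 1) (dualFrame θ x 2)
        (by simp [dualFrame_apply hi]) (by simp [dualFrame_apply hi])
      rw [Finset.sum_singleton] at this
      exact (mul_eq_zero.1 this).resolve_right h
    · have := hα.2 (dualFrame θ x 1) (dualFrame θ x 3)
        (by simp [dualFrame_apply hi]) (by simp [dualFrame_apply hi])
      rw [Finset.sum_singleton] at this
      exact (mul_eq_zero.1 this).resolve_right h
  rw [Submodule.mem_bot]
  refine covector_ext hi fun i => ?_
  by_cases hi0 : i = 0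
  · rw [hi0, h0]; rfl
  · rw [hα.1 i (by simpa using hi0)]; rfl

omit [IsManifold 𝓘(ℝ, E4) ∞ X] in
theorem isSubbundle_of_coframe {θ : Fin 4 → CovectorField X} (hθ : IsCoframing θ) {r : ℕ}
    {J : PfaffianSystem X} (c : Fin r → Fin 4) (hc : Function.Injective c)
    (hJ : ∀ x, J x = Submodule.span ℝ (Set.range fun i => θ (c i) x)) : J.IsSubbundle r :=
  fun _ => ⟨Set.univ, isOpen_univ, trivial, fun i => θ (c i), fun i => hθ.smooth (c i),
    fun y _ => ⟨(hθ.linearIndependent y).comp c hc, hJ y⟩⟩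

omit [IsManifold 𝓘(ℝ, E4) ∞ X] in
theorem IsCoframing.coframeOn {θ : Fin 4 → CovectorField X} (hθ : IsCoframing θ) :
    CoframeOn θ Set.univ :=
  ⟨isOpen_univ, hθ.smooth, fun x _ => hθ.linearIndependent x⟩

/-- The symplectic form `θ₁ ∧ θ₃ + θ₂ ∧ θ₄` of a coframing. -/
def coframeForm (θ : Fin 4 → CovectorField X) : Form X 2 :=
  fun x => wedge (θ 0 x) (θ 2 x) + wedge (θ 1 x) (θ 3 x)

omit [IsManifold 𝓘(ℝ, E4) ∞ X] in
theorem coframeForm_smoothOn {θ : Fin 4 → CovectorField X} {U : Set X} (hθ : CoframeOn θ U) :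
    (coframeForm θ).SmoothOn U :=
  Form.smoothOn_add hθ.isOpen (Form.smoothOn_wedge hθ.isOpen (hθ.smooth 0) (hθ.smooth 2))
    (Form.smoothOn_wedge hθ.isOpen (hθ.smooth 1) (hθ.smooth 3))

theorem coframeForm_d {θ : Fin 4 → CovectorField X} {U : Set X} (hθ : CoframeOn θ U) {x : X}
    (hx : x ∈ U) (t v w : TangentSpace 𝓘(ℝ, E4) x) :
    (coframeForm θ).d x ![t, v, w] =
      (θ 0).d x ![t, v] * θ 2 x w - (θ 0).d x ![t, w] * θ 2 x v + (θ 0).d x ![v, w] * θ 2 x t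
      - ((θ 2).d x ![t, v] * θ 0 x w - (θ 2).d x ![t, w] * θ 0 x v + (θ 2).d x ![v, w] * θ 0 x t)
      + ((θ 1).d x ![t, v] * θ 3 x w - (θ 1).d x ![t, w] * θ 3 x v + (θ 1).d x ![v, w] * θ 3 x t
      - ((θ 3).d x ![t, v] * θ 1 x w - (θ 3).d x ![t, w] * θ 1 x v
        + (θ 3).d x ![v, w] * θ 1 x t)) := by
  unfold coframeForm
  rw [Form.d_add hθ.isOpen (Form.smoothOn_wedge hθ.isOpen (hθ.smooth 0) (hθ.smooth 2))
    (Form.smoothOn_wedge hθ.isOpen (hθ.smooth 1) (hθ.smooth 3)) hx,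
    ContinuousAlternatingMap.add_apply, Form.d_wedge hθ.isOpen (hθ.smooth 0) (hθ.smooth 2) hx,
    Form.d_wedge hθ.isOpen (hθ.smooth 1) (hθ.smooth 3) hx]

/-- A coframing whose symplectic form is closed and whose first two forms generate an Engel system
is 0-adapted to a Lagrangian Engel structure. -/
theorem exists_isZeroAdapted {θ : Fin 4 → CovectorField X} (hθ : IsCoframing θ)
    (hclosed : ∀ x, (coframeForm θ).d x = 0)
    (h0 : ∀ x, (θ 0).d x ![dualFrame θ x 2, dualFrame θ x 3] = 0)
    (h1 : ∀ x, (θ 1).d x ![dualFrame θ x 2, dualFrame θ x 3] ≠ 0)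
    (h2 : ∀ x, (θ 0).d x ![dualFrame θ x 1, dualFrame θ x 2] ≠ 0 ∨
      (θ 0).d x ![dualFrame θ x 1, dualFrame θ x 3] ≠ 0) :
    ∃ S : LagrangianEngel X, S.IsZeroAdapted θ := by
  let I : PfaffianSystem X := fun x => Submodule.span ℝ {θ 0 x, θ 1 x}
  have hder : ∀ x, I.derived x = Submodule.span ℝ {θ 0 x} := fun x =>
    derived_eq_span hθ.coframeOn (fun _ _ => rfl) trivial (h0 x) (h1 x)
  have hperp : ∀ x, ∀ v ∈ I.perp x, θ 0 x v = 0 ∧ θ 1 x v = 0 := fun x v hv =>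
    ⟨hv _ (Submodule.subset_span (by simp)), hv _ (Submodule.subset_span (by simp))⟩
  refine ⟨⟨coframeForm θ, I, ⟨coframeForm_smoothOn hθ.coframeOn, hclosed, ?_⟩, ⟨?_, ?_, ?_⟩, ?_⟩,
    hθ, fun _ => rfl, fun _ => rfl, hder⟩
  · intro x v hv
    have hi := hθ.linearIndependent x
    have hv' : ∀ w, θ 0 x v * θ 2 x w - θ 0 x w * θ 2 x v
        + (θ 1 x v * θ 3 x w - θ 1 x w * θ 3 x v) = 0 := fun w => by
      have := hv w
      rwa [coframeForm, ContinuousAlternatingMap.add_apply, wedge_apply, wedge_apply] at this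
    refine tangent_ext hi fun i => ?_
    rw [map_zero]
    -- Pairing `v` under Ω with the four frame vectors gives, up to sign and order, the four coframe
    -- components of `v`.
    have a0 := hv' (dualFrame θ x 0)
    have a1 := hv' (dualFrame θ x 1)
    have a2 := hv' (dualFrame θ x 2)
    have a3 := hv' (dualFrame θ x 3)
    simp only [dualFrame_apply hi] at a0 a1 a2 a3
    simp at a0 a1 a2 a3
    fin_cases i <;> assumption
  · refine isSubbundle_of_coframe hθ ![0, 1] (by decide) fun x => ?_
    have : (Set.range fun i : Fin 2 => θ (![0, 1] i) x) = {θ 0 x, θ 1 x} := by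
      ext α
      simp [Fin.exists_fin_two, @eq_comm _ α]
    rw [this]
  · refine isSubbundle_of_coframe hθ ![0] (Function.injective_of_subsingleton _) fun x => ?_
    have : (Set.range fun i : Fin 1 => θ (![0] i) x) = {θ 0 x} := by
      ext α
      simp
    rw [this, hder]
  · exact fun x => derived_eq_bot hθ.coframeOn (fun y _ => hder y) trivial (h2 x)
  · intro x v hv w hw
    rw [coframeForm, ContinuousAlternatingMap.add_apply, wedge_apply, wedge_apply,
      (hperp x v hv).1, (hperp x v hv).2, (hperp x w hw).1, (hperp x w hw).2]
    ring

omit [IsManifold 𝓘(ℝ, E4) ∞ X] in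
theorem SatisfiesStructureEq.apply {θ : Fin 4 → CovectorField X} {C : Matrix (Fin 4) (Fin 6) ℝ}
    (h : SatisfiesStructureEq θ C) (i : Fin 4) (x : X) (v w : TangentSpace 𝓘(ℝ, E4) x) :
    (θ i).d x ![v, w] = ∑ p : Fin 6, C i p *
      (θ (pair p).1 x v * θ (pair p).2 x w - θ (pair p).1 x w * θ (pair p).2 x v) := by
  rw [h i x]
  simp only [Fin.sum_univ_six, ContinuousAlternatingMap.add_apply,
    ContinuousAlternatingMap.smul_apply, smul_eq_mul, wedge_apply]

omit [IsManifold 𝓘(ℝ, E4) ∞ X] in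
theorem SatisfiesStructureEq.apply_frame {θ : Fin 4 → CovectorField X}
    {C : Matrix (Fin 4) (Fin 6) ℝ} (h : SatisfiesStructureEq θ C) (i : Fin 4) {x : X}
    (hi : LinearIndependent ℝ (fun i => θ i x)) (p : Fin 6) :
    (θ i).d x ![dualFrame θ x (pair p).1, dualFrame θ x (pair p).2] = C i p := by
  rw [h.apply]
  simp only [dualFrame_apply hi]
  fin_cases p <;> simp [Fin.sum_univ_six, pair]

theorem exists_isZeroAdapted_family {θ : Fin 4 → CovectorField X} (hθ : IsCoframing θ)
    {k : Fin 6} {a b : ℝ} (h : SatisfiesStructureEq θ (family a b k)) :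
    ∃ S : LagrangianEngel X, S.IsZeroAdapted θ := by
  refine exists_isZeroAdapted hθ (fun x => ?_)
    (fun x => (h.apply_frame 0 (hθ.linearIndependent x) 5).trans ?_)
    (fun x => (h.apply_frame 1 (hθ.linearIndependent x) 5).trans_ne ?_)
    (fun x => ?_)
  -- With the structure equations inserted, dΩ = 0 becomes a polynomial identity in the coframe
  -- components of three vectors and in `a`, `b`.
  · ext t
    have ht : t = ![t 0, t 1, t 2] := by ext i; fin_cases i <;> rfl
    rw [ht, coframeForm_d hθ.coframeOn trivial]
    change _ = (0 : ℝ)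
    simp only [h.apply, Fin.sum_univ_six]
    fin_cases k <;>
    · simp only [family, pair, Fin.zero_eta, Fin.mk_one, Fin.reduceFinMk, Matrix.cons_val,
        Matrix.of_apply, Fin.isValue, zero_mul, add_zero, zero_add]
      ring
  · fin_cases k <;> rfl
  · fin_cases k <;> exact one_ne_zero
  · have e1 := h.apply_frame 0 (hθ.linearIndependent x) 3
    have e2 := h.apply_frame 0 (hθ.linearIndependent x) 4
    change (θ 0).d x ![dualFrame θ x 1, dualFrame θ x 2] = _ at e1
    change (θ 0).d x ![dualFrame θ x 1, dualFrame θ x 3] = _ at e2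
    rw [e1, e2]
    fin_cases k
    · exact Or.inl one_ne_zero
    · exact Or.inl one_ne_zero
    · exact Or.inl one_ne_zero
    · exact Or.inl one_ne_zero
    · exact Or.inr one_ne_zero
    · exact Or.inr one_ne_zero

end Adapted

/-! ### Stokes' theorem on a compact manifold -/

section TopForms

/-- The value of a 4-form on the standard basis of `ℝ⁴`. -/
def topValue (μ : E4 [⋀^Fin 4]→L[ℝ] ℝ) : ℝ :=
  μ fun i => (EuclideanSpace.basisFun (Fin 4) ℝ).toBasis i

/-- The space of 4-forms on `ℝ⁴` is a line, spanned by the determinant. -/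
theorem topForm_ext {μ ν : E4 [⋀^Fin 4]→L[ℝ] ℝ} (h : topValue μ = topValue ν) : μ = ν := by
  apply ContinuousAlternatingMap.toAlternatingMap_injective
  rw [AlternatingMap.eq_smul_basis_det (EuclideanSpace.basisFun (Fin 4) ℝ).toBasis
    μ.toAlternatingMap, AlternatingMap.eq_smul_basis_det
    (EuclideanSpace.basisFun (Fin 4) ℝ).toBasis ν.toAlternatingMap]
  exact congrArg (· • _) h

theorem topValue_smul (c : ℝ) (μ : E4 [⋀^Fin 4]→L[ℝ] ℝ) :
    topValue (c • μ) = c * topValue μ := rfl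

theorem topValue_comp (μ : E4 [⋀^Fin 4]→L[ℝ] ℝ) (L : E4 →L[ℝ] E4) :
    topValue (μ.compContinuousLinearMap L) = L.det * topValue μ := by
  let b := (EuclideanSpace.basisFun (Fin 4) ℝ).toBasis
  have h := AlternatingMap.eq_smul_basis_det b μ.toAlternatingMap
  have h2 : topValue (μ.compContinuousLinearMap L) = μ.toAlternatingMap fun i => L (b i) := rfl
  rw [h2, h, AlternatingMap.smul_apply, smul_eq_mul, mul_comm]
  congr 1
  have := b.det_comp_basis b (L : E4 →ₗ[ℝ] E4)
  exact this

theorem ContDiffAt.topValue {ν : E4 → E4 [⋀^Fin 4]→L[ℝ] ℝ} {y : E4} (h : ContDiffAt ℝ ∞ ν y) :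
    ContDiffAt ℝ ∞ (fun z => topValue (ν z)) y :=
  ContDiffAt.form_apply h fun _ => contDiffAt_const

end TopForms

/-! ### Stokes' theorem with compact support on `ℝ⁴`. -/

section Flat

open MeasureTheory

variable {V : Type*} [NormedAddCommGroup V] [NormedSpace ℝ V]

/-- At points outside `W`, the complement of `K` is a neighbourhood on which the extension by zero
vanishes. -/
theorem contDiff_indicator {W K : Set E4} (hW : IsOpen W) (hK : IsCompact K) (hKW : K ⊆ W)
    {F : E4 → V} {n : WithTop ℕ∞} (hF : ∀ y ∈ W, ContDiffAt ℝ n F y)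
    (h0 : ∀ y ∈ W, y ∉ K → F y = 0) : ContDiff ℝ n (W.indicator F) := by
  rw [contDiff_iff_contDiffAt]
  intro y
  by_cases hy : y ∈ W
  · refine (hF y hy).congr_of_eventuallyEq ?_
    filter_upwards [hW.mem_nhds hy] with z hz
    rw [Set.indicator_of_mem hz]
  · refine (contDiffAt_const (c := (0 : V))).congr_of_eventuallyEq ?_
    filter_upwards [hK.isClosed.isOpen_compl.mem_nhds fun h => hy (hKW h)] with z hz
    by_cases hzW : z ∈ W
    · rw [Set.indicator_of_mem hzW, h0 z hzW hz]
    · rw [Set.indicator_of_notMem hzW]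

omit [NormedSpace ℝ V] in
theorem hasCompactSupport_indicator {W K : Set E4} (hK : IsCompact K)
    {F : E4 → V} (h0 : ∀ y ∈ W, y ∉ K → F y = 0) : HasCompactSupport (W.indicator F) := by
  refine HasCompactSupport.intro hK fun y hy => ?_
  by_cases hyW : y ∈ W
  · rw [Set.indicator_of_mem hyW, h0 y hyW hy]
  · rw [Set.indicator_of_notMem hyW]

/-- Integration by parts against the constant function 1. -/
theorem integral_fderiv_eq_zero {f : E4 → ℝ} (hf : ContDiff ℝ 1 f) (hs : HasCompactSupport f)
    (v : E4) : ∫ y, fderiv ℝ f y v = 0 := by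
  have hc : Continuous fun y => fderiv ℝ f y v :=
    (hf.continuous_fderiv (by simp)).clm_apply continuous_const
  have hi : Integrable (fun y => fderiv ℝ f y v) :=
    hc.integrable_of_hasCompactSupport (hs.fderiv_apply (𝕜 := ℝ) v)
  have hi2 : Integrable f := hf.continuous.integrable_of_hasCompactSupport hs
  have := integral_mul_fderiv_eq_neg_fderiv_mul_of_integrable
    (μ := (volume : Measure E4)) (f := fun _ : E4 => (1 : ℝ)) (g := f) (v := v)
    (by simp) (by simpa using hi) (by simpa using hi2)
    (fun x _ => differentiableAt_const _) (fun x _ => (hf.differentiable (by simp)) x)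
  simpa using this

/-- Stokes' theorem for compactly supported forms on `ℝ⁴`. -/
theorem integral_extDeriv_eq_zero {ζ : E4 → E4 [⋀^Fin 3]→L[ℝ] ℝ} (hζ : ContDiff ℝ ∞ ζ)
    (hs : HasCompactSupport ζ) : ∫ y, topValue (extDeriv ζ y) = 0 := by
  let b := (EuclideanSpace.basisFun (Fin 4) ℝ).toBasis
  have h1 : ∀ i : Fin 4, ContDiff ℝ 1 (fun y => ζ y (i.removeNth fun i => b i)) := fun i =>
    contDiff_iff_contDiffAt.2 fun y => (ContDiffAt.form_apply (hζ.contDiffAt)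
      (fun _ => contDiffAt_const)).of_le (by exact_mod_cast le_top)
  have h2 : ∀ i : Fin 4, HasCompactSupport (fun y => ζ y (i.removeNth fun i => b i)) := fun i =>
    hs.comp_left (g := fun μ : E4 [⋀^Fin 3]→L[ℝ] ℝ => μ (i.removeNth fun i => b i)) rfl
  have e : (fun y => topValue (extDeriv ζ y)) = fun y => ∑ i : Fin 4, (-1 : ℝ) ^ i.val *
      fderiv ℝ (fun y => ζ y (i.removeNth fun i => b i)) y (b i) := by
    funext y
    rw [topValue, extDeriv_apply (hζ.differentiable (by simp) y)]
    exact Finset.sum_congr rfl fun i _ => by rw [zsmul_eq_mul]; push_cast; rfl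
  rw [e, integral_finsetSum]
  · refine Finset.sum_eq_zero fun i _ => ?_
    rw [integral_const_mul, integral_fderiv_eq_zero (h1 i) (h2 i), mul_zero]
  · intro i _
    refine Integrable.const_mul ?_ _
    exact (((h1 i).continuous_fderiv (by simp)).clm_apply
      continuous_const).integrable_of_hasCompactSupport ((h2 i).fderiv_apply (𝕜 := ℝ) _)

end Flat

/-! ### Integration against the density of a nowhere vanishing 4-form. -/

section Stokes

open MeasureTheory

variable {N : Type u} [TopologicalSpace N] [ChartedSpace E4 N]

theorem extDeriv_const_zero (n : ℕ) (y : E4) :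
    extDeriv (fun _ : E4 => (0 : E4 [⋀^Fin n]→L[ℝ] ℝ)) y = 0 := by
  ext v
  simp [extDeriv, ContinuousAlternatingMap.alternatizeUncurryFin_apply]

/-- The integral of `h` against the density `|ν|` over the domain of the chart centred at `c`. -/
def chartIntegral (ν : Form N 4) (c : N) (h : N → ℝ) : ℝ :=
  ∫ y in (extChartAt 𝓘(ℝ, E4) c).target,
    h ((extChartAt 𝓘(ℝ, E4) c).symm y) * |topValue (ν.inChart c y)|

theorem exists_eq_smul_of_ne_zero (μ : Form N 4) {ν : Form N 4} (hν : ∀ x, ν x ≠ 0) :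
    ∃ k : N → ℝ, ∀ x, μ x = k x • ν x := by
  have key : ∀ x, ∃ t : ℝ, μ x = t • ν x := fun x => by
    let m : E4 [⋀^Fin 4]→L[ℝ] ℝ := μ x
    let n : E4 [⋀^Fin 4]→L[ℝ] ℝ := ν x
    have hn : topValue n ≠ 0 := fun h => hν x (topForm_ext (μ := n) (ν := 0) h)
    refine ⟨topValue m / topValue n, topForm_ext (μ := m) ?_⟩
    change _ = topValue ((topValue m / topValue n) • n)
    rw [topValue_smul, div_mul_cancel₀ _ hn]
  choose k hk using key
  exact ⟨k, hk⟩

variable [IsManifold 𝓘(ℝ, E4) ∞ N]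

theorem topValue_inChart_ne_zero {ν : Form N 4} (hν : ∀ x, ν x ≠ 0) (c : N) {y : E4}
    (hy : y ∈ (extChartAt 𝓘(ℝ, E4) c).target) : topValue (ν.inChart c y) ≠ 0 := by
  intro h
  have h0 : ν.inChart c y = 0 := topForm_ext (ν := 0) h
  refine hν ((extChartAt 𝓘(ℝ, E4) c).symm y) ?_
  ext v
  have e : ν.inChart c y (fun i => mfderiv 𝓘(ℝ, E4) 𝓘(ℝ, E4) (extChartAt 𝓘(ℝ, E4) c)
      ((extChartAt 𝓘(ℝ, E4) c).symm y) (v i)) = ν ((extChartAt 𝓘(ℝ, E4) c).symm y) v := by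
    refine congrArg (ν _) ?_
    funext i
    exact mfderiv_symm_comp_mfderiv_symm c hy (v i)
  rw [← e, h0]
  rfl

omit [IsManifold 𝓘(ℝ, E4) ∞ N] in
theorem continuousOn_topValue {ν : Form N 4} (hνs : ν.SmoothOn Set.univ) (c : N) :
    ContinuousOn (fun y => topValue (ν.inChart c y)) (extChartAt 𝓘(ℝ, E4) c).target := fun _ hy =>
  (ContDiffAt.topValue
    (hνs.contDiffAt isOpen_univ hy trivial)).continuousAt.continuousWithinAt

/-- In a chart `k` is the quotient of the top coefficients of μ and ν, and the denominator never
vanishes. -/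
theorem smoothFun_of_eq_smul {μ ν : Form N 4} (hμ : μ.SmoothOn Set.univ)
    (hνs : ν.SmoothOn Set.univ) (hν : ∀ x, ν x ≠ 0) {k : N → ℝ} (hk : ∀ x, μ x = k x • ν x) :
    SmoothFun k Set.univ := fun c y hy _ => by
  have h1 := ContDiffAt.topValue (hμ.contDiffAt isOpen_univ hy trivial)
  have h2 := ContDiffAt.topValue (hνs.contDiffAt isOpen_univ hy trivial)
  refine (h1.div h2 (topValue_inChart_ne_zero hν c hy)).congr_of_eventuallyEq ?_
  filter_upwards [(isOpen_extChartAt_target c).mem_nhds hy] with z hz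
  change k _ = topValue (μ.inChart c z) / topValue (ν.inChart c z)
  rw [eq_div_iff (topValue_inChart_ne_zero hν c hz)]
  simp only [Form.inChart]
  rw [hk]
  rfl

theorem topValue_inChart_transition (ν : Form N 4) {c c' : N} {y : E4}
    (hy : y ∈ (extChartAt 𝓘(ℝ, E4) c).target)
    (hy' : (extChartAt 𝓘(ℝ, E4) c).symm y ∈ (extChartAt 𝓘(ℝ, E4) c').source) :
    topValue (ν.inChart c y) =
      (fderiv ℝ (extChartAt 𝓘(ℝ, E4) c' ∘ (extChartAt 𝓘(ℝ, E4) c).symm) y).det *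
        topValue (ν.inChart c' (extChartAt 𝓘(ℝ, E4) c' ((extChartAt 𝓘(ℝ, E4) c).symm y))) := by
  rw [← topValue_comp]
  exact congrArg topValue
    (ν.pull_eventuallyEq (contMDiffAt_extChartAt_symm c hy) c' hy').self_of_nhds

/-- This is the change of variables formula on the overlap of the two charts. The absolute value in
the density absorbs the absolute Jacobian determinant, so no orientation has to be chosen. -/
theorem chartIntegral_eq (ν : Form N 4) {c c' : N} {h : N → ℝ}
    (hh : ∀ x, h x ≠ 0 → x ∈ (extChartAt 𝓘(ℝ, E4) c).source ∧
      x ∈ (extChartAt 𝓘(ℝ, E4) c').source) :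
    chartIntegral ν c h = chartIntegral ν c' h := by
  have restrict : ∀ a a' : N, (∀ x, h x ≠ 0 → x ∈ (extChartAt 𝓘(ℝ, E4) a').source) →
      chartIntegral ν a h = ∫ y in (extChartAt 𝓘(ℝ, E4) a).target ∩
        (extChartAt 𝓘(ℝ, E4) a).symm ⁻¹' (extChartAt 𝓘(ℝ, E4) a').source,
        h ((extChartAt 𝓘(ℝ, E4) a).symm y) * |topValue (ν.inChart a y)| := fun a a' ha => by
    refine setIntegral_eq_of_subset_of_forall_sdiff_eq_zero
      (isOpen_extChartAt_target a).measurableSet Set.inter_subset_left fun y hy => ?_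
    by_cases h0 : h ((extChartAt 𝓘(ℝ, E4) a).symm y) = 0
    · rw [h0, zero_mul]
    · exact absurd ⟨hy.1, ha _ h0⟩ hy.2
  rw [restrict c c' fun x hx => (hh x hx).2, restrict c' c fun x hx => (hh x hx).1]
  set φ := extChartAt 𝓘(ℝ, E4) c with hφ
  set ψ := extChartAt 𝓘(ℝ, E4) c' with hψ
  have hA : IsOpen (φ.target ∩ φ.symm ⁻¹' ψ.source) :=
    isOpen_chart_preimage c (isOpen_extChartAt_source c')
  have him : (ψ ∘ φ.symm) '' (φ.target ∩ φ.symm ⁻¹' ψ.source) =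
      ψ.target ∩ ψ.symm ⁻¹' φ.source := by
    ext z
    constructor
    · rintro ⟨y, hy, rfl⟩
      refine ⟨ψ.map_source hy.2, ?_⟩
      simp only [Set.mem_preimage, Function.comp_apply]
      rw [ψ.left_inv hy.2]
      exact φ.map_target hy.1
    · rintro ⟨hz1, hz2⟩
      refine ⟨φ (ψ.symm z), ⟨φ.map_source hz2, ?_⟩, ?_⟩
      · simp only [Set.mem_preimage]
        rw [φ.left_inv hz2]
        exact ψ.map_target hz1
      · simp only [Function.comp_apply]
        rw [φ.left_inv hz2, ψ.right_inv hz1]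
  have hd : ∀ y ∈ φ.target ∩ φ.symm ⁻¹' ψ.source,
      HasFDerivWithinAt (ψ ∘ φ.symm) (fderiv ℝ (ψ ∘ φ.symm) y)
        (φ.target ∩ φ.symm ⁻¹' ψ.source) y := fun y hy => by
    have h1 : ContMDiffAt 𝓘(ℝ, E4) 𝓘(ℝ, E4) ∞ (ψ ∘ φ.symm) y :=
      (contMDiffAt_extChartAt_of_mem c' hy.2).comp y (contMDiffAt_extChartAt_symm c hy.1)
    exact (h1.contDiffAt.differentiableAt (by simp)).hasFDerivAt.hasFDerivWithinAt
  have hinj : Set.InjOn (ψ ∘ φ.symm) (φ.target ∩ φ.symm ⁻¹' ψ.source) := fun y hy z hz hyz => by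
    have h1 := ψ.injOn hy.2 hz.2 hyz
    exact φ.symm.injOn hy.1 hz.1 h1
  rw [← him, integral_image_eq_integral_abs_det_fderiv_smul _ hA.measurableSet hd hinj]
  refine setIntegral_congr_fun hA.measurableSet fun y hy => ?_
  simp only [Function.comp_apply, smul_eq_mul]
  rw [ψ.left_inv hy.2, topValue_inChart_transition ν hy.1 hy.2, abs_mul]
  ring

variable [CompactSpace N]

omit [IsManifold 𝓘(ℝ, E4) ∞ N] in
theorem isCompact_chart_image (c : N) {h : N → ℝ}
    (hs : tsupport h ⊆ (extChartAt 𝓘(ℝ, E4) c).source) :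
    IsCompact (extChartAt 𝓘(ℝ, E4) c '' tsupport h) :=
  (isClosed_tsupport h).isCompact.image_of_continuousOn ((continuousOn_extChartAt c).mono hs)

omit [IsManifold 𝓘(ℝ, E4) ∞ N] [CompactSpace N] in
theorem chart_image_subset (c : N) {h : N → ℝ}
    (hs : tsupport h ⊆ (extChartAt 𝓘(ℝ, E4) c).source) :
    extChartAt 𝓘(ℝ, E4) c '' tsupport h ⊆ (extChartAt 𝓘(ℝ, E4) c).target := by
  rintro _ ⟨x, hx, rfl⟩
  exact (extChartAt 𝓘(ℝ, E4) c).map_source (hs hx)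

omit [IsManifold 𝓘(ℝ, E4) ∞ N] [CompactSpace N] in
theorem eq_zero_of_notMem_chart_image (c : N) {h : N → ℝ} {y : E4}
    (hy : y ∈ (extChartAt 𝓘(ℝ, E4) c).target) (hyK : y ∉ extChartAt 𝓘(ℝ, E4) c '' tsupport h) :
    (extChartAt 𝓘(ℝ, E4) c).symm y ∉ tsupport h := fun hx =>
  hyK ⟨_, hx, (extChartAt 𝓘(ℝ, E4) c).right_inv hy⟩

omit [IsManifold 𝓘(ℝ, E4) ∞ N] in
theorem continuous_chart_integrand {ν : Form N 4} (hνs : ν.SmoothOn Set.univ) (c : N) {h : N → ℝ}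
    (hc : Continuous h) (hs : tsupport h ⊆ (extChartAt 𝓘(ℝ, E4) c).source) :
    Continuous ((extChartAt 𝓘(ℝ, E4) c).target.indicator
      fun y => h ((extChartAt 𝓘(ℝ, E4) c).symm y) * |topValue (ν.inChart c y)|) ∧
    HasCompactSupport ((extChartAt 𝓘(ℝ, E4) c).target.indicator
      fun y => h ((extChartAt 𝓘(ℝ, E4) c).symm y) * |topValue (ν.inChart c y)|) := by
  have h0 : ∀ y ∈ (extChartAt 𝓘(ℝ, E4) c).target, y ∉ extChartAt 𝓘(ℝ, E4) c '' tsupport h →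
      h ((extChartAt 𝓘(ℝ, E4) c).symm y) * |topValue (ν.inChart c y)| = 0 := fun y hy hyK => by
    rw [image_eq_zero_of_notMem_tsupport (eq_zero_of_notMem_chart_image c hy hyK), zero_mul]
  refine ⟨contDiff_zero.1 (contDiff_indicator (isOpen_extChartAt_target c)
    (isCompact_chart_image c hs) (chart_image_subset c hs) (fun y hy => ?_) h0),
    hasCompactSupport_indicator (isCompact_chart_image c hs) h0⟩
  refine (contDiffOn_zero.2 ?_).contDiffAt ((isOpen_extChartAt_target c).mem_nhds hy)
  exact (hc.comp_continuousOn (continuousOn_extChartAt_symm c)).mul (continuousOn_topValue hνs c).abs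

omit [IsManifold 𝓘(ℝ, E4) ∞ N] in
theorem integrableOn_chart_integrand {ν : Form N 4} (hνs : ν.SmoothOn Set.univ) (c : N) {h : N → ℝ}
    (hc : Continuous h) (hs : tsupport h ⊆ (extChartAt 𝓘(ℝ, E4) c).source) :
    IntegrableOn (fun y => h ((extChartAt 𝓘(ℝ, E4) c).symm y) * |topValue (ν.inChart c y)|)
      (extChartAt 𝓘(ℝ, E4) c).target := by
  obtain ⟨h1, h2⟩ := continuous_chart_integrand hνs c hc hs
  exact (integrable_indicator_iff (isOpen_extChartAt_target c).measurableSet).1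
    (h1.integrable_of_hasCompactSupport h2)

theorem chartIntegral_pos {ν : Form N 4} (hνs : ν.SmoothOn Set.univ) (hν : ∀ x, ν x ≠ 0) (c : N)
    {h : N → ℝ} (hc : Continuous h) (hs : tsupport h ⊆ (extChartAt 𝓘(ℝ, E4) c).source)
    (h0 : ∀ x, 0 ≤ h x) {x : N} (hx : h x ≠ 0) : 0 < chartIntegral ν c h := by
  obtain ⟨h1, h2⟩ := continuous_chart_integrand hνs c hc hs
  have hxs := hs (subset_tsupport h hx)
  rw [chartIntegral, ← integral_indicator (isOpen_extChartAt_target c).measurableSet]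
  refine h1.integral_pos_of_hasCompactSupport_nonneg_nonzero h2
    (fun y => Set.indicator_nonneg (fun y _ => mul_nonneg (h0 _) (abs_nonneg _)) y)
    (x := extChartAt 𝓘(ℝ, E4) c x) ?_
  rw [Set.indicator_of_mem ((extChartAt 𝓘(ℝ, E4) c).map_source hxs),
    (extChartAt 𝓘(ℝ, E4) c).left_inv hxs]
  exact mul_ne_zero hx (abs_ne_zero.2
    (topValue_inChart_ne_zero hν c ((extChartAt 𝓘(ℝ, E4) c).map_source hxs)))

omit [IsManifold 𝓘(ℝ, E4) ∞ N] [CompactSpace N] in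
theorem chartIntegral_nonneg (ν : Form N 4) (c : N) {h : N → ℝ} (h0 : ∀ x, 0 ≤ h x) :
    0 ≤ chartIntegral ν c h :=
  setIntegral_nonneg (isOpen_extChartAt_target c).measurableSet fun _ _ =>
    mul_nonneg (h0 _) (abs_nonneg _)

omit [CompactSpace N] in
/-- Stokes' theorem for a form supported in a chart. -/
theorem chartIntegral_d_eq_zero {ν : Form N 4} (hνs : ν.SmoothOn Set.univ) (hν : ∀ x, ν x ≠ 0)
    (c : N) {η : Form N 3} (hη : η.SmoothOn Set.univ) {K : Set N} (hK : IsCompact K)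
    (hKc : K ⊆ (extChartAt 𝓘(ℝ, E4) c).source) (hηK : ∀ x ∉ K, η x = 0) {k : N → ℝ}
    (hk : ∀ x, η.d x = k x • ν x) : chartIntegral ν c k = 0 := by
  set φ := extChartAt 𝓘(ℝ, E4) c with hφ
  -- The sign of ν in the chart is locally constant because ν never vanishes. Replacing η by `s`·η
  -- turns k|ν| into an exact form on `ℝ⁴`.
  let s : E4 → ℝ := fun y => if 0 < topValue (ν.inChart c y) then 1 else -1
  have hs : ∀ y ∈ φ.target, ∀ᶠ z in 𝓝 y, s z = s y := fun y hy => by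
    have hc : ContinuousAt (fun y => topValue (ν.inChart c y)) y :=
      (continuousOn_topValue hνs c).continuousAt ((isOpen_extChartAt_target c).mem_nhds hy)
    rcases (topValue_inChart_ne_zero hν c hy).lt_or_gt with h | h
    · filter_upwards [hc.eventually_lt_const h] with z hz
      simp only [s, if_neg hz.not_gt, if_neg h.not_gt]
    · filter_upwards [hc.eventually_const_lt h] with z hz
      simp only [s, if_pos hz, if_pos h]
  have hsabs : ∀ y, s y * topValue (ν.inChart c y) = |topValue (ν.inChart c y)| := fun y => by
    simp only [s]
    split_ifs with h
    · rw [one_mul, abs_of_pos h]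
    · rw [abs_of_nonpos (not_lt.1 h), neg_one_mul]
  have hKi : IsCompact (φ '' K) := hK.image_of_continuousOn ((continuousOn_extChartAt c).mono hKc)
  have hKt : φ '' K ⊆ φ.target := by
    rintro _ ⟨x, hx, rfl⟩
    exact φ.map_source (hKc hx)
  let F : E4 → E4 [⋀^Fin 3]→L[ℝ] ℝ := fun y => s y • η.inChart c y
  have h0 : ∀ y ∈ φ.target, y ∉ φ '' K → F y = 0 := fun y hy hyK => by
    have : φ.symm y ∉ K := fun hx => hyK ⟨_, hx, φ.right_inv hy⟩
    have h2 : η.inChart c y = 0 := by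
      simp only [Form.inChart]
      rw [hηK _ this]
      rfl
    simp only [F]
    rw [h2, smul_zero]
  have hFe : ∀ y ∈ φ.target, F =ᶠ[𝓝 y] fun z => s y • η.inChart c z := fun y hy => by
    filter_upwards [hs y hy] with z hz
    simp only [F, hz]
  have hconst : ∀ y ∈ φ.target, ContDiffAt ℝ ∞ (fun z => s y • η.inChart c z) y := fun y hy => by
    have := (hη.contDiffAt isOpen_univ hy trivial).const_smul (s y)
    exact this
  have hF : ContDiff ℝ ∞ (φ.target.indicator F) :=
    contDiff_indicator (isOpen_extChartAt_target c) hKi hKt (fun y hy =>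
      (hconst y hy).congr_of_eventuallyEq (hFe y hy)) h0
  have hFs : HasCompactSupport (φ.target.indicator F) := hasCompactSupport_indicator hKi h0
  rw [chartIntegral, ← integral_indicator (isOpen_extChartAt_target c).measurableSet,
    ← integral_extDeriv_eq_zero hF hFs]
  congr 1
  funext y
  by_cases hy : y ∈ φ.target
  · have e : φ.target.indicator F =ᶠ[𝓝 y] fun z => s y • η.inChart c z := by
      filter_upwards [hFe y hy, (isOpen_extChartAt_target c).mem_nhds hy] with z hz hzt
      rw [Set.indicator_of_mem hzt, hz]
    have hsm : extDeriv (fun z => s y • η.inChart c z) y = s y • extDeriv (η.inChart c) y :=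
      extDeriv_smul (s y) (η.inChart c)
    rw [Set.indicator_of_mem hy, e.extDeriv_eq, hsm, topValue_smul,
      ← Form.inChart_d hη isOpen_univ c hy trivial, ← hsabs]
    have : topValue (η.d.inChart c y) = k (φ.symm y) * topValue (ν.inChart c y) := by
      simp only [Form.inChart]
      rw [hk]
      rfl
    rw [this]
    ring
  · have e : φ.target.indicator F =ᶠ[𝓝 y] fun _ => 0 := by
      filter_upwards [hKi.isClosed.isOpen_compl.mem_nhds fun h => hy (hKt h)] with z hz
      by_cases hzt : z ∈ φ.target
      · rw [Set.indicator_of_mem hzt, h0 z hzt hz]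
      · rw [Set.indicator_of_notMem hzt]
    rw [Set.indicator_of_notMem hy, e.extDeriv_eq, extDeriv_const_zero]
    rfl

omit [IsManifold 𝓘(ℝ, E4) ∞ N] [CompactSpace N] in
theorem SmoothFun.continuous {f : N → ℝ} (hf : SmoothFun f Set.univ) : Continuous f :=
  continuous_iff_continuousAt.2 fun _ => hf.continuousAt trivial

omit [CompactSpace N] in
theorem smoothFun_of_contMDiff {f : N → ℝ} (hf : ContMDiff 𝓘(ℝ, E4) 𝓘(ℝ, ℝ) ∞ f) :
    SmoothFun f Set.univ := fun c y hy _ => by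
  have h : ContMDiffAt 𝓘(ℝ, E4) 𝓘(ℝ, ℝ) ∞ (f ∘ (extChartAt 𝓘(ℝ, E4) c).symm) y :=
    hf.contMDiffAt.comp y (contMDiffAt_extChartAt_symm c hy)
  exact h.contDiffAt

omit [IsManifold 𝓘(ℝ, E4) ∞ N] [CompactSpace N] in
theorem Form.smoothOn_smul {n : ℕ} {f : N → ℝ} {η : Form N n} {U : Set N} (hU : IsOpen U)
    (hf : SmoothFun f U) (hη : η.SmoothOn U) : Form.SmoothOn (fun x => f x • η x) U :=
  Form.smoothOn_of_contDiffAt fun x₀ y hy hyU =>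
    (hf x₀ y hy hyU).smul (hη.contDiffAt hU hy hyU)

omit [IsManifold 𝓘(ℝ, E4) ∞ N] [CompactSpace N] in
-- The two assertions are proved together because additivity of d in the inductive step needs
-- smoothness of the partial sum.
theorem Form.smoothOn_sum_and_d_sum {n : ℕ} {ι : Type*} (s : Finset ι) {η : ι → Form N n}
    {U : Set N} (hU : IsOpen U) (hη : ∀ i, (η i).SmoothOn U) :
    Form.SmoothOn (fun x => ∑ i ∈ s, η i x) U ∧
      ∀ x ∈ U, Form.d (fun x => ∑ i ∈ s, η i x) x = ∑ i ∈ s, (η i).d x := by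
  classical
  induction s using Finset.induction_on with
  | empty =>
    have h0 : ∀ x₀, Form.inChart (fun x => ∑ i ∈ (∅ : Finset ι), η i x) x₀ = fun _ => 0 :=
      fun x₀ => by funext y; simp only [Form.inChart, Finset.sum_empty]; rfl
    refine ⟨fun x₀ => ?_, fun x _ => ?_⟩
    · rw [h0]; exact contDiffOn_const
    · simp only [Form.d]
      rw [h0]
      rw [extDeriv_const_zero]
      rfl
  | insert i s hi ih =>
    simp only [Finset.sum_insert hi]
    exact ⟨Form.smoothOn_add hU (hη i) ih.1, fun x hx => by
      rw [Form.d_add hU (hη i) ih.1 hx, ih.2 x hx]⟩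

/-- On a nonempty compact manifold, the exterior derivative of a smooth 3-form vanishes somewhere:
otherwise the total volume would be zero by Stokes' theorem. -/
theorem exists_d_eq_zero [T2Space N] [Nonempty N] {η : Form N 3} (hη : η.SmoothOn Set.univ) :
    ∃ x, η.d x = 0 := by
  by_contra! hν
  have hνs := hη.d isOpen_univ
  obtain ⟨t, ht⟩ := isCompact_univ.elim_finite_subcover
    (fun c : N => (extChartAt 𝓘(ℝ, E4) c).source) (fun c => isOpen_extChartAt_source c)
    (fun x _ => Set.mem_iUnion.2 ⟨x, mem_extChartAt_source x⟩)
  obtain ⟨ρ, hρ⟩ := SmoothPartitionOfUnity.exists_isSubordinate 𝓘(ℝ, E4) (s := Set.univ)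
    isClosed_univ (fun c : t => (extChartAt 𝓘(ℝ, E4) (c : N)).source)
    (fun c => isOpen_extChartAt_source _) (fun x hx => by
      obtain ⟨c, hc⟩ := Set.mem_iUnion.1 (ht hx)
      obtain ⟨hct, hxc⟩ := Set.mem_iUnion.1 hc
      exact Set.mem_iUnion.2 ⟨⟨c, hct⟩, hxc⟩)
  have hsum : ∀ x, ∑ i : t, ρ i x = 1 := fun x => by
    rw [← finsum_eq_sum_of_fintype]; exact ρ.sum_eq_one trivial
  have hρs : ∀ i : t, SmoothFun (ρ i) Set.univ := fun i => smoothFun_of_contMDiff (ρ i).contMDiff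
  have hρη : ∀ i : t, Form.SmoothOn (fun x => ρ i x • η x) Set.univ := fun i =>
    Form.smoothOn_smul isOpen_univ (hρs i) hη
  -- Under the contrary assumption dη is itself a volume form, and d(ρ_i η) = k_i dη. Since the ρ_i
  -- sum to 1, so do the k_i.
  choose k hk using fun i : t => exists_eq_smul_of_ne_zero (Form.d fun x => ρ i x • η x) hν
  have hks : ∀ i : t, SmoothFun (k i) Set.univ := fun i =>
    smoothFun_of_eq_smul ((hρη i).d isOpen_univ) hνs hν (hk i)
  have hksum : ∀ x, ∑ i : t, k i x = 1 := fun x => by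
    have h1 := (Form.smoothOn_sum_and_d_sum Finset.univ isOpen_univ hρη).2 x trivial
    have h2 : (fun x => ∑ i : t, ρ i x • η x) = η := by
      funext x
      rw [← Finset.sum_smul, hsum, one_smul]
    rw [h2, Finset.sum_congr rfl fun i _ => hk i x, ← Finset.sum_smul] at h1
    have h3 : (1 : ℝ) • η.d x = (∑ i : t, k i x) • η.d x := by rw [one_smul]; exact h1
    exact (smul_left_injective ℝ (hν x) h3).symm
  have hksupp : ∀ (i : t) x, k i x ≠ 0 → x ∈ tsupport (ρ i) := fun i x hx => by
    by_contra hxs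
    have h1 : Form.d (fun x => ρ i x • η x) x = 0 := by
      have h2 := Form.d_congr (η := fun _ => 0) (η' := fun x => ρ i x • η x)
        (isClosed_tsupport (ρ i)).isOpen_compl
        (fun y hy => by rw [image_eq_zero_of_notMem_tsupport hy, zero_smul]) hxs
      rw [h2]
      have h3 := (Form.smoothOn_sum_and_d_sum (∅ : Finset N) (η := fun _ => η) isOpen_univ
        fun _ => hη).2 x trivial
      simpa using h3
    rw [hk i x] at h1
    exact hx ((smul_eq_zero.1 h1).resolve_right (hν x))
  have hcomp : ∀ i : t, chartIntegral η.d (i : N) (k i) = 0 := fun i =>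
    chartIntegral_d_eq_zero hνs hν (i : N) (hρη i) (isClosed_tsupport (ρ i)).isCompact (hρ i)
      (fun x hx => by rw [image_eq_zero_of_notMem_tsupport hx, zero_smul]) (hk i)
  -- The total volume is expanded as Σ_i Σ_j ∫ ρ_i k_j |dη|. Moving each term to chart j and summing
  -- over i first leaves Σ_j ∫ k_j |dη|, which is zero by Stokes in the charts.
  have hzero : ∑ i : t, chartIntegral η.d (i : N) (ρ i) = 0 := by
    have hprod : ∀ i j : t, Continuous fun x => ρ i x * k j x := fun i j =>
      (hρs i).continuous.mul (hks j).continuous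
    have e1 : ∀ i : t, chartIntegral η.d (i : N) (ρ i) =
        ∑ j : t, chartIntegral η.d (i : N) (fun x => ρ i x * k j x) := fun i => by
      simp only [chartIntegral]
      rw [← integral_finsetSum _ fun j _ => integrableOn_chart_integrand hνs (i : N) (hprod i j)
        ((tsupport_mul_subset_left).trans (hρ i))]
      congr 1
      funext y
      rw [← Finset.sum_mul, ← Finset.mul_sum, hksum, mul_one]
    have e2 : ∀ i j : t, chartIntegral η.d (i : N) (fun x => ρ i x * k j x) =
        chartIntegral η.d (j : N) (fun x => ρ i x * k j x) := fun i j =>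
      chartIntegral_eq η.d fun x hx =>
        ⟨hρ i (subset_tsupport _ (left_ne_zero_of_mul hx)),
          hρ j (hksupp j x (right_ne_zero_of_mul hx))⟩
    have e3 : ∀ j : t, ∑ i : t, chartIntegral η.d (j : N) (fun x => ρ i x * k j x) =
        chartIntegral η.d (j : N) (k j) := fun j => by
      have hsup : ∀ i : t, tsupport (fun x => ρ i x * k j x) ⊆ (extChartAt 𝓘(ℝ, E4) (j : N)).source :=
        fun i => (tsupport_mul_subset_right).trans ((closure_minimal (fun x hx => hksupp j x hx)
          (isClosed_tsupport _)).trans (hρ j))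
      simp only [chartIntegral]
      rw [← integral_finsetSum _ fun i _ => integrableOn_chart_integrand hνs (j : N) (hprod i j)
        (hsup i)]
      congr 1
      funext y
      rw [← Finset.sum_mul, ← Finset.sum_mul, hsum, one_mul]
    rw [Finset.sum_congr rfl fun i _ => e1 i, Finset.sum_comm]
    refine Finset.sum_eq_zero fun j _ => ?_
    rw [Finset.sum_congr rfl fun i _ => e2 i j, e3, hcomp]
  obtain ⟨x⟩ := ‹Nonempty N›
  obtain ⟨i, -, hi⟩ := Finset.exists_ne_zero_of_sum_ne_zero
    (by rw [hsum x]; exact one_ne_zero : ∑ i : t, ρ i x ≠ 0)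
  have hpos := chartIntegral_pos hνs hν (i : N) (hρs i).continuous (hρ i) (ρ.nonneg i) hi
  have := (Finset.sum_eq_zero_iff_of_nonneg fun i _ =>
    chartIntegral_nonneg η.d ((i : t) : N) (ρ.nonneg i)).1 hzero i (Finset.mem_univ i)
  exact hpos.ne' this

end Stokes

/-! ### Products of a 1-form and a 2-form -/

section WedgeTwo

/-- The wedge product of a covector and a 2-form. -/
def wedgeTwo (α : E4 →L[ℝ] ℝ) (β : E4 [⋀^Fin 2]→L[ℝ] ℝ) : E4 [⋀^Fin 3]→L[ℝ] ℝ :=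
  ContinuousAlternatingMap.alternatizeUncurryFin (α.smulRight β)

theorem wedgeTwo_apply (α : E4 →L[ℝ] ℝ) (β : E4 [⋀^Fin 2]→L[ℝ] ℝ) (t v w : E4) :
    wedgeTwo α β ![t, v, w] = α t * β ![v, w] - α v * β ![t, w] + α w * β ![t, v] := by
  rw [wedgeTwo, ContinuousAlternatingMap.alternatizeUncurryFin_apply, Fin.sum_univ_three]
  have e0 : (0 : Fin 3).removeNth ![t, v, w] = ![v, w] := rfl
  have e1 : (1 : Fin 3).removeNth ![t, v, w] = ![t, w] := by
    ext i; fin_cases i <;> rfl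
  have e2 : (2 : Fin 3).removeNth ![t, v, w] = ![t, v] := by
    ext i; fin_cases i <;> rfl
  rw [e0, e1, e2]
  simp
  ring

theorem wedgeTwo_comp (α : E4 →L[ℝ] ℝ) (β : E4 [⋀^Fin 2]→L[ℝ] ℝ) (L : E4 →L[ℝ] E4) :
    (wedgeTwo α β).compContinuousLinearMap L =
      wedgeTwo (α.comp L) (β.compContinuousLinearMap L) := by
  ext v
  rw [ContinuousAlternatingMap.compContinuousLinearMap_apply, wedgeTwo, wedgeTwo,
    ContinuousAlternatingMap.alternatizeUncurryFin_apply,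
    ContinuousAlternatingMap.alternatizeUncurryFin_apply]
  rfl

theorem ContDiffAt.wedgeTwo {a : E4 → E4 →L[ℝ] ℝ} {b : E4 → E4 [⋀^Fin 2]→L[ℝ] ℝ} {y : E4}
    (ha : ContDiffAt ℝ ∞ a y) (hb : ContDiffAt ℝ ∞ b y) :
    ContDiffAt ℝ ∞ (fun z => LagEngel.wedgeTwo (a z) (b z)) y := by
  have hb' : ∀ p q : E4, ContDiffAt ℝ ∞ (fun z => b z ![p, q]) y := fun p q =>
    ContDiffAt.form_apply (v := fun i _ => ![p, q] i) hb fun _ => contDiffAt_const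
  refine contDiffAt_form_of_apply fun v => ?_
  have hv : v = ![v 0, v 1, v 2] := by ext i; fin_cases i <;> rfl
  rw [hv]
  simp only [wedgeTwo_apply]
  exact (((ha.clm_apply contDiffAt_const).mul (hb' _ _)).sub
    ((ha.clm_apply contDiffAt_const).mul (hb' _ _))).add
      ((ha.clm_apply contDiffAt_const).mul (hb' _ _))

/-- In d(a ∧ b) = da ∧ b - a ∧ db the second term drops out because b is closed at `y`. -/
theorem extDeriv_wedgeTwo {a : E4 → E4 →L[ℝ] ℝ} {b : E4 → E4 [⋀^Fin 2]→L[ℝ] ℝ} {y : E4}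
    (ha : ContDiffAt ℝ ∞ a y) (hb : ContDiffAt ℝ ∞ b y) (h0 : extDeriv b y = 0) (s t v w : E4) :
    extDeriv (fun z => wedgeTwo (a z) (b z)) y ![s, t, v, w] =
      (fderiv ℝ a y s t - fderiv ℝ a y t s) * b y ![v, w]
      - (fderiv ℝ a y s v - fderiv ℝ a y v s) * b y ![t, w]
      + (fderiv ℝ a y s w - fderiv ℝ a y w s) * b y ![t, v]
      + (fderiv ℝ a y t v - fderiv ℝ a y v t) * b y ![s, w]
      - (fderiv ℝ a y t w - fderiv ℝ a y w t) * b y ![s, v]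
      + (fderiv ℝ a y v w - fderiv ℝ a y w v) * b y ![s, t] := by
  have had := ha.differentiableAt (by simp)
  have hbd := hb.differentiableAt (by simp)
  have hd := (ContDiffAt.wedgeTwo ha hb).differentiableAt (by simp)
  have hb' : ∀ p q : E4, DifferentiableAt ℝ (fun z => b z ![p, q]) y := fun p q =>
    (ContDiffAt.form_apply (v := fun i _ => ![p, q] i) hb fun _ =>
      contDiffAt_const).differentiableAt (by simp)
  have key : ∀ q : E4, HasFDerivAt (fun z => a z q) ((fderiv ℝ a y).flip q) y := fun q => by
    have := had.hasFDerivAt.clm_apply (hasFDerivAt_const q y)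
    refine this.congr_fderiv ?_
    ext p; simp
  have key2 : ∀ r p q u : E4, fderiv ℝ (fun z => wedgeTwo (a z) (b z) ![p, q, u]) y r =
      fderiv ℝ a y r p * b y ![q, u] + a y p * fderiv ℝ (fun z => b z ![q, u]) y r
      - (fderiv ℝ a y r q * b y ![p, u] + a y q * fderiv ℝ (fun z => b z ![p, u]) y r)
      + (fderiv ℝ a y r u * b y ![p, q] + a y u * fderiv ℝ (fun z => b z ![p, q]) y r) :=
    fun r p q u => by
    simp only [wedgeTwo_apply]
    have h : HasFDerivAt
        (fun z => a z p * b z ![q, u] - a z q * b z ![p, u] + a z u * b z ![p, q]) _ y :=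
      (((key p).mul (hb' q u).hasFDerivAt).sub ((key q).mul (hb' p u).hasFDerivAt)).add
        ((key u).mul (hb' p q).hasFDerivAt)
    rw [h.fderiv]
    simp only [sub_apply, add_apply, smul_apply, smul_eq_mul, ContinuousLinearMap.flip_apply]
    ring
  have key3 : ∀ p q r : E4, fderiv ℝ (fun z => b z ![q, r]) y p
      - fderiv ℝ (fun z => b z ![p, r]) y q + fderiv ℝ (fun z => b z ![p, q]) y r = 0 :=
    fun p q r => by
    have h : extDeriv b y ![p, q, r] = 0 := by rw [h0]; rfl
    rw [extDeriv_apply hbd, Fin.sum_univ_three] at h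
    have e0 : (0 : Fin 3).removeNth ![p, q, r] = ![q, r] := rfl
    have e1 : (1 : Fin 3).removeNth ![p, q, r] = ![p, r] := by
      ext i; fin_cases i <;> rfl
    have e2 : (2 : Fin 3).removeNth ![p, q, r] = ![p, q] := by
      ext i; fin_cases i <;> rfl
    rw [e0, e1, e2] at h
    simp at h
    linarith
  rw [extDeriv_apply hd, Fin.sum_univ_four]
  have e0 : (0 : Fin 4).removeNth ![s, t, v, w] = ![t, v, w] := rfl
  have e1 : (1 : Fin 4).removeNth ![s, t, v, w] = ![s, v, w] := by
    ext i; fin_cases i <;> rfl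
  have e2 : (2 : Fin 4).removeNth ![s, t, v, w] = ![s, t, w] := by
    ext i; fin_cases i <;> rfl
  have e3 : (3 : Fin 4).removeNth ![s, t, v, w] = ![s, t, v] := by
    ext i; fin_cases i <;> rfl
  rw [e0, e1, e2, e3, key2, key2, key2, key2]
  simp
  linear_combination (-a y s) * key3 t v w + a y t * key3 s v w - a y v * key3 s t w
    + a y w * key3 s t v

variable {X : Type u} [TopologicalSpace X] [ChartedSpace E4 X]

/-- The wedge product of a covector field and a 2-form. -/
def Form.wedgeTwo (α : CovectorField X) (β : Form X 2) : Form X 3 :=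
  fun x => LagEngel.wedgeTwo (α x) (β x)

theorem Form.inChart_wedgeTwo (α : CovectorField X) (β : Form X 2) (x₀ : X) :
    (Form.wedgeTwo α β).inChart x₀ =
      fun z => LagEngel.wedgeTwo (α.inChart x₀ z) (β.inChart x₀ z) := by
  funext z
  exact wedgeTwo_comp _ _ _

theorem Form.smoothOn_wedgeTwo {α : CovectorField X} {β : Form X 2} {U : Set X} (hU : IsOpen U)
    (hα : α.toForm.SmoothOn U) (hβ : β.SmoothOn U) : (Form.wedgeTwo α β).SmoothOn U :=
  Form.smoothOn_of_contDiffAt fun x₀ y hy hyU => by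
    rw [Form.inChart_wedgeTwo]
    exact ContDiffAt.wedgeTwo (CovectorField.contDiffAt hα hU hy hyU) (hβ.contDiffAt hU hy hyU)

variable [IsManifold 𝓘(ℝ, E4) ∞ X]

theorem Form.inChart_chartDeriv {n : ℕ} (β : Form X n) (x : X)
    (v : Fin n → TangentSpace 𝓘(ℝ, E4) x) :
    β.inChart x (extChartAt 𝓘(ℝ, E4) x x) (fun i => chartDeriv x (v i)) = β x v := by
  have hm := mem_extChartAt_source (I := 𝓘(ℝ, E4)) x
  have h1 := fun i => mfderiv_symm_comp_mfderiv x hm (v i)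
  have h2 : ∀ x' : X, x' = x → ∀ u : Fin n → E4, u = v →
      (show E4 [⋀^Fin n]→L[ℝ] ℝ from β x') u = (show E4 [⋀^Fin n]→L[ℝ] ℝ from β x) v := by
    rintro x' rfl u rfl
    rfl
  exact h2 _ ((extChartAt 𝓘(ℝ, E4) x).left_inv hm) _ (funext h1)

theorem Form.d_wedgeTwo {α : CovectorField X} {β : Form X 2} {U : Set X} (hU : IsOpen U)
    (hα : α.toForm.SmoothOn U) (hβ : β.SmoothOn U) {x : X} (hx : x ∈ U) (h0 : β.d x = 0)
    (s t v w : TangentSpace 𝓘(ℝ, E4) x) :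
    (Form.wedgeTwo α β).d x ![s, t, v, w] =
      α.d x ![s, t] * β x ![v, w] - α.d x ![s, v] * β x ![t, w] + α.d x ![s, w] * β x ![t, v]
      + α.d x ![t, v] * β x ![s, w] - α.d x ![t, w] * β x ![s, v]
      + α.d x ![v, w] * β x ![s, t] := by
  have hm := mem_extChartAt_source (I := 𝓘(ℝ, E4)) x
  have hl := (extChartAt 𝓘(ℝ, E4) x).left_inv hm
  have ht := (extChartAt 𝓘(ℝ, E4) x).map_source hm
  have hxU : (extChartAt 𝓘(ℝ, E4) x).symm (extChartAt 𝓘(ℝ, E4) x x) ∈ U := by rwa [hl]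
  have hac := CovectorField.contDiffAt hα hU ht hxU
  have hbc := hβ.contDiffAt hU ht hxU
  have h0' : extDeriv (β.inChart x) (extChartAt 𝓘(ℝ, E4) x x) = 0 := by
    rw [← Form.inChart_d hβ hU x ht hxU]
    simp only [Form.inChart]
    have : ∀ x', x' = x → β.d x' = 0 := by rintro x' rfl; exact h0
    rw [this _ hl]
    rfl
  have hβ2 : ∀ p q : TangentSpace 𝓘(ℝ, E4) x, β x ![p, q] =
      β.inChart x (extChartAt 𝓘(ℝ, E4) x x) ![chartDeriv x p, chartDeriv x q] := fun p q => by
    rw [← Form.inChart_chartDeriv]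
    refine congrArg (β.inChart x _) ?_
    ext i; fin_cases i <;> rfl
  simp only [CovectorField.d_apply (hac.differentiableAt (by simp)), hβ2]
  rw [← extDeriv_wedgeTwo hac hbc h0', ← Form.inChart_wedgeTwo]
  refine congrArg (extDeriv _ _) ?_
  ext i; fin_cases i <;> rfl

/-- On a nonempty compact manifold, the product of an exact and a closed 2-form vanishes
somewhere. -/
theorem exists_d_mul_eq_zero [CompactSpace X] [T2Space X] [Nonempty X]
    {α : CovectorField X} {β : Form X 2} (hα : α.toForm.SmoothOn Set.univ)
    (hβ : β.SmoothOn Set.univ) (h0 : ∀ x, β.d x = 0) :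
    ∃ x, ∀ s t v w,
      α.d x ![s, t] * β x ![v, w] - α.d x ![s, v] * β x ![t, w] + α.d x ![s, w] * β x ![t, v]
      + α.d x ![t, v] * β x ![s, w] - α.d x ![t, w] * β x ![s, v]
      + α.d x ![v, w] * β x ![s, t] = 0 := by
  obtain ⟨x, hx⟩ := exists_d_eq_zero (Form.smoothOn_wedgeTwo isOpen_univ hα hβ)
  refine ⟨x, fun s t v w => ?_⟩
  rw [← Form.d_wedgeTwo isOpen_univ hα hβ trivial (h0 x), hx]
  rfl

end WedgeTwo

/-! ### Pullback of covector fields -/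

section PullCovector

theorem linearIndependent_of_ker {θ : Fin 4 → E4 →L[ℝ] ℝ}
    (h : ∀ v, (∀ i, θ i v = 0) → v = 0) : LinearIndependent ℝ θ := by
  let Φ : E4 →ₗ[ℝ] (Fin 4 → ℝ) := LinearMap.pi fun i => (θ i).toLinearMap
  have hΦ : Function.Injective Φ := (injective_iff_map_eq_zero Φ).2 fun v hv =>
    h v fun i => congrFun hv i
  have hs : Function.Surjective Φ := (LinearMap.injective_iff_surjective_of_finrank_eq_finrank
    (by simp)).1 hΦ
  choose e he using fun j => hs (Pi.single j 1)
  refine linearIndependent_of_dual (e := e) fun i j => ?_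
  have := congrFun (he j) i
  rw [Pi.single_apply] at this
  exact this

variable {X : Type u} [TopologicalSpace X] [ChartedSpace E4 X] [IsManifold 𝓘(ℝ, E4) ∞ X]
  {Y : Type v} [TopologicalSpace Y] [ChartedSpace E4 Y] [IsManifold 𝓘(ℝ, E4) ∞ Y]

theorem Form.smoothOn_pull {n : ℕ} {η : Form Y n} {V : Set Y} (hV : IsOpen V) (hη : η.SmoothOn V)
    {f : X → Y} {U : Set X} (hf : ∀ x ∈ U, ContMDiffAt 𝓘(ℝ, E4) 𝓘(ℝ, E4) ∞ f x)
    (hfV : ∀ x ∈ U, f x ∈ V) : (η.pull f).SmoothOn U := by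
  refine Form.smoothOn_of_contDiffAt fun x₀ y hy hyU => ?_
  set φ := extChartAt 𝓘(ℝ, E4) x₀
  have hs := contMDiffAt_extChartAt_symm x₀ hy
  have hc : ContMDiffAt 𝓘(ℝ, E4) 𝓘(ℝ, E4) ∞ (f ∘ φ.symm) y := (hf _ hyU).comp y hs
  have e : ((η.pull f).inChart x₀ : E4 → E4 [⋀^Fin n]→L[ℝ] ℝ) =ᶠ[𝓝 y] η.pull (f ∘ φ.symm) := by
    have h1 : ∀ᶠ z in 𝓝 y, MDifferentiableAt 𝓘(ℝ, E4) 𝓘(ℝ, E4) f (φ.symm z) :=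
      hs.continuousAt.eventually (eventually_mdifferentiableAt (hf _ hyU))
    filter_upwards [h1, (isOpen_extChartAt_target x₀).mem_nhds hy] with z hz1 hz2
    exact η.pull_pull ((contMDiffAt_extChartAt_symm x₀ hz2).mdifferentiableAt (by simp)) hz1
  set c := f (φ.symm y) with hcdef
  have hm := mem_extChartAt_source (I := 𝓘(ℝ, E4)) c
  have e2 := e.trans (η.pull_eventuallyEq hc c hm)
  refine ContDiffAt.congr_of_eventuallyEq ?_ e2
  have hψ : ContMDiffAt 𝓘(ℝ, E4) 𝓘(ℝ, E4) ∞ (extChartAt 𝓘(ℝ, E4) c ∘ (f ∘ φ.symm)) y :=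
    (contMDiffAt_extChartAt_of_mem c hm).comp y hc
  have hg : ContDiffAt ℝ ∞ (extChartAt 𝓘(ℝ, E4) c ∘ (f ∘ φ.symm)) y := hψ.contDiffAt
  have hl := (extChartAt 𝓘(ℝ, E4) c).left_inv hm
  have hcV : (extChartAt 𝓘(ℝ, E4) c).symm (extChartAt 𝓘(ℝ, E4) c c) ∈ V := by
    rw [hl]; exact hfV _ hyU
  have hη1 : ContDiffAt ℝ ∞ (fun z => η.inChart c ((extChartAt 𝓘(ℝ, E4) c ∘ (f ∘ φ.symm)) z)) y :=
    ContDiffAt.comp y (hη.contDiffAt hV ((extChartAt 𝓘(ℝ, E4) c).map_source hm) hcV) hg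
  refine contDiffAt_form_of_apply fun v => ?_
  exact ContDiffAt.form_apply (v := fun i z =>
    fderiv ℝ (extChartAt 𝓘(ℝ, E4) c ∘ (f ∘ φ.symm)) z (v i)) hη1 fun i =>
      (hg.fderiv_right (m := ∞) (by simp)).clm_apply contDiffAt_const

omit [IsManifold 𝓘(ℝ, E4) ∞ X] [IsManifold 𝓘(ℝ, E4) ∞ Y] in
/-- The pullback of a covector field. -/
def CovectorField.pull (α : CovectorField Y) (f : X → Y) : CovectorField X := fun x =>
  (α (f x)).comp (mfderiv 𝓘(ℝ, E4) 𝓘(ℝ, E4) f x)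

omit [IsManifold 𝓘(ℝ, E4) ∞ X] [IsManifold 𝓘(ℝ, E4) ∞ Y] in
theorem CovectorField.toForm_pull (α : CovectorField Y) (f : X → Y) :
    (α.pull f).toForm = α.toForm.pull f := rfl

theorem CovectorField.smoothOn_pull {α : CovectorField Y} {V : Set Y} (hV : IsOpen V)
    (hα : α.toForm.SmoothOn V) {f : X → Y} {U : Set X}
    (hf : ∀ x ∈ U, ContMDiffAt 𝓘(ℝ, E4) 𝓘(ℝ, E4) ∞ f x) (hfV : ∀ x ∈ U, f x ∈ V) :
    (α.pull f).toForm.SmoothOn U :=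
  Form.smoothOn_pull hV hα hf hfV

theorem CovectorField.d_pull_apply {α : CovectorField Y} {V : Set Y} (hV : IsOpen V)
    (hα : α.toForm.SmoothOn V) {f : X → Y} {x : X}
    (hf : ContMDiffAt 𝓘(ℝ, E4) 𝓘(ℝ, E4) ∞ f x) (hx : f x ∈ V) (v w : TangentSpace 𝓘(ℝ, E4) x) :
    (α.pull f).d x ![v, w] = α.d (f x) ![mfderiv 𝓘(ℝ, E4) 𝓘(ℝ, E4) f x v,
      mfderiv 𝓘(ℝ, E4) 𝓘(ℝ, E4) f x w] := by
  rw [CovectorField.d, CovectorField.toForm_pull, Form.d_pull hα hV hf hx]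
  refine congrArg (α.toForm.d (f x)) ?_
  ext i; fin_cases i <;> rfl

end PullCovector

/-! ### Adapted coframes -/

section Adapted

variable {X : Type u} [TopologicalSpace X] [ChartedSpace E4 X]

/-- A smooth coframe on `U` that is 0-adapted to the structure. -/
structure LagrangianEngel.AdaptedOn (S : LagrangianEngel X) (θ : Fin 4 → CovectorField X)
    (U : Set X) : Prop where
  coframe : CoframeOn θ U
  symplectic : ∀ x ∈ U, S.Ω x = wedge (θ 0 x) (θ 2 x) + wedge (θ 1 x) (θ 3 x)
  system : ∀ x ∈ U, S.I x = Submodule.span ℝ ((fun i => θ i x) '' (({0, 1} : Finset (Fin 4))))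
  derived : ∀ x ∈ U, S.I.derived x = Submodule.span ℝ ((fun i => θ i x) '' (({0} : Finset (Fin 4))))

theorem derived_le (I : PfaffianSystem X) (x : X) : I.derived x ≤ I x := by
  refine Submodule.span_le.2 ?_
  rintro α ⟨U, -, hx, η, -, hη, rfl, -⟩
  exact hη x hx

theorem finiteDimensional_dual (x : X) :
    FiniteDimensional ℝ (TangentSpace 𝓘(ℝ, E4) x →L[ℝ] ℝ) :=
  inferInstanceAs (FiniteDimensional ℝ (E4 →L[ℝ] ℝ))

theorem finrank_of_isSubbundle {I : PfaffianSystem X} {r : ℕ} (h : I.IsSubbundle r) (x : X) :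
    Module.finrank ℝ (I x) = r := by
  obtain ⟨U, -, hx, η, -, hη⟩ := h x
  rw [(hη x hx).2, finrank_span_eq_card (hη x hx).1, Fintype.card_fin]

/-- The inclusion of the span is an equality because both dimensions are `r`. -/
theorem eq_span_of_mem {I : PfaffianSystem X} {r : ℕ} (h : I.IsSubbundle r) (x : X)
    {θ : Fin 4 → CovectorField X} (hi : LinearIndependent ℝ (fun i => θ i x))
    {s : Finset (Fin 4)} (hs : s.card = r) (hm : ∀ i ∈ s, θ i x ∈ I x) :
    I x = Submodule.span ℝ ((fun i => θ i x) '' s) := by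
  have := finiteDimensional_dual x
  refine (Submodule.eq_of_le_of_finrank_eq (Submodule.span_le.2 ?_) ?_).symm
  · rintro _ ⟨i, his, rfl⟩
    exact hm i his
  · rw [finrank_of_isSubbundle h]
    have h1 : LinearIndependent ℝ (fun i : s => θ i x) := hi.comp _ Subtype.val_injective
    have h2 : (fun i => θ i x) '' (s : Set (Fin 4)) = Set.range (fun i : s => θ i x) := by
      ext; simp
    rw [h2, finrank_span_eq_card h1, Fintype.card_coe, hs]

/-- Linear independence need not be assumed: a vector killed by all four forms lies in the kernel of
Ω. The two spans are then identified by rank. -/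
theorem LagrangianEngel.AdaptedOn.of {S : LagrangianEngel X} {θ : Fin 4 → CovectorField X}
    {U : Set X} (hU : IsOpen U) (hs : ∀ i, (θ i).toForm.SmoothOn U)
    (hΩ : ∀ x ∈ U, ∀ v w, S.Ω x ![v, w] =
      θ 0 x v * θ 2 x w - θ 0 x w * θ 2 x v + (θ 1 x v * θ 3 x w - θ 1 x w * θ 3 x v))
    (h1 : ∀ x ∈ U, θ 1 x ∈ S.I x) (h0 : ∀ x ∈ U, θ 0 x ∈ S.I.derived x) : S.AdaptedOn θ U := by
  have hk : ∀ x ∈ U, ∀ v : TangentSpace 𝓘(ℝ, E4) x, (∀ i, θ i x v = 0) → v = 0 :=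
    fun x hx v h => S.symplectic.nondegenerate x v fun w => by
      rw [hΩ x hx, h, h, h, h]
      ring
  have hi : ∀ x ∈ U, LinearIndependent ℝ (fun i => θ i x) := fun x hx =>
    linearIndependent_of_ker (θ := fun i => θ i x) (hk x hx)
  refine ⟨⟨hU, hs, hi⟩, fun x hx => twoForm_ext fun v w => ?_, fun x hx => ?_, fun x hx => ?_⟩
  · rw [hΩ x hx, ContinuousAlternatingMap.add_apply, wedge_apply, wedge_apply]
  · refine eq_span_of_mem S.engel.rank_two x (hi x hx) rfl fun i hi => ?_
    rcases Finset.mem_insert.1 hi with rfl | hi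
    · exact derived_le S.I x (h0 x hx)
    · rw [Finset.mem_singleton.1 hi]; exact h1 x hx
  · exact eq_span_of_mem S.engel.derived_rank_one x (hi x hx) rfl
      fun i hi => by rw [Finset.mem_singleton.1 hi]; exact h0 x hx

variable {S : LagrangianEngel X} {θ : Fin 4 → CovectorField X} {U : Set X}

theorem LagrangianEngel.AdaptedOn.mono (h : S.AdaptedOn θ U) {V : Set X} (hV : IsOpen V)
    (hVU : V ⊆ U) : S.AdaptedOn θ V where
  coframe := ⟨hV, fun i => (h.coframe.smooth i).mono hVU,
    fun x hx => h.coframe.linearIndependent x (hVU hx)⟩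
  symplectic := fun x hx => h.symplectic x (hVU hx)
  system := fun x hx => h.system x (hVU hx)
  derived := fun x hx => h.derived x (hVU hx)

theorem LagrangianEngel.AdaptedOn.mem_system (h : S.AdaptedOn θ U) {x : X} (hx : x ∈ U) :
    θ 1 x ∈ S.I x := by
  rw [h.system x hx]
  exact Submodule.subset_span ⟨1, by simp, rfl⟩

theorem LagrangianEngel.AdaptedOn.mem_derived (h : S.AdaptedOn θ U) {x : X} (hx : x ∈ U) :
    θ 0 x ∈ S.I.derived x := by
  rw [h.derived x hx]
  exact Submodule.subset_span ⟨0, by simp, rfl⟩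

theorem LagrangianEngel.AdaptedOn.Ω_apply (h : S.AdaptedOn θ U) {x : X} (hx : x ∈ U)
    (v w : TangentSpace 𝓘(ℝ, E4) x) : S.Ω x ![v, w] =
      θ 0 x v * θ 2 x w - θ 0 x w * θ 2 x v + (θ 1 x v * θ 3 x w - θ 1 x w * θ 3 x v) := by
  rw [h.symplectic x hx, ContinuousAlternatingMap.add_apply, wedge_apply, wedge_apply]

variable [IsManifold 𝓘(ℝ, E4) ∞ X]

theorem LagrangianEngel.AdaptedOn.d_zero_apply (h : S.AdaptedOn θ U) {x : X} (hx : x ∈ U)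
    {v w : TangentSpace 𝓘(ℝ, E4) x} (hv0 : θ 0 x v = 0) (hv1 : θ 1 x v = 0) (hw0 : θ 0 x w = 0)
    (hw1 : θ 1 x w = 0) : (θ 0).d x ![v, w] = 0 := by
  have := ((mem_derived_iff h.coframe h.system hx (θ 0 x)).1 (h.mem_derived hx)).2 v w
    (by simp [hv0, hv1]) (by simp [hw0, hw1])
  simpa [Finset.sum_pair, dualFrame_apply (h.coframe.linearIndependent x hx)] using this

/-- Otherwise θ₁ would lie in I⁽¹⁾, which is the line spanned by θ₀. -/
theorem LagrangianEngel.AdaptedOn.d_one_ne_zero (h : S.AdaptedOn θ U) {x : X} (hx : x ∈ U) :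
    (θ 1).d x ![dualFrame θ x 2, dualFrame θ x 3] ≠ 0 := fun h0 => by
  have hi := h.coframe.linearIndependent x hx
  have : θ 1 x ∈ S.I.derived x := by
    refine (mem_derived_iff h.coframe h.system hx (θ 1 x)).2 ⟨h.mem_system hx, fun v w hv hw => ?_⟩
    have hv0 := hv 0 (by simp)
    have hv1 := hv 1 (by simp)
    have hw0 := hw 0 (by simp)
    have hw1 := hw 1 (by simp)
    rw [Finset.sum_pair (by decide), dualFrame_apply hi, dualFrame_apply hi,
      twoForm_apply_frame hi ((θ 1).d x) v w]
    simp [Fin.sum_univ_six, pair, hv0, hv1, hw0, hw1, h0]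
  rw [h.derived x hx, mem_span_image_iff hi] at this
  simpa [dualFrame_apply hi] using this 1 (by decide)

/-- Otherwise dθ₀, which already vanishes on (e₂, e₃), would vanish on the kernel of θ₀, and θ₀
would lie in I⁽²⁾ = 0. -/
theorem LagrangianEngel.AdaptedOn.d_zero_ne_zero (h : S.AdaptedOn θ U) {x : X} (hx : x ∈ U) :
    (θ 0).d x ![dualFrame θ x 1, dualFrame θ x 2] ≠ 0 ∨
      (θ 0).d x ![dualFrame θ x 1, dualFrame θ x 3] ≠ 0 := by
  by_contra! h0
  have hi := h.coframe.linearIndependent x hx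
  have h23 : (θ 0).d x ![dualFrame θ x 2, dualFrame θ x 3] = 0 :=
    h.d_zero_apply hx (by simp [dualFrame_apply hi]) (by simp [dualFrame_apply hi])
      (by simp [dualFrame_apply hi]) (by simp [dualFrame_apply hi])
  have : θ 0 x ∈ S.I.derived.derived x := by
    refine (mem_derived_iff h.coframe h.derived hx (θ 0 x)).2
      ⟨h.mem_derived hx, fun v w hv hw => ?_⟩
    have hv0 := hv 0 (by simp)
    have hw0 := hw 0 (by simp)
    rw [Finset.sum_singleton, twoForm_apply_frame hi ((θ 0).d x) v w]
    simp [Fin.sum_univ_six, pair, hv0, hw0, h0, h23]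
  rw [S.engel.derived_derived x, Submodule.mem_bot] at this
  exact hi.ne_zero 0 this

end Adapted

/-! ### Local existence of adapted coframes -/

section Existence

variable {X : Type u} [TopologicalSpace X] [ChartedSpace E4 X] [IsManifold 𝓘(ℝ, E4) ∞ X]

/-- Linear independence is an open condition, applied to the continuous coordinate expressions in a
chart. -/
theorem exists_coframeOn {θ : Fin 4 → CovectorField X} {U : Set X} (hU : IsOpen U)
    (hθ : ∀ i, (θ i).toForm.SmoothOn U) {x : X} (hx : x ∈ U)
    (hi : LinearIndependent ℝ (fun i => θ i x)) : ∃ V ⊆ U, x ∈ V ∧ CoframeOn θ V := by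
  set φ := extChartAt 𝓘(ℝ, E4) x with hφ
  have hm : x ∈ φ.source := mem_extChartAt_source x
  have hxU : φ.symm (φ x) ∈ U := by rwa [φ.left_inv hm]
  have h1 : LinearIndependent ℝ (fun i => (θ i).inChart x (φ x)) := by
    let L : (E4 →L[ℝ] ℝ) →ₗ[ℝ] (TangentSpace 𝓘(ℝ, E4) x →L[ℝ] ℝ) :=
      { toFun := fun a => a.comp (chartDeriv x)
        map_add' := fun a b => ContinuousLinearMap.add_comp a b _
        map_smul' := fun c a => ContinuousLinearMap.smul_comp c a _ }
    refine LinearIndependent.of_comp L ?_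
    have : (L ∘ fun i => (θ i).inChart x (φ x)) = fun i => θ i x := by
      funext i
      ext v
      exact (θ i).inChart_chartDeriv x v
    rwa [this]
  have hc : ContinuousAt (fun z => fun i => (θ i).inChart x z) (φ x) :=
    continuousAt_pi.2 fun i => (CovectorField.contDiffAt (hθ i) hU (φ.map_source hm) hxU).continuousAt
  have h2 : ∀ᶠ z in 𝓝 (φ x), LinearIndependent ℝ (fun i => (θ i).inChart x z) :=
    hc.eventually h1.eventually
  have h3 : ∀ᶠ y in 𝓝 x, LinearIndependent ℝ (fun i => θ i y) := by
    filter_upwards [(continuousAt_extChartAt (I := 𝓘(ℝ, E4)) x).eventually h2,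
      (isOpen_extChartAt_source (I := 𝓘(ℝ, E4)) x).mem_nhds hm] with y hy hys
    have key : LinearIndependent ℝ (fun i => θ i (φ.symm (φ y))) := by
      let L : (TangentSpace 𝓘(ℝ, E4) (φ.symm (φ y)) →L[ℝ] ℝ) →ₗ[ℝ] (E4 →L[ℝ] ℝ) :=
        { toFun := fun a => a.comp (mfderiv 𝓘(ℝ, E4) 𝓘(ℝ, E4) φ.symm (φ y))
          map_add' := fun a b => ContinuousLinearMap.add_comp a b _
          map_smul' := fun c a => ContinuousLinearMap.smul_comp c a _ }
      exact LinearIndependent.of_comp L hy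
    rwa [φ.left_inv hys] at key
  obtain ⟨V, hV, hVo, hxV⟩ := eventually_nhds_iff.1 (h3.and (hU.mem_nhds hx))
  exact ⟨V, fun y hy => (hV y hy).2, hxV, hVo, fun i => (hθ i).mono fun y hy => (hV y hy).2,
    fun y hy => (hV y hy).1⟩

theorem exists_smooth_covectorField (x : X) (α : TangentSpace 𝓘(ℝ, E4) x →L[ℝ] ℝ) :
    ∃ β : CovectorField X, β.toForm.SmoothOn (extChartAt 𝓘(ℝ, E4) x).source ∧ β x = α := by
  set φ := extChartAt 𝓘(ℝ, E4) x with hφ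
  let α' : E4 →L[ℝ] ℝ := α
  let A : E4 →L[ℝ] ℝ := α'.comp (mfderiv 𝓘(ℝ, E4) 𝓘(ℝ, E4) φ.symm (φ x))
  let β : CovectorField E4 := fun _ => A
  have hβ : β.toForm.SmoothOn Set.univ := CovectorField.smoothOn_of_contDiffAt fun x₀ y _ _ => by
    have : β.inChart x₀ = fun _ => A := by
      funext z
      ext v
      have hid : mfderiv 𝓘(ℝ, E4) 𝓘(ℝ, E4) (extChartAt 𝓘(ℝ, E4) x₀).symm z v = v := by
        rw [extChartAt_model_space_eq_id]
        change mfderiv 𝓘(ℝ, E4) 𝓘(ℝ, E4) (id : E4 → E4) z v = v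
        rw [mfderiv_id]
        rfl
      exact congrArg A hid
    rw [this]
    exact contDiffAt_const
  refine ⟨β.pull φ, CovectorField.smoothOn_pull isOpen_univ hβ
    (fun y hy => contMDiffAt_extChartAt_of_mem x hy) (fun _ _ => trivial), ?_⟩
  ext v
  exact congrArg α' (mfderiv_symm_comp_mfderiv x (mem_extChartAt_source x) v)

theorem exists_linearIndependent_four {V : Type*} [AddCommGroup V] [Module ℝ V]
    (hV : Module.finrank ℝ V = 4) {a b : V} (h : LinearIndependent ℝ ![a, b]) :
    ∃ c d, LinearIndependent ℝ ![a, b, c, d] := by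
  obtain ⟨c, hc⟩ := exists_linearIndependent_snoc_of_lt_finrank h (by omega)
  obtain ⟨d, hd⟩ := exists_linearIndependent_snoc_of_lt_finrank hc (by omega)
  have e : ![a, b, c, d] = Fin.snoc (Fin.snoc ![a, b] c) d := by
    ext i; fin_cases i <;> rfl
  exact ⟨c, d, e ▸ hd⟩

theorem exists_linearIndependent_pair {V : Type*} [AddCommGroup V] [Module ℝ V]
    {η : Fin 2 → V} (h : LinearIndependent ℝ η) {ζ : V} (hζ : ζ ∈ Submodule.span ℝ (Set.range η))
    (h0 : ζ ≠ 0) : ∃ j, LinearIndependent ℝ ![ζ, η j] := by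
  obtain ⟨c, rfl⟩ := (Submodule.mem_span_range_iff_exists_fun ℝ).1 hζ
  rw [Fin.sum_univ_two] at h0 ⊢
  have h' : ∀ s t : ℝ, s • η 0 + t • η 1 = 0 → s = 0 ∧ t = 0 := by
    have e : ![η 0, η 1] = η := by ext i; fin_cases i <;> rfl
    exact LinearIndependent.pair_iff.1 (e ▸ h)
  by_cases hc : c 0 = 0
  · have hc1 : c 1 ≠ 0 := fun h1 => h0 (by rw [hc, h1]; simp)
    refine ⟨0, LinearIndependent.pair_iff.2 fun s t hst => ?_⟩
    have h2 := h' (s * c 0 + t) (s * c 1) (by rw [← hst]; module)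
    have hs : s = 0 := (mul_eq_zero.1 h2.2).resolve_right hc1
    exact ⟨hs, by simpa [hs] using h2.1⟩
  · refine ⟨1, LinearIndependent.pair_iff.2 fun s t hst => ?_⟩
    have h2 := h' (s * c 0) (s * c 1 + t) (by rw [← hst]; module)
    have hs : s = 0 := (mul_eq_zero.1 h2.1).resolve_right hc
    exact ⟨hs, by simpa [hs] using h2.2⟩

/-- A generator of I⁽¹⁾ is completed to a local basis of I and then to any coframe τ. Expanding Ω in
τ dictates the last two forms of the adapted coframe. -/
theorem LagrangianEngel.exists_adaptedOn (S : LagrangianEngel X) (x : X) :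
    ∃ U θ, x ∈ U ∧ S.AdaptedOn θ U := by
  obtain ⟨U₁, hU₁, hx₁, ζ, hζ, hζ'⟩ := S.engel.derived_rank_one x
  obtain ⟨U₂, hU₂, hx₂, η, hη, hη'⟩ := S.engel.rank_two x
  have hζd : ∀ y ∈ U₁, ζ 0 y ∈ S.I.derived y := fun y hy => by
    rw [(hζ' y hy).2]; exact Submodule.subset_span ⟨0, rfl⟩
  have hηI : ∀ y ∈ U₂, ∀ j, η j y ∈ S.I y := fun y hy j => by
    rw [(hη' y hy).2]; exact Submodule.subset_span ⟨j, rfl⟩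
  obtain ⟨j, hj⟩ := exists_linearIndependent_pair (hη' x hx₂).1
    (by rw [← (hη' x hx₂).2]; exact derived_le _ _ (hζd x hx₁)) ((hζ' x hx₁).1.ne_zero 0)
  obtain ⟨c, d, hcd⟩ := exists_linearIndependent_four finrank_dual_E4 hj
  obtain ⟨γ, hγ, rfl⟩ := exists_smooth_covectorField x c
  obtain ⟨δ, hδ, rfl⟩ := exists_smooth_covectorField x d
  set W := U₁ ∩ U₂ ∩ (extChartAt 𝓘(ℝ, E4) x).source with hWdef
  have hW : IsOpen W := (hU₁.inter hU₂).inter (isOpen_extChartAt_source x)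
  have hxW : x ∈ W := ⟨⟨hx₁, hx₂⟩, mem_extChartAt_source x⟩
  let τ : Fin 4 → CovectorField X := ![ζ 0, η j, γ, δ]
  have hτs : ∀ i, (τ i).toForm.SmoothOn W := by
    intro i
    fin_cases i
    · exact (hζ 0).mono fun y hy => hy.1.1
    · exact (hη j).mono fun y hy => hy.1.2
    · exact hγ.mono fun y hy => hy.2
    · exact hδ.mono fun y hy => hy.2
  have hτx : (fun i => τ i x) = ![ζ 0 x, η j x, γ x, δ x] := by
    funext i; fin_cases i <;> rfl
  obtain ⟨V, hVW, hxV, hτ⟩ := exists_coframeOn hW hτs hxW (hτx ▸ hcd)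
  have hsys : ∀ y ∈ V, S.I y = Submodule.span ℝ
      ((fun i => τ i y) '' (({0, 1} : Finset (Fin 4)) : Set (Fin 4))) := fun y hy => by
    refine eq_span_of_mem S.engel.rank_two y (hτ.linearIndependent y hy) rfl fun i hi => ?_
    rcases Finset.mem_insert.1 hi with rfl | hi
    · exact derived_le _ _ (hζd y (hVW hy).1.1)
    · rw [Finset.mem_singleton.1 hi]; exact hηI y (hVW hy).1.2 j
  let f : Fin 4 → Fin 4 → X → ℝ := fun i j y => S.Ω y ![dualFrame τ y i, dualFrame τ y j]
  have hf : ∀ i j, SmoothFun (f i j) V := hτ.smoothFun_twoForm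
    (S.symplectic.smooth.mono (Set.subset_univ V))
  have hs : ∀ (g : X → ℝ) (i : Fin 4), SmoothFun g V →
      (CovectorField.toForm fun y => g y • τ i y).SmoothOn V := fun g i hg =>
    CovectorField.smoothOn_smul hτ.isOpen hg (hτ.smooth i)
  -- The Lagrangian condition removes the τ₂ ∧ τ₃ term from Ω. Collecting the terms containing τ₀,
  -- and then those containing τ₁, gives Ω = τ₀ ∧ α + τ₁ ∧ β.
  let α : CovectorField X := fun y =>
    f 0 1 y • τ 1 y + (f 0 2 y • τ 2 y + f 0 3 y • τ 3 y)
  let β : CovectorField X := fun y => f 1 2 y • τ 2 y + f 1 3 y • τ 3 y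
  refine ⟨V, ![ζ 0, η j, α, β], hxV, .of hτ.isOpen ?_ ?_
    (fun y hy => hηI y (hVW hy).1.2 j) (fun y hy => hζd y (hVW hy).1.1)⟩
  · intro i
    fin_cases i
    · exact hτ.smooth 0
    · exact hτ.smooth 1
    · exact CovectorField.smoothOn_add hτ.isOpen (hs _ 1 (hf 0 1))
        (CovectorField.smoothOn_add hτ.isOpen (hs _ 2 (hf 0 2)) (hs _ 3 (hf 0 3)))
    · exact CovectorField.smoothOn_add hτ.isOpen (hs _ 2 (hf 1 2)) (hs _ 3 (hf 1 3))
  · intro y hy v w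
    have hi := hτ.linearIndependent y hy
    have h23 : S.Ω y ![dualFrame τ y 2, dualFrame τ y 3] = 0 :=
      S.lagrangian y _ ((mem_perp_iff (hsys y hy) _).2 (by simp [dualFrame_apply hi]))
        _ ((mem_perp_iff (hsys y hy) _).2 (by simp [dualFrame_apply hi]))
    rw [twoForm_apply_frame hi (S.Ω y) v w]
    simp only [Fin.sum_univ_six, pair]
    simp only [α, β, f, τ, Matrix.cons_val] at h23 ⊢
    rw [h23]
    simp only [add_apply, smul_apply, smul_eq_mul]
    ring

end Existence

/-! ### Local equivalences -/

section Equivalence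

variable {X : Type u} [TopologicalSpace X] [ChartedSpace E4 X]
  {Y : Type v} [TopologicalSpace Y] [ChartedSpace E4 Y]

/-- `f` pulls the structure `S'` back to `S` at the point `x`. -/
structure PreservesAt (S : LagrangianEngel X) (S' : LagrangianEngel Y) (f : X → Y) (x : X) :
    Prop where
  smooth : ContMDiffAt 𝓘(ℝ, E4) 𝓘(ℝ, E4) ∞ f x
  form : ∀ v w, S'.Ω (f x) ![mfderiv 𝓘(ℝ, E4) 𝓘(ℝ, E4) f x v, mfderiv 𝓘(ℝ, E4) 𝓘(ℝ, E4) f x w] =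
    S.Ω x ![v, w]
  system : ∀ α, α ∈ S'.I (f x) ↔ α.comp (mfderiv 𝓘(ℝ, E4) 𝓘(ℝ, E4) f x) ∈ S.I x

theorem Preserves.preservesAt {X Y : Type u} [TopologicalSpace X] [ChartedSpace E4 X]
    [TopologicalSpace Y] [ChartedSpace E4 Y] {S : LagrangianEngel X} {S' : LagrangianEngel Y}
    {f : X → Y} (h : Preserves S S' f) (hf : ContMDiff 𝓘(ℝ, E4) 𝓘(ℝ, E4) ∞ f) (x : X) :
    PreservesAt S S' f x where
  smooth := hf.contMDiffAt
  form := fun v w => by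
    rw [← h.1 x]
    refine congrArg (S'.Ω (f x)) ?_
    ext i; fin_cases i <;> rfl
  system := h.2 x

variable {S : LagrangianEngel X} {S' : LagrangianEngel Y} {f : X → Y}

/-- A vector in the kernel of the derivative would lie in the kernel of the nondegenerate form Ω. -/
theorem PreservesAt.mfderiv_injective {x : X} (h : PreservesAt S S' f x)
    {v : TangentSpace 𝓘(ℝ, E4) x} (hv : mfderiv 𝓘(ℝ, E4) 𝓘(ℝ, E4) f x v = 0) : v = 0 :=
  S.symplectic.nondegenerate x v fun w => by
    rw [← h.form, hv]
    exact (S'.Ω (f x)).map_coord_zero (0 : Fin 2) rfl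

variable [IsManifold 𝓘(ℝ, E4) ∞ X] [IsManifold 𝓘(ℝ, E4) ∞ Y]

theorem LagrangianEngel.AdaptedOn.pull {θ : Fin 4 → CovectorField Y} {V : Set Y}
    (h : S'.AdaptedOn θ V) {U : Set X} (hU : IsOpen U) (hf : ∀ x ∈ U, PreservesAt S S' f x)
    (hfV : ∀ x ∈ U, f x ∈ V) : S.AdaptedOn (fun i => (θ i).pull f) U := by
  have hs : ∀ i, ((θ i).pull f).toForm.SmoothOn U := fun i =>
    CovectorField.smoothOn_pull h.coframe.isOpen (h.coframe.smooth i)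
      (fun x hx => (hf x hx).smooth) hfV
  have h0 : ∀ x ∈ U, (θ 0).pull f x ∈ S.I x := fun x hx =>
    ((hf x hx).system _).1 (derived_le _ _ (h.mem_derived (hfV x hx)))
  have h1 : ∀ x ∈ U, (θ 1).pull f x ∈ S.I x := fun x hx =>
    ((hf x hx).system _).1 (h.mem_system (hfV x hx))
  refine .of hU hs (fun x hx v w => ?_) h1 fun x hx => ?_
  · rw [← (hf x hx).form, h.Ω_apply (hfV x hx)]
    rfl
  · refine Submodule.subset_span ⟨U, hU, hx, (θ 0).pull f, hs 0, h0, rfl, fun v hv w hw => ?_⟩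
    rw [CovectorField.d_pull_apply h.coframe.isOpen (h.coframe.smooth 0) (hf x hx).smooth
      (hfV x hx)]
    exact h.d_zero_apply (hfV x hx) (hv _ (h0 x hx)) (hv _ (h1 x hx)) (hw _ (h0 x hx))
      (hw _ (h1 x hx))

/-- The structure functions of a coframe. -/
def structFun {X : Type u} [TopologicalSpace X] [ChartedSpace E4 X] (θ : Fin 4 → CovectorField X)
    (i j k : Fin 4) (x : X) : ℝ :=
  (θ i).d x ![dualFrame θ x j, dualFrame θ x k]

/-- The derivative of `f` carries the frame dual to the pulled-back coframe to the frame dual to θ,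
and d commutes with pullback. -/
theorem LagrangianEngel.AdaptedOn.structFun_pull {θ : Fin 4 → CovectorField Y} {V : Set Y}
    (h : S'.AdaptedOn θ V) {U : Set X} (hU : IsOpen U) (hf : ∀ x ∈ U, PreservesAt S S' f x)
    (hfV : ∀ x ∈ U, f x ∈ V) {x : X} (hx : x ∈ U) (i j k : Fin 4) :
    structFun (fun i => (θ i).pull f) i j k x = structFun θ i j k (f x) := by
  have hp := h.pull hU hf hfV
  have he : ∀ j, mfderiv 𝓘(ℝ, E4) 𝓘(ℝ, E4) f x (dualFrame (fun i => (θ i).pull f) x j) =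
      dualFrame θ (f x) j := fun j => by
    have hi := h.coframe.linearIndependent _ (hfV x hx)
    refine tangent_ext hi fun i => ?_
    rw [dualFrame_apply hi]
    exact dualFrame_apply (hp.coframe.linearIndependent x hx) i j
  rw [structFun, structFun, CovectorField.d_pull_apply h.coframe.isOpen (h.coframe.smooth i)
    (hf x hx).smooth (hfV x hx), he, he]

omit [IsManifold 𝓘(ℝ, E4) ∞ X] [IsManifold 𝓘(ℝ, E4) ∞ Y] in
theorem PreservesAt.comp {Z : Type w} [TopologicalSpace Z] [ChartedSpace E4 Z]
    {S'' : LagrangianEngel Z} {g : Y → Z} {x : X} (hg : PreservesAt S' S'' g (f x))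
    (hf : PreservesAt S S' f x) : PreservesAt S S'' (g ∘ f) x := by
  have hc : mfderiv 𝓘(ℝ, E4) 𝓘(ℝ, E4) (g ∘ f) x =
      (mfderiv 𝓘(ℝ, E4) 𝓘(ℝ, E4) g (f x)).comp (mfderiv 𝓘(ℝ, E4) 𝓘(ℝ, E4) f x) :=
    mfderiv_comp x (hg.smooth.mdifferentiableAt (by simp)) (hf.smooth.mdifferentiableAt (by simp))
  refine ⟨hg.smooth.comp x hf.smooth, fun v w => ?_, fun α => ?_⟩
  · rw [hc, ← hf.form, ← hg.form]
    rfl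
  · rw [hc]
    exact (hg.system α).trans (hf.system _)

omit [IsManifold 𝓘(ℝ, E4) ∞ X] [IsManifold 𝓘(ℝ, E4) ∞ Y] in
/-- A smooth local section of an equivalence is an equivalence. -/
theorem PreservesAt.of_section {σ : Y → X} {y : Y} (hf : PreservesAt S S' f (σ y))
    (hσ : ContMDiffAt 𝓘(ℝ, E4) 𝓘(ℝ, E4) ∞ σ y) (h : f ∘ σ =ᶠ[𝓝 y] id) :
    PreservesAt S' S σ y := by
  let D : E4 →L[ℝ] E4 := mfderiv 𝓘(ℝ, E4) 𝓘(ℝ, E4) f (σ y)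
  let L : E4 →L[ℝ] E4 := mfderiv 𝓘(ℝ, E4) 𝓘(ℝ, E4) σ y
  let Ω' : Y → E4 [⋀^Fin 2]→L[ℝ] ℝ := S'.Ω
  let I' : Y → Submodule ℝ (E4 →L[ℝ] ℝ) := S'.I
  have hy : f (σ y) = y := h.self_of_nhds
  have hc : mfderiv 𝓘(ℝ, E4) 𝓘(ℝ, E4) (f ∘ σ) y =
      (mfderiv 𝓘(ℝ, E4) 𝓘(ℝ, E4) f (σ y)).comp (mfderiv 𝓘(ℝ, E4) 𝓘(ℝ, E4) σ y) :=
    mfderiv_comp y (hf.smooth.mdifferentiableAt (by simp)) (hσ.mdifferentiableAt (by simp))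
  have hDL : ∀ v, D (L v) = v := fun v => by
    have h1 : mfderiv 𝓘(ℝ, E4) 𝓘(ℝ, E4) (f ∘ σ) y = mfderiv 𝓘(ℝ, E4) 𝓘(ℝ, E4) (id : Y → Y) y :=
      h.mfderiv_eq
    rw [mfderiv_id] at h1
    exact congrArg (fun T : E4 →L[ℝ] E4 => T v) (hc.symm.trans h1)
  -- `D` is injective since `f` preserves the symplectic form, so its right inverse `L` is also a
  -- left inverse.
  have hLD : ∀ v, L (D v) = v := fun v => by
    have := hf.mfderiv_injective (v := (L (D v) - v : E4)) ((D.map_sub _ _).trans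
      (sub_eq_zero.2 (hDL _)))
    exact sub_eq_zero.1 this
  refine ⟨hσ, fun v w => ?_, fun α => ?_⟩
  · have key : ∀ v w : E4, Ω' (f (σ y)) ![D (L v), D (L w)] = Ω' y ![v, w] := fun v w => by
      rw [hDL, hDL, hy]
    exact (hf.form _ _).symm.trans (key v w)
  · let α' : E4 →L[ℝ] ℝ := α
    have h1 : α'.comp L ∈ I' (f (σ y)) ↔ (α'.comp L).comp D ∈ S.I (σ y) := hf.system (α'.comp L)
    have h2 : (α'.comp L).comp D = α' := by
      ext v
      exact congrArg α' (hLD v)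
    rw [h2, hy] at h1
    exact h1.symm

omit [IsManifold 𝓘(ℝ, E4) ∞ X] [IsManifold 𝓘(ℝ, E4) ∞ Y] in
/-- The local equivalences act transitively. -/
def LagrangianEngel.IsLocallyHomogeneous (S : LagrangianEngel X) : Prop :=
  ∀ x y : X, ∃ (f : X → X) (U : Set X), IsOpen U ∧ x ∈ U ∧ f x = y ∧ ∀ z ∈ U, PreservesAt S S f z

omit [IsManifold 𝓘(ℝ, E4) ∞ X] [IsManifold 𝓘(ℝ, E4) ∞ Y] in
theorem LagrangianEngel.IsHomogeneous.quotient (hS : S.IsHomogeneous)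
    (hf : IsLocalDiffeomorph 𝓘(ℝ, E4) 𝓘(ℝ, E4) ∞ f) (hs : Function.Surjective f)
    (hp : ∀ x, PreservesAt S S' f x) : S'.IsLocallyHomogeneous := fun y y' => by
  obtain ⟨x, rfl⟩ := hs y
  obtain ⟨x', rfl⟩ := hs y'
  obtain ⟨Φ, hxΦ, hΦ⟩ := hf x
  obtain ⟨φ, hφ, hφx⟩ := hS x x'
  have hfx : f x = Φ.toPartialEquiv x := hΦ hxΦ
  have hsym : Φ.toPartialEquiv.symm (f x) = x := by
    rw [hfx]; exact Φ.toPartialEquiv.left_inv hxΦ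
  -- The local symmetry downstairs lifts by a local inverse of `f`, applies a symmetry `φ` of the
  -- cover, and projects back.
  refine ⟨f ∘ φ ∘ Φ.toPartialEquiv.symm, Φ.target, Φ.open_target, ?_, ?_, fun z hz => ?_⟩
  · rw [hfx]; exact Φ.toPartialEquiv.map_source hxΦ
  · simp only [Function.comp_apply]
    rw [hsym, hφx]
  · have h1 : PreservesAt S' S Φ.toPartialEquiv.symm z := by
      refine PreservesAt.of_section (hp _)
        ((Φ.contMDiffOn_invFun z hz).contMDiffAt (Φ.open_target.mem_nhds hz)) ?_
      filter_upwards [Φ.open_target.mem_nhds hz] with t ht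
      have : f (Φ.toPartialEquiv.symm t) = Φ.toPartialEquiv (Φ.toPartialEquiv.symm t) :=
        hΦ (Φ.toPartialEquiv.map_target ht)
      exact this.trans (Φ.toPartialEquiv.right_inv ht)
    exact (hp _).comp (((hφ.preservesAt φ.contMDiff) _).comp h1)

end Equivalence

/-! ### Change of adapted coframe -/

section Change

variable {X : Type u} [TopologicalSpace X] [ChartedSpace E4 X] [IsManifold 𝓘(ℝ, E4) ∞ X]
  {S : LagrangianEngel X} {θ θ' : Fin 4 → CovectorField X} {U U' : Set X} {x : X}

omit [IsManifold 𝓘(ℝ, E4) ∞ X] in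
theorem LagrangianEngel.AdaptedOn.zero_eq (h : S.AdaptedOn θ U) (h' : S.AdaptedOn θ' U')
    (hx : x ∈ U) (hx' : x ∈ U') (v : TangentSpace 𝓘(ℝ, E4) x) :
    θ' 0 x v = θ' 0 x (dualFrame θ x 0) * θ 0 x v := by
  have hi := h.coframe.linearIndependent x hx
  have hm := h'.mem_derived hx'
  rw [h.derived x hx, mem_span_image_iff hi] at hm
  conv_lhs => rw [covector_eq_sum hi (θ' 0 x)]
  simp [Fin.sum_univ_four, hm 1 (by decide), hm 2 (by decide), hm 3 (by decide)]

omit [IsManifold 𝓘(ℝ, E4) ∞ X] in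
theorem LagrangianEngel.AdaptedOn.one_eq (h : S.AdaptedOn θ U) (h' : S.AdaptedOn θ' U')
    (hx : x ∈ U) (hx' : x ∈ U') (v : TangentSpace 𝓘(ℝ, E4) x) :
    θ' 1 x v = θ' 1 x (dualFrame θ x 0) * θ 0 x v + θ' 1 x (dualFrame θ x 1) * θ 1 x v := by
  have hi := h.coframe.linearIndependent x hx
  have hm := h'.mem_system hx'
  rw [h.system x hx, mem_span_image_iff hi] at hm
  conv_lhs => rw [covector_eq_sum hi (θ' 1 x)]
  simp [Fin.sum_univ_four, hm 2 (by decide), hm 3 (by decide)]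

theorem LagrangianEngel.AdaptedOn.d_zero_eq (h : S.AdaptedOn θ U) (h' : S.AdaptedOn θ' U')
    (hx : x ∈ U) (hx' : x ∈ U') {v w : TangentSpace 𝓘(ℝ, E4) x} (hv : θ 0 x v = 0)
    (hw : θ 0 x w = 0) :
    (θ' 0).d x ![v, w] = θ' 0 x (dualFrame θ x 0) * (θ 0).d x ![v, w] := by
  have := d_section h.coframe h.derived hx h'.coframe.isOpen hx' (h'.coframe.smooth 0)
    (fun y hy => h'.mem_derived hy) (v := v) (w := w) (by simpa using hv) (by simpa using hw)
  simpa using this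

theorem LagrangianEngel.AdaptedOn.d_one_eq (h : S.AdaptedOn θ U) (h' : S.AdaptedOn θ' U')
    (hx : x ∈ U) (hx' : x ∈ U') {v w : TangentSpace 𝓘(ℝ, E4) x} (hv0 : θ 0 x v = 0)
    (hv1 : θ 1 x v = 0) (hw0 : θ 0 x w = 0) (hw1 : θ 1 x w = 0) :
    (θ' 1).d x ![v, w] = θ' 1 x (dualFrame θ x 1) * (θ 1).d x ![v, w] := by
  have := d_section h.coframe h.system hx h'.coframe.isOpen hx' (h'.coframe.smooth 1)
    (fun y hy => h'.mem_system hy) (v := v) (w := w) (by simp [hv0, hv1]) (by simp [hw0, hw1])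
  rw [Finset.sum_pair (by decide), h.d_zero_apply hx hv0 hv1 hw0 hw1] at this
  simpa using this

theorem LagrangianEngel.AdaptedOn.structFun_zero_two_three (h : S.AdaptedOn θ U) (hx : x ∈ U) :
    structFun θ 0 2 3 x = 0 := by
  have hi := h.coframe.linearIndependent x hx
  exact h.d_zero_apply hx (by simp [dualFrame_apply hi]) (by simp [dualFrame_apply hi])
    (by simp [dualFrame_apply hi]) (by simp [dualFrame_apply hi])

omit [IsManifold 𝓘(ℝ, E4) ∞ X] in
theorem d_eq_structFun (hi : LinearIndependent ℝ (fun i => θ i x)) (i : Fin 4)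
    (v w : TangentSpace 𝓘(ℝ, E4) x) : (θ i).d x ![v, w] =
      structFun θ i 0 1 x * (θ 0 x v * θ 1 x w - θ 0 x w * θ 1 x v) +
      structFun θ i 0 2 x * (θ 0 x v * θ 2 x w - θ 0 x w * θ 2 x v) +
      structFun θ i 0 3 x * (θ 0 x v * θ 3 x w - θ 0 x w * θ 3 x v) +
      structFun θ i 1 2 x * (θ 1 x v * θ 2 x w - θ 1 x w * θ 2 x v) +
      structFun θ i 1 3 x * (θ 1 x v * θ 3 x w - θ 1 x w * θ 3 x v) +
      structFun θ i 2 3 x * (θ 2 x v * θ 3 x w - θ 2 x w * θ 3 x v) := by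
  rw [twoForm_apply_frame hi ((θ i).d x) v w, Fin.sum_univ_six]
  rfl

omit [IsManifold 𝓘(ℝ, E4) ∞ X] in
/-- The coordinates of the dual frame of an adapted coframe with respect to another one. -/
theorem LagrangianEngel.AdaptedOn.dualFrame_change (h : S.AdaptedOn θ U) (h' : S.AdaptedOn θ' U')
    (hx : x ∈ U) (hx' : x ∈ U') :
    θ' 0 x (dualFrame θ x 0) ≠ 0 ∧ θ' 1 x (dualFrame θ x 1) ≠ 0 ∧
    (∀ j, θ' 0 x (dualFrame θ x 0) * θ 0 x (dualFrame θ' x j) = if 0 = j then 1 else 0) ∧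
    (∀ j, θ' 1 x (dualFrame θ x 0) * θ 0 x (dualFrame θ' x j) +
      θ' 1 x (dualFrame θ x 1) * θ 1 x (dualFrame θ' x j) = if 1 = j then 1 else 0) ∧
    θ 2 x (dualFrame θ' x 2) = θ' 0 x (dualFrame θ x 0) ∧
    θ 3 x (dualFrame θ' x 2) = 0 ∧
    θ 2 x (dualFrame θ' x 3) = θ' 1 x (dualFrame θ x 0) ∧
    θ 3 x (dualFrame θ' x 3) = θ' 1 x (dualFrame θ x 1) := by
  have hi := h.coframe.linearIndependent x hx
  have hi' := h'.coframe.linearIndependent x hx'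
  have h0 : ∀ j, θ' 0 x (dualFrame θ x 0) * θ 0 x (dualFrame θ' x j) =
      if 0 = j then 1 else 0 := fun j => by
    rw [← h.zero_eq h' hx hx', dualFrame_apply hi']
  have h1 : ∀ j, θ' 1 x (dualFrame θ x 0) * θ 0 x (dualFrame θ' x j) +
      θ' 1 x (dualFrame θ x 1) * θ 1 x (dualFrame θ' x j) = if 1 = j then 1 else 0 := fun j => by
    rw [← h.one_eq h' hx hx', dualFrame_apply hi']
  have n0 : θ' 0 x (dualFrame θ x 0) ≠ 0 := fun h2 => by
    have := h0 0
    rw [h2] at this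
    simp at this
  have z0 : ∀ j, j ≠ 0 → θ 0 x (dualFrame θ' x j) = 0 := fun j hj => by
    have := h0 j
    rw [if_neg hj.symm] at this
    exact (mul_eq_zero.1 this).resolve_left n0
  have n1 : θ' 1 x (dualFrame θ x 1) ≠ 0 := fun h2 => by
    have := h1 1
    rw [h2, z0 1 (by decide)] at this
    simp at this
  have z1 : ∀ j, j ≠ 0 → j ≠ 1 → θ 1 x (dualFrame θ' x j) = 0 := fun j hj hj1 => by
    have := h1 j
    rw [if_neg hj1.symm, z0 j hj, mul_zero, zero_add] at this
    exact (mul_eq_zero.1 this).resolve_left n1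
  -- Both coframes express the same Ω. Pairing e₀ and e₁ with the new frame vectors determines the
  -- θ₂- and θ₃-components of the latter.
  have e : ∀ v w, _ := fun v w => (h.Ω_apply hx v w).symm.trans (h'.Ω_apply hx' v w)
  have key0 : ∀ j, j ≠ 0 → j ≠ 1 → θ 2 x (dualFrame θ' x j) =
      θ' 0 x (dualFrame θ x 0) * θ' 2 x (dualFrame θ' x j) +
      θ' 1 x (dualFrame θ x 0) * θ' 3 x (dualFrame θ' x j) := fun j hj hj1 => by
    have := e (dualFrame θ x 0) (dualFrame θ' x j)
    simpa [dualFrame_apply hi, dualFrame_apply hi', z0 j hj, z1 j hj hj1, hj.symm, hj1.symm]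
      using this
  have z2 : θ' 0 x (dualFrame θ x 1) = 0 := by
    rw [h.zero_eq h' hx hx', dualFrame_apply hi]; simp
  have key1 : ∀ j, j ≠ 0 → j ≠ 1 → θ 3 x (dualFrame θ' x j) =
      θ' 1 x (dualFrame θ x 1) * θ' 3 x (dualFrame θ' x j) := fun j hj hj1 => by
    have := e (dualFrame θ x 1) (dualFrame θ' x j)
    simpa [dualFrame_apply hi, dualFrame_apply hi', z0 j hj, z1 j hj hj1, hj.symm, hj1.symm, z2]
      using this
  refine ⟨n0, n1, h0, h1, ?_, ?_, ?_, ?_⟩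
  · rw [key0 2 (by decide) (by decide)]; simp [dualFrame_apply hi']
  · rw [key1 2 (by decide) (by decide)]; simp [dualFrame_apply hi']
  · rw [key0 3 (by decide) (by decide)]; simp [dualFrame_apply hi']
  · rw [key1 3 (by decide) (by decide)]; simp [dualFrame_apply hi']

/-- Transformation of the leading structure functions. -/
theorem LagrangianEngel.AdaptedOn.structFun_change (h : S.AdaptedOn θ U) (h' : S.AdaptedOn θ' U')
    (hx : x ∈ U) (hx' : x ∈ U') :
    θ' 1 x (dualFrame θ x 1) * structFun θ' 0 1 2 x =
      θ' 0 x (dualFrame θ x 0) ^ 2 * structFun θ 0 1 2 x ∧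
    θ' 1 x (dualFrame θ x 1) * structFun θ' 0 1 3 x = θ' 0 x (dualFrame θ x 0) *
      (θ' 1 x (dualFrame θ x 0) * structFun θ 0 1 2 x +
        θ' 1 x (dualFrame θ x 1) * structFun θ 0 1 3 x) ∧
    structFun θ' 1 2 3 x = θ' 1 x (dualFrame θ x 1) ^ 2 * θ' 0 x (dualFrame θ x 0) *
      structFun θ 1 2 3 x := by
  have hi := h.coframe.linearIndependent x hx
  obtain ⟨n0, n1, h0, h1, e22, e32, e23, e33⟩ := h.dualFrame_change h' hx hx'
  have z0 : ∀ j, j ≠ 0 → θ 0 x (dualFrame θ' x j) = 0 := fun j hj => by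
    have := h0 j
    rw [if_neg hj.symm] at this
    exact (mul_eq_zero.1 this).resolve_left n0
  have z1 : ∀ j, j ≠ 0 → j ≠ 1 → θ 1 x (dualFrame θ' x j) = 0 := fun j hj hj1 => by
    have := h1 j
    rw [if_neg hj1.symm, z0 j hj, mul_zero, zero_add] at this
    exact (mul_eq_zero.1 this).resolve_left n1
  have o1 : θ' 1 x (dualFrame θ x 1) * θ 1 x (dualFrame θ' x 1) = 1 := by
    simpa [z0 1 (by decide)] using h1 1
  have c23 := h.structFun_zero_two_three hx
  have z01 := z0 1 (by decide)
  have z02 := z0 2 (by decide)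
  have z03 := z0 3 (by decide)
  have z12 := z1 2 (by decide) (by decide)
  have z13 := z1 3 (by decide) (by decide)
  refine ⟨?_, ?_, ?_⟩
  · rw [structFun, h.d_zero_eq h' hx hx' z01 z02, d_eq_structFun hi, c23, z01, z02, z12, e22, e32]
    linear_combination (θ' 0 x (dualFrame θ x 0) ^ 2 * structFun θ 0 1 2 x) * o1
  · rw [structFun, h.d_zero_eq h' hx hx' z01 z03, d_eq_structFun hi, c23, z01, z03, z13, e23, e33]
    linear_combination (θ' 0 x (dualFrame θ x 0) *
      (θ' 1 x (dualFrame θ x 0) * structFun θ 0 1 2 x +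
        θ' 1 x (dualFrame θ x 1) * structFun θ 0 1 3 x)) * o1
  · rw [structFun, h.d_one_eq h' hx hx' z02 z12 z03 z13, d_eq_structFun hi, z02, z03, z12, z13,
      e22, e32, e23, e33]
    ring

/-- Transformation of the structure functions when the first two forms are unchanged. -/
theorem LagrangianEngel.AdaptedOn.structFun_change_of_eq (h : S.AdaptedOn θ U)
    (h' : S.AdaptedOn θ' U) (h0 : ∀ y ∈ U, θ' 0 y = θ 0 y) (h1 : ∀ y ∈ U, θ' 1 y = θ 1 y)
    (hx : x ∈ U) :
    dualFrame θ' x 0 = dualFrame θ x 0 + θ 2 x (dualFrame θ' x 0) • dualFrame θ x 2 +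
      θ 3 x (dualFrame θ' x 0) • dualFrame θ x 3 ∧
    dualFrame θ' x 1 = dualFrame θ x 1 + θ 3 x (dualFrame θ' x 0) • dualFrame θ x 2 +
      θ 3 x (dualFrame θ' x 1) • dualFrame θ x 3 ∧
    dualFrame θ' x 2 = dualFrame θ x 2 ∧ dualFrame θ' x 3 = dualFrame θ x 3 ∧
    structFun θ' 0 0 1 x = structFun θ 0 0 1 x +
      θ 3 x (dualFrame θ' x 0) * structFun θ 0 0 2 x +
      θ 3 x (dualFrame θ' x 1) * structFun θ 0 0 3 x -
      θ 2 x (dualFrame θ' x 0) * structFun θ 0 1 2 x -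
      θ 3 x (dualFrame θ' x 0) * structFun θ 0 1 3 x ∧
    structFun θ' 1 1 2 x = structFun θ 1 1 2 x -
      θ 3 x (dualFrame θ' x 1) * structFun θ 1 2 3 x ∧
    structFun θ' 1 0 2 x = structFun θ 1 0 2 x -
      θ 3 x (dualFrame θ' x 0) * structFun θ 1 2 3 x ∧
    structFun θ' 1 1 3 x = structFun θ 1 1 3 x +
      θ 3 x (dualFrame θ' x 0) * structFun θ 1 2 3 x := by
  have hi := h.coframe.linearIndependent x hx
  have hi' := h'.coframe.linearIndependent x hx
  have f0 : ∀ j, θ 0 x (dualFrame θ' x j) = if 0 = j then 1 else 0 := fun j => by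
    rw [← h0 x hx, dualFrame_apply hi']
  have f1 : ∀ j, θ 1 x (dualFrame θ' x j) = if 1 = j then 1 else 0 := fun j => by
    rw [← h1 x hx, dualFrame_apply hi']
  obtain ⟨-, -, -, -, e22, e32, e23, e33⟩ := h.dualFrame_change h' hx hx
  rw [h0 x hx, dualFrame_apply hi] at e22
  rw [h1 x hx, dualFrame_apply hi] at e23 e33
  -- Since Ω(e₀', e₁') = 0, the shear is symmetric, and three parameters remain.
  have e21 : θ 2 x (dualFrame θ' x 1) = θ 3 x (dualFrame θ' x 0) := by
    have := (h.Ω_apply hx (dualFrame θ' x 0) (dualFrame θ' x 1)).symm.trans (h'.Ω_apply hx _ _)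
    simp only [f0, f1, dualFrame_apply hi'] at this
    simp at this
    linarith
  have c23 := h.structFun_zero_two_three hx
  have d0 : (θ' 0).d x = (θ 0).d x := CovectorField.d_congr h.coframe.isOpen h0 hx
  have d1 : (θ' 1).d x = (θ 1).d x := CovectorField.d_congr h.coframe.isOpen h1 hx
  refine ⟨?_, ?_, ?_, ?_, ?_, ?_, ?_, ?_⟩
  · refine tangent_ext hi fun i => ?_
    fin_cases i <;> simp [f0, f1, dualFrame_apply hi]
  · refine tangent_ext hi fun i => ?_
    fin_cases i <;> simp [f0, f1, dualFrame_apply hi, e21]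
  · refine tangent_ext hi fun i => ?_
    fin_cases i <;> simp [f0, f1, dualFrame_apply hi, e22, e32]
  · refine tangent_ext hi fun i => ?_
    fin_cases i <;> simp [f0, f1, dualFrame_apply hi, e23, e33]
  · rw [structFun, d0, d_eq_structFun hi, c23, e21]
    simp [f0, f1]
    ring
  · rw [structFun, d1, d_eq_structFun hi, e21, e22, e32]
    simp [f0, f1]
    ring
  · rw [structFun, d1, d_eq_structFun hi, e22, e32]
    simp [f0, f1]
    ring
  · rw [structFun, d1, d_eq_structFun hi, e21, e23, e33]
    simp [f0, f1]
    ring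

end Change

/-! ### Canonical coframes of generic structures -/

section Normal

/-- The function is t ↦ t^(-1/5), extended oddly to negative t. It supplies the scaling that solves
a⁵A²C = 1 whatever the sign of C. -/
theorem exists_fifth_root_inv : ∃ F : ℝ → ℝ, ∀ t ≠ 0, ContDiffAt ℝ ∞ F t ∧ F t ^ 5 * t = 1 := by
  have hp : ∀ t : ℝ, 0 < t → (t ^ (-(1 / 5 : ℝ))) ^ 5 * t = 1 := fun t ht => by
    rw [← Real.rpow_natCast, ← Real.rpow_mul ht.le]
    norm_num
    rw [Real.rpow_neg_one, inv_mul_cancel₀ ht.ne']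
  refine ⟨fun t => if 0 < t then t ^ (-(1 / 5 : ℝ)) else -((-t) ^ (-(1 / 5 : ℝ))), fun t ht => ?_⟩
  rcases ht.lt_or_gt with h | h
  · constructor
    · have h1 : ContDiffAt ℝ ∞ (fun t : ℝ => -((-t) ^ (-(1 / 5 : ℝ)))) t :=
        (contDiff_neg.contDiffAt.rpow_const_of_ne (neg_ne_zero.2 ht)).neg
      refine h1.congr_of_eventuallyEq ?_
      filter_upwards [gt_mem_nhds h] with s hs
      rw [if_neg hs.not_gt]
    · have := hp (-t) (neg_pos.2 h)
      simp only [if_neg h.not_gt]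
      linear_combination this
  · constructor
    · refine (Real.contDiffAt_rpow_const_of_ne (p := -(1 / 5 : ℝ)) ht).congr_of_eventuallyEq ?_
      filter_upwards [lt_mem_nhds h] with s hs
      rw [if_pos hs]
    · simp only [if_pos h]
      exact hp t h

variable {X : Type u} [TopologicalSpace X] [ChartedSpace E4 X]

/-- The normalisation of the structure functions of a canonical coframe. -/
structure IsNormalAt (θ : Fin 4 → CovectorField X) (x : X) : Prop where
  c012 : structFun θ 0 1 2 x = 1
  c013 : structFun θ 0 1 3 x = 0
  c123 : structFun θ 1 2 3 x = 1
  c001 : structFun θ 0 0 1 x = 0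
  c112 : structFun θ 1 1 2 x = 0
  c102 : structFun θ 1 0 2 x = structFun θ 1 1 3 x

variable [IsManifold 𝓘(ℝ, E4) ∞ X]
  {S : LagrangianEngel X} {θ θ' : Fin 4 → CovectorField X} {U : Set X} {x : X}

/-- A canonical coframe is unique. -/
theorem LagrangianEngel.AdaptedOn.eq_of_isNormalAt (h : S.AdaptedOn θ U) (h' : S.AdaptedOn θ' U)
    (hn : ∀ y ∈ U, IsNormalAt θ y) (hn' : ∀ y ∈ U, IsNormalAt θ' y) (hx : x ∈ U) (i : Fin 4) :
    θ' i x = θ i x := by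
  have key : ∀ y ∈ U, θ' 0 y = θ 0 y ∧ θ' 1 y = θ 1 y := fun y hy => by
    obtain ⟨n0, n1, -⟩ := h.dualFrame_change h' hy hy
    obtain ⟨e1, e2, e3⟩ := h.structFun_change h' hy hy
    rw [(hn y hy).c012, (hn' y hy).c012, mul_one, mul_one] at e1
    rw [(hn y hy).c012, (hn' y hy).c013, (hn y hy).c013, mul_zero, mul_one, add_zero]
      at e2
    rw [(hn y hy).c123, (hn' y hy).c123, e1, mul_one] at e3
    have k0 : θ' 1 y (dualFrame θ y 0) = 0 := (mul_eq_zero.1 e2.symm).resolve_left n0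
    -- The transformation rules leave m = a² and a⁵ = 1, and the real fifth root of 1 is unique, so
    -- not even a sign ambiguity remains.
    have l1 : θ' 0 y (dualFrame θ y 0) = 1 := by
      have h5 : θ' 0 y (dualFrame θ y 0) ^ 5 = 1 := by rw [e3]; ring
      exact (Odd.strictMono_pow (by decide : Odd 5)).injective (h5.trans (one_pow 5).symm)
    constructor
    · ext v
      rw [h.zero_eq h' hy hy, l1, one_mul]
    · ext v
      rw [h.one_eq h' hy hy, k0, e1, l1]
      ring
  obtain ⟨d0, d1, d2, d3, f1, f2, f3, f4⟩ := h.structFun_change_of_eq h'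
    (fun y hy => (key y hy).1) (fun y hy => (key y hy).2) hx
  have hnx := hn x hx
  have hnx' := hn' x hx
  rw [hnx.c123, hnx.c112, hnx'.c112] at f2
  have r0 : θ 3 x (dualFrame θ' x 1) = 0 := by linarith
  rw [hnx.c123, hnx'.c102] at f3
  rw [hnx.c123, ← hnx.c102] at f4
  -- The shear changes c^1_02 by -q and c^1_13 by +q; as they are equal in both coframes, q = 0.
  have q0 : θ 3 x (dualFrame θ' x 0) = 0 := by linarith
  rw [hnx.c001, hnx'.c001, r0, q0, hnx.c012] at f1
  have p0 : θ 2 x (dualFrame θ' x 0) = 0 := by linarith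
  rw [p0, q0, zero_smul, zero_smul, add_zero, add_zero] at d0
  rw [q0, r0, zero_smul, zero_smul, add_zero, add_zero] at d1
  have hd : ∀ j, dualFrame θ' x j = dualFrame θ x j := fun j => by
    fin_cases j
    exacts [d0, d1, d2, d3]
  have hi := h.coframe.linearIndependent x hx
  refine covector_ext hi fun j => ?_
  rw [dualFrame_apply hi, ← hd j, dualFrame_apply (h'.coframe.linearIndependent x hx)]

theorem LagrangianEngel.AdaptedOn.smoothFun_structFun (h : S.AdaptedOn θ U) (i j k : Fin 4) :
    SmoothFun (structFun θ i j k) U :=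
  h.coframe.smoothFun_twoForm ((h.coframe.smooth i).d h.coframe.isOpen) j k

omit [IsManifold 𝓘(ℝ, E4) ∞ X] in
theorem SmoothFun.isOpen_inter_ne_zero {f : X → ℝ} (hU : IsOpen U) (hf : SmoothFun f U) :
    IsOpen (U ∩ {y | f y ≠ 0}) :=
  isOpen_iff_mem_nhds.2 fun _ hy =>
    Filter.inter_mem (hU.mem_nhds hy.1) ((hf.continuousAt hy.1).eventually_ne hy.2)

omit [IsManifold 𝓘(ℝ, E4) ∞ X] in
/-- The coframe obtained by rescaling and changing the second form by a multiple of the first. -/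
theorem LagrangianEngel.AdaptedOn.exists_change (h : S.AdaptedOn θ U) {a k m : X → ℝ}
    (ha : SmoothFun a U) (hk : SmoothFun k U) (hm : SmoothFun m U) (ha0 : ∀ y ∈ U, a y ≠ 0)
    (hm0 : ∀ y ∈ U, m y ≠ 0) : ∃ θ', S.AdaptedOn θ' U ∧ ∀ y ∈ U,
      θ' 0 y (dualFrame θ y 0) = a y ∧ θ' 1 y (dualFrame θ y 0) = k y ∧
      θ' 1 y (dualFrame θ y 1) = m y := by
  have hU := h.coframe.isOpen
  have hs : ∀ (g : X → ℝ) (i : Fin 4), SmoothFun g U →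
      (CovectorField.toForm fun y => g y • θ i y).SmoothOn U := fun g i hg =>
    CovectorField.smoothOn_smul hU hg (h.coframe.smooth i)
  have ha' := ha.inv ha0
  have hm' := hm.inv hm0
  refine ⟨![fun y => a y • θ 0 y, fun y => k y • θ 0 y + m y • θ 1 y,
    fun y => (a y)⁻¹ • θ 2 y + (-(k y * (a y)⁻¹ * (m y)⁻¹)) • θ 3 y, fun y => (m y)⁻¹ • θ 3 y],
    .of hU (fun i => ?_) (fun y hy v w => ?_) (fun y hy => ?_) (fun y hy => ?_), fun y hy => ?_⟩
  · fin_cases i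
    · exact hs _ 0 ha
    · exact CovectorField.smoothOn_add hU (hs _ 0 hk) (hs _ 1 hm)
    · exact CovectorField.smoothOn_add hU (hs _ 2 ha') (hs _ 3 ((hk.mul ha').mul hm').neg)
    · exact hs _ 3 hm'
  · have h1 := ha0 y hy
    have h2 := hm0 y hy
    rw [h.Ω_apply hy]
    simp only [Matrix.cons_val, add_apply, smul_apply, smul_eq_mul]
    field_simp
    ring
  · exact (S.I y).add_mem ((S.I y).smul_mem _ (derived_le _ _ (h.mem_derived hy)))
      ((S.I y).smul_mem _ (h.mem_system hy))
  · exact (S.I.derived y).smul_mem _ (h.mem_derived hy)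
  · have hi := h.coframe.linearIndependent y hy
    simp [dualFrame_apply hi]

omit [IsManifold 𝓘(ℝ, E4) ∞ X] in
/-- The coframe obtained by changing the last two forms by multiples of the first two. -/
theorem LagrangianEngel.AdaptedOn.exists_shear (h : S.AdaptedOn θ U) {p q r : X → ℝ}
    (hp : SmoothFun p U) (hq : SmoothFun q U) (hr : SmoothFun r U) :
    ∃ θ', S.AdaptedOn θ' U ∧ (∀ y ∈ U, θ' 0 y = θ 0 y) ∧ (∀ y ∈ U, θ' 1 y = θ 1 y) ∧
      ∀ y ∈ U, θ 2 y (dualFrame θ' y 0) = p y ∧ θ 3 y (dualFrame θ' y 0) = q y ∧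
      θ 3 y (dualFrame θ' y 1) = r y := by
  have hU := h.coframe.isOpen
  have hs : ∀ (g : X → ℝ) (i : Fin 4), SmoothFun g U →
      (CovectorField.toForm fun y => g y • θ i y).SmoothOn U := fun g i hg =>
    CovectorField.smoothOn_smul hU hg (h.coframe.smooth i)
  let θ' : Fin 4 → CovectorField X := ![θ 0, θ 1,
    fun y => θ 2 y + ((-p y) • θ 0 y + (-q y) • θ 1 y),
    fun y => θ 3 y + ((-q y) • θ 0 y + (-r y) • θ 1 y)]
  have h' : S.AdaptedOn θ' U := .of hU (fun i => by
    fin_cases i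
    · exact h.coframe.smooth 0
    · exact h.coframe.smooth 1
    · exact CovectorField.smoothOn_add hU (h.coframe.smooth 2)
        (CovectorField.smoothOn_add hU (hs _ 0 hp.neg) (hs _ 1 hq.neg))
    · exact CovectorField.smoothOn_add hU (h.coframe.smooth 3)
        (CovectorField.smoothOn_add hU (hs _ 0 hq.neg) (hs _ 1 hr.neg)))
    (fun y hy v w => by
      rw [h.Ω_apply hy]
      simp only [θ', Matrix.cons_val, add_apply, smul_apply, smul_eq_mul]
      ring) (fun y hy => h.mem_system hy) (fun y hy => h.mem_derived hy)
  refine ⟨θ', h', fun _ _ => rfl, fun _ _ => rfl, fun y hy => ?_⟩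
  have hi := h'.coframe.linearIndependent y hy
  have f0 : ∀ j, θ 0 y (dualFrame θ' y j) = if 0 = j then 1 else 0 := fun j =>
    dualFrame_apply hi 0 j
  have f1 : ∀ j, θ 1 y (dualFrame θ' y j) = if 1 = j then 1 else 0 := fun j =>
    dualFrame_apply hi 1 j
  have f2 : ∀ j, θ 2 y (dualFrame θ' y j) + (-p y * θ 0 y (dualFrame θ' y j) +
      -q y * θ 1 y (dualFrame θ' y j)) = if 2 = j then 1 else 0 := fun j =>
    dualFrame_apply hi 2 j
  have f3 : ∀ j, θ 3 y (dualFrame θ' y j) + (-q y * θ 0 y (dualFrame θ' y j) +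
      -r y * θ 1 y (dualFrame θ' y j)) = if 3 = j then 1 else 0 := fun j =>
    dualFrame_apply hi 3 j
  have g2 := f2 0
  have g3 := f3 0
  have g31 := f3 1
  rw [f0, f1] at g2 g3 g31
  simp at g2 g3 g31
  exact ⟨by linarith, by linarith, by linarith⟩

/-- Existence of canonical coframes. -/
theorem LagrangianEngel.AdaptedOn.exists_isNormalAt (h : S.AdaptedOn θ U) (hx : x ∈ U)
    (hA : structFun θ 0 1 2 x ≠ 0) :
    ∃ V θ', x ∈ V ∧ S.AdaptedOn θ' V ∧ ∀ y ∈ V, IsNormalAt θ' y := by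
  obtain ⟨F, hF⟩ := exists_fifth_root_inv
  have hV := (h.smoothFun_structFun 0 1 2).isOpen_inter_ne_zero h.coframe.isOpen
  set V := U ∩ {y | structFun θ 0 1 2 y ≠ 0}
  have hθ := h.mono hV Set.inter_subset_left
  have sA := hθ.smoothFun_structFun 0 1 2
  have sB := hθ.smoothFun_structFun 0 1 3
  have sC := hθ.smoothFun_structFun 1 2 3
  have nA : ∀ y ∈ V, structFun θ 0 1 2 y ≠ 0 := fun y hy => hy.2
  have nT : ∀ y ∈ V, structFun θ 0 1 2 y * structFun θ 0 1 2 y * structFun θ 1 2 3 y ≠ 0 :=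
    fun y hy => mul_ne_zero (mul_ne_zero hy.2 hy.2) (hθ.d_one_ne_zero hy)
  have sT := (sA.mul sA).mul sC
  have sl := sT.comp fun y hy => (hF _ (nT y hy)).1
  set l : X → ℝ := fun y =>
    F (structFun θ 0 1 2 y * structFun θ 0 1 2 y * structFun θ 1 2 3 y)
  have hl : ∀ y ∈ V, l y ^ 5 * (structFun θ 0 1 2 y * structFun θ 0 1 2 y *
      structFun θ 1 2 3 y) = 1 := fun y hy => (hF _ (nT y hy)).2
  have nl : ∀ y ∈ V, l y ≠ 0 := fun y hy h0 => by
    have := hl y hy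
    rw [h0] at this
    norm_num at this
  have sm := (sl.mul sl).mul sA
  have nm : ∀ y ∈ V, l y * l y * structFun θ 0 1 2 y ≠ 0 := fun y hy =>
    mul_ne_zero (mul_ne_zero (nl y hy) (nl y hy)) (nA y hy)
  -- The choices a = l, m = l²A, k = -l²B with l⁵A²C = 1 make A' = 1, B' = 0 and C' = 1.
  obtain ⟨θ₁, h₁, e₁⟩ := hθ.exists_change sl ((sl.mul sl).mul sB).neg sm nl nm
  have n₁ : ∀ y ∈ V, structFun θ₁ 0 1 2 y = 1 ∧ structFun θ₁ 0 1 3 y = 0 ∧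
      structFun θ₁ 1 2 3 y = 1 := fun y hy => by
    obtain ⟨a1, a2, a3⟩ := hθ.structFun_change h₁ hy hy
    obtain ⟨b1, b2, b3⟩ := e₁ y hy
    rw [b1, b3] at a1
    rw [b1, b2, b3] at a2
    rw [b1, b3] at a3
    refine ⟨mul_left_cancel₀ (nm y hy) (a1.trans (by ring)),
      mul_left_cancel₀ (nm y hy) (a2.trans (by ring)), a3.trans ?_⟩
    rw [← hl y hy]
    ring
  have s1 := fun i j k => h₁.smoothFun_structFun i j k
  -- The shear parameters solve three linear equations: r = c^1_12 kills c^1_12, q = (c^1_02 -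
  -- c^1_13)/2 equalises those two functions, and p then kills c^0_01 because A = 1 and B = 0.
  have sr := s1 1 1 2
  have sq := ((s1 1 0 2).sub (s1 1 1 3)).mul (smoothFun_const (1 / 2) V)
  have sp := ((s1 0 0 1).add (sq.mul (s1 0 0 2))).add (sr.mul (s1 0 0 3))
  obtain ⟨θ₂, h₂, e20, e21, e₂⟩ := h₁.exists_shear sp sq sr
  refine ⟨V, θ₂, ⟨hx, hA⟩, h₂, fun y hy => ?_⟩
  obtain ⟨-, -, d2, d3, f1, f2, f3, f4⟩ := h₁.structFun_change_of_eq h₂ e20 e21 hy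
  obtain ⟨m1, m2, m3⟩ := n₁ y hy
  obtain ⟨g1, g2, g3⟩ := e₂ y hy
  obtain ⟨a1, a2, a3⟩ := h₁.structFun_change h₂ hy hy
  have hi := h₁.coframe.linearIndependent y hy
  rw [e20 y hy, e21 y hy] at a1 a2
  rw [e20 y hy, e21 y hy] at a3
  simp only [dualFrame_apply hi, m1, m2, m3] at a1 a2 a3
  norm_num at a1 a2 a3
  rw [g1, g2, g3, m1, m2] at f1
  rw [g3, m3] at f2
  rw [g2, m3] at f3 f4
  exact ⟨a1, a2, a3, by rw [f1]; ring, by rw [f2]; ring, by rw [f3, f4]; ring⟩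

end Normal

/-! ### Locally homogeneous structures on compact manifolds -/

section Classification

variable {N : Type u} [TopologicalSpace N] [ChartedSpace E4 N] [IsManifold 𝓘(ℝ, E4) ∞ N]
  {S : LagrangianEngel N}

/-- Pulling back by a local symmetry transports an adapted coframe near `y` to one near any `x` with
matching structure functions. Pointwise facts about these functions thereby spread over the
manifold. -/
theorem LagrangianEngel.IsLocallyHomogeneous.exists_pull (hS : S.IsLocallyHomogeneous)
    {θ : Fin 4 → CovectorField N} {V : Set N} (h : S.AdaptedOn θ V) {y : N} (hy : y ∈ V) (x : N) :
    ∃ (f : N → N) (U : Set N) (θ' : Fin 4 → CovectorField N), x ∈ U ∧ f x = y ∧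
      S.AdaptedOn θ' U ∧ ∀ z ∈ U, f z ∈ V ∧
        ∀ i j k, structFun θ' i j k z = structFun θ i j k (f z) := by
  obtain ⟨f, U, hU, hx, rfl, hf⟩ := hS x y
  have hW : IsOpen (U ∩ f ⁻¹' V) := isOpen_iff_mem_nhds.2 fun z hz =>
    Filter.inter_mem (hU.mem_nhds hz.1)
      ((hf z hz.1).smooth.continuousAt.preimage_mem_nhds (h.coframe.isOpen.mem_nhds hz.2))
  have hf' : ∀ z ∈ U ∩ f ⁻¹' V, PreservesAt S S f z := fun z hz => hf z hz.1
  exact ⟨f, U ∩ f ⁻¹' V, _, ⟨hx, hy⟩, rfl, h.pull hW hf' (fun z hz => hz.2), fun z hz =>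
    ⟨hz.2, h.structFun_pull hW hf' (fun z hz => hz.2) hz⟩⟩

variable [CompactSpace N] [T2Space N] [Nonempty N]

/-- If A vanished in every adapted coframe, B could be scaled to 1, and θ₀ would become a global
1-form α. The products dα ∧ Ω and dα ∧ dα would both have to vanish somewhere, and homogeneity makes
these requirements incompatible. -/
theorem LagrangianEngel.IsLocallyHomogeneous.exists_generic (hS : S.IsLocallyHomogeneous) :
    ∃ U θ x, x ∈ U ∧ S.AdaptedOn θ U ∧ structFun θ 0 1 2 x ≠ 0 := by
  by_contra! hA
  have hex : ∀ x, ∃ U θ, x ∈ U ∧ S.AdaptedOn θ U ∧ ∀ y ∈ U, structFun θ 0 1 3 y = 1 := fun x => by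
    obtain ⟨U, θ, hx, h⟩ := S.exists_adaptedOn x
    have hB : ∀ y ∈ U, structFun θ 0 1 3 y ≠ 0 := fun y hy =>
      (h.d_zero_ne_zero hy).resolve_left fun h0 => h0 (hA U θ y hy h)
    obtain ⟨θ', h', e⟩ := h.exists_change ((h.smoothFun_structFun 0 1 3).inv hB)
      (smoothFun_const 0 U) (smoothFun_const 1 U) (fun y hy => inv_ne_zero (hB y hy))
      (fun _ _ => one_ne_zero)
    refine ⟨U, θ', hx, h', fun y hy => ?_⟩
    obtain ⟨-, a, -⟩ := h.structFun_change h' hy hy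
    obtain ⟨e1, e2, e3⟩ := e y hy
    rw [e1, e2, e3, hA U θ y hy h] at a
    have := inv_mul_cancel₀ (hB y hy)
    linarith
  choose U θ hxU hθ hB using hex
  let α : CovectorField N := fun x => θ x 0 x
  -- With A = 0 and B = B' = 1 the rule mB' = a(kA + mB) gives a = 1, so the normalised θ₀ does not
  -- depend on the coframe.
  have hα : ∀ {V : Set N} {τ : Fin 4 → CovectorField N}, S.AdaptedOn τ V →
      (∀ y ∈ V, structFun τ 0 1 3 y = 1) → ∀ y ∈ V, α y = τ 0 y := fun {V τ} hτ hτB y hy => by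
    obtain ⟨-, n1, -⟩ := hτ.dualFrame_change (hθ y) hy (hxU y)
    obtain ⟨-, a, -⟩ := hτ.structFun_change (hθ y) hy (hxU y)
    rw [hτB y hy, hB y y (hxU y), hA V τ y hy hτ] at a
    have l1 : θ y 0 y (dualFrame τ y 0) = 1 := by
      refine mul_right_cancel₀ n1 ?_
      linarith
    ext v
    change θ y 0 y v = _
    rw [hτ.zero_eq (hθ y) hy (hxU y), l1, one_mul]
  have hαs : α.toForm.SmoothOn Set.univ := Form.smoothOn_of_locally fun x _ =>
    ⟨U x, (hθ x).coframe.isOpen, hxU x, ((hθ x).coframe.smooth 0).congr fun y hy => by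
      simp only [CovectorField.toForm]
      rw [hα (hθ x) (hB x) y hy]⟩
  have hd : ∀ {V : Set N} {τ : Fin 4 → CovectorField N}, S.AdaptedOn τ V →
      (∀ y ∈ V, structFun τ 0 1 3 y = 1) → ∀ y ∈ V, α.d y = (τ 0).d y := fun {V τ} hτ hτB y hy =>
    CovectorField.d_congr hτ.coframe.isOpen (hα hτ hτB) hy
  obtain ⟨x, hx⟩ := exists_d_mul_eq_zero hαs S.symplectic.smooth S.symplectic.closed
  obtain ⟨x', hx'⟩ := exists_d_mul_eq_zero hαs (hαs.d isOpen_univ)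
    (fun x => Form.d_d hαs isOpen_univ trivial)
  -- At `x` the product dα ∧ Ω vanishes, that is, c^0_02 + c^0_13 = 0, while c^0_13 = B = 1.
  have h1 : structFun (θ x) 0 0 2 x = -1 := by
    have hi := (hθ x).coframe.linearIndependent x (hxU x)
    have := hx (dualFrame (θ x) x 0) (dualFrame (θ x) x 1) (dualFrame (θ x) x 2)
      (dualFrame (θ x) x 3)
    rw [hd (hθ x) (hB x) x (hxU x)] at this
    simp only [(hθ x).Ω_apply (hxU x), dualFrame_apply hi] at this
    have hB' : (θ x 0).d x ![dualFrame (θ x) x 1, dualFrame (θ x) x 3] = 1 := hB x x (hxU x)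
    rw [hB'] at this
    simp at this
    change (θ x 0).d x ![dualFrame (θ x) x 0, dualFrame (θ x) x 2] = -1
    linarith
  -- The points `x` and `x'` may differ; a local symmetry carries the value c^0_02 = -1 to `x'`.
  -- There the coefficient of dα ∧ dα is -2c^0_02 c^0_13 = 2, contrary to its vanishing.
  obtain ⟨f, V, τ, hxV, rfl, hτ, hf⟩ := hS.exists_pull (hθ x) (hxU x) x'
  have hτB : ∀ y ∈ V, structFun τ 0 1 3 y = 1 := fun y hy => by
    rw [(hf y hy).2, hB _ _ (hf y hy).1]
  have h2 : structFun τ 0 0 2 x' = -1 := by rw [(hf x' hxV).2, h1]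
  have := hx' (dualFrame τ x' 0) (dualFrame τ x' 1) (dualFrame τ x' 2) (dualFrame τ x' 3)
  change (fun β : Form N 2 => β x' _ * β x' _ - β x' _ * β x' _ + β x' _ * β x' _ + β x' _ * β x' _
    - β x' _ * β x' _ + β x' _ * β x' _ = 0) α.d at this
  simp only [hd hτ hτB x' hxV] at this
  have e02 : (τ 0).d x' ![dualFrame τ x' 0, dualFrame τ x' 2] = -1 := h2
  have e13 : (τ 0).d x' ![dualFrame τ x' 1, dualFrame τ x' 3] = 1 := hτB x' hxV
  have e12 : (τ 0).d x' ![dualFrame τ x' 1, dualFrame τ x' 2] = 0 := hA V τ x' hxV hτ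
  have e23 : (τ 0).d x' ![dualFrame τ x' 2, dualFrame τ x' 3] = 0 :=
    hτ.structFun_zero_two_three hxV
  rw [e02, e13, e12, e23] at this
  norm_num at this

/-- A canonical global coframe with constant structure functions. -/
theorem LagrangianEngel.IsLocallyHomogeneous.exists_isNormalAt (hS : S.IsLocallyHomogeneous) :
    ∃ θ, S.AdaptedOn θ Set.univ ∧ (∀ x, IsNormalAt θ x) ∧
      ∀ i j k x y, structFun θ i j k x = structFun θ i j k y := by
  obtain ⟨U₀, θ₀, x₀, hx₀, h₀, hA⟩ := hS.exists_generic
  have hex : ∀ x, ∃ U θ, x ∈ U ∧ S.AdaptedOn θ U ∧ ∀ y ∈ U, IsNormalAt θ y := fun x => by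
    obtain ⟨f, V, τ, hxV, rfl, hτ, hf⟩ := hS.exists_pull h₀ hx₀ x
    exact hτ.exists_isNormalAt hxV (by rwa [(hf x hxV).2])
  choose U θ hxU hθ hn using hex
  -- By uniqueness of canonical coframes, the diagonal choice agrees near each point with any smooth
  -- local one.
  let Θ : Fin 4 → CovectorField N := fun i x => θ x i x
  have hΘ : ∀ {V : Set N} {τ : Fin 4 → CovectorField N}, S.AdaptedOn τ V →
      (∀ y ∈ V, IsNormalAt τ y) → ∀ y ∈ V, ∀ i, Θ i y = τ i y := fun {V τ} hτ hτn y hy i => by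
    have hW : IsOpen (V ∩ U y) := hτ.coframe.isOpen.inter (hθ y).coframe.isOpen
    exact (hτ.mono hW Set.inter_subset_left).eq_of_isNormalAt
      ((hθ y).mono hW Set.inter_subset_right) (fun z hz => hτn z hz.1) (fun z hz => hn y z hz.2)
      ⟨hy, hxU y⟩ i
  have hsf : ∀ {V : Set N} {τ : Fin 4 → CovectorField N}, S.AdaptedOn τ V →
      (∀ y ∈ V, IsNormalAt τ y) → ∀ y ∈ V, ∀ i j k, structFun Θ i j k y = structFun τ i j k y :=
    fun {V τ} hτ hτn y hy i j k => by
      have h1 : (Θ i).d y = (τ i).d y :=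
        CovectorField.d_congr hτ.coframe.isOpen (fun z hz => hΘ hτ hτn z hz i) hy
      have h2 : dualFrame Θ y = dualFrame τ y := by
        have hi := hτ.coframe.linearIndependent y hy
        have hi' : LinearIndependent ℝ (fun i => Θ i y) := (hθ y).coframe.linearIndependent y (hxU y)
        refine funext fun j => tangent_ext hi fun i => ?_
        rw [dualFrame_apply hi, ← hΘ hτ hτn y hy, dualFrame_apply hi']
      rw [structFun, structFun, h1, h2]
  have hΘa : S.AdaptedOn Θ Set.univ := .of isOpen_univ
    (fun i => Form.smoothOn_of_locally fun x _ => ⟨U x, (hθ x).coframe.isOpen, hxU x,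
      ((hθ x).coframe.smooth i).congr fun y hy => by
        simp only [CovectorField.toForm]
        rw [hΘ (hθ x) (hn x) y hy]⟩)
    (fun x _ v w => (hθ x).Ω_apply (hxU x) v w) (fun x _ => (hθ x).mem_system (hxU x))
    (fun x _ => (hθ x).mem_derived (hxU x))
  have hΘn : ∀ x, IsNormalAt Θ x := fun x => by
    have h := hn x x (hxU x)
    have e := hsf (hθ x) (hn x) x (hxU x)
    exact ⟨(e _ _ _).trans h.c012, (e _ _ _).trans h.c013, (e _ _ _).trans h.c123,
      (e _ _ _).trans h.c001, (e _ _ _).trans h.c112, by rw [e, e, h.c102]⟩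
  refine ⟨Θ, hΘa, hΘn, fun i j k x y => ?_⟩
  -- The pullback of Θ by a local symmetry taking `x` to `y` is again canonical, hence equal to Θ
  -- near `x`, so the structure functions agree at `x` and `y`.
  obtain ⟨f, V, τ, hxV, rfl, hτ, hf⟩ := hS.exists_pull hΘa (Set.mem_univ y) x
  have hτn : ∀ z ∈ V, IsNormalAt τ z := fun z hz => by
    have e := (hf z hz).2
    have h := hΘn (f z)
    exact ⟨(e _ _ _).trans h.c012, (e _ _ _).trans h.c013, (e _ _ _).trans h.c123,
      (e _ _ _).trans h.c001, (e _ _ _).trans h.c112, by rw [e, e, h.c102]⟩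
  rw [hsf hτ hτn x hxV, (hf x hxV).2]

/-- The classification on compact manifolds. -/
theorem LagrangianEngel.IsLocallyHomogeneous.exists_satisfiesStructureEq
    (hS : S.IsLocallyHomogeneous) :
    ∃ b θ, S.AdaptedOn θ Set.univ ∧ SatisfiesStructureEq θ (family 0 b 0) := by
  obtain ⟨θ, h, hn, hc⟩ := hS.exists_isNormalAt
  obtain ⟨x₀⟩ := ‹Nonempty N›
  have : Nonempty N := ⟨x₀⟩
  let c : Fin 4 → Fin 4 → Fin 4 → ℝ := fun i j k => structFun θ i j k x₀
  have hcx : ∀ i j k x, (θ i).d x ![dualFrame θ x j, dualFrame θ x k] = c i j k :=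
    fun i j k x => hc i j k x x₀
  have hi := fun x => h.coframe.linearIndependent x trivial
  -- The coefficient of dθ_i ∧ Ω is the constant -(c^i_02 + c^i_13), and Stokes makes it vanish at
  -- some point.
  have hΩ : ∀ i, c i 0 2 + c i 1 3 = 0 := fun i => by
    obtain ⟨x, hx⟩ := exists_d_mul_eq_zero (h.coframe.smooth i) S.symplectic.smooth
      S.symplectic.closed
    have := hx (dualFrame θ x 0) (dualFrame θ x 1) (dualFrame θ x 2) (dualFrame θ x 3)
    simp only [h.Ω_apply (Set.mem_univ x), dualFrame_apply (hi x), hcx] at this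
    simp at this
    linarith
  -- The same argument applies to dθ_i ∧ dθ_j, whose coefficient is constant.
  have hdd : ∀ i j, c i 0 1 * c j 2 3 - c i 0 2 * c j 1 3 + c i 0 3 * c j 1 2 + c i 1 2 * c j 0 3
      - c i 1 3 * c j 0 2 + c i 2 3 * c j 0 1 = 0 := fun i j => by
    obtain ⟨x, hx⟩ := exists_d_mul_eq_zero (h.coframe.smooth i)
      ((h.coframe.smooth j).d isOpen_univ)
      (fun x => Form.d_d (h.coframe.smooth j) isOpen_univ trivial)
    have := hx (dualFrame θ x 0) (dualFrame θ x 1) (dualFrame θ x 2) (dualFrame θ x 3)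
    rw [← hcx i 0 1 x, ← hcx i 0 2 x, ← hcx i 0 3 x, ← hcx i 1 2 x, ← hcx i 1 3 x, ← hcx i 2 3 x,
      ← hcx j 0 1 x, ← hcx j 0 2 x, ← hcx j 0 3 x, ← hcx j 1 2 x, ← hcx j 1 3 x, ← hcx j 2 3 x]
    exact this
  have hcl : ∀ i j k, (coframeForm θ).d x₀ ![dualFrame θ x₀ i, dualFrame θ x₀ j,
      dualFrame θ x₀ k] = 0 := fun i j k => by
    have : coframeForm θ = S.Ω := funext fun x => (h.symplectic x trivial).symm
    rw [this, S.symplectic.closed]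
    rfl
  simp only [coframeForm_d h.coframe trivial, hcx, dualFrame_apply (hi x₀)] at hcl
  have n := hn x₀
  have a012 : c 0 1 2 = 1 := n.c012
  have a013 : c 0 1 3 = 0 := n.c013
  have a123 : c 1 2 3 = 1 := n.c123
  have a001 : c 0 0 1 = 0 := n.c001
  have a112 : c 1 1 2 = 0 := n.c112
  have a102' : c 1 0 2 = c 1 1 3 := n.c102
  have a023 : c 0 2 3 = 0 := h.structFun_zero_two_three trivial
  have a002 : c 0 0 2 = 0 := by linarith [hΩ 0]
  have a102 : c 1 0 2 = 0 := by linarith [hΩ 1]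
  have a113 : c 1 1 3 = 0 := by linarith [hΩ 1]
  have a003 : c 0 0 3 = 0 := by
    have := hdd 0 0
    rw [a012, a013, a001, a002, a023] at this
    linarith
  -- By now dθ₀ = θ₁ ∧ θ₂, so its product with dθ_i isolates c^i_03. Likewise dθ₁ = θ₂ ∧ θ₃ will
  -- isolate c^i_01.
  have row : ∀ i, c i 0 3 = 0 := fun i => by
    have := hdd 0 i
    rw [a012, a013, a001, a002, a003, a023] at this
    linarith
  have a101 : c 1 0 1 = 0 := by
    have := hdd 1 1
    rw [row, a112, a113, a102, a123] at this
    linarith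
  have row' : ∀ i, c i 0 1 = 0 := fun i => by
    have := hdd 1 i
    rw [row 1, a112, a113, a102, a123, a101] at this
    linarith
  -- In dθ_i ∧ dθ_i only -2c^i_02 c^i_13 remains, which equals 2(c^i_02)² by `hΩ`.
  have sq : ∀ i, c i 0 2 = 0 := fun i => by
    have := hdd i i
    rw [row, row'] at this
    have h1 : c i 1 3 = -c i 0 2 := by linarith [hΩ i]
    rw [h1] at this
    nlinarith
  have sq' : ∀ i, c i 1 3 = 0 := fun i => by linarith [hΩ i, sq i]
  -- The coefficients of dθ₂ and dθ₃ not reached by the products are controlled by dΩ = 0. Only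
  -- c^3_12 escapes, and it becomes the parameter b.
  have a212 : c 2 1 2 = 0 := by
    have := hcl 0 1 2
    simp at this
    linarith [sq 3]
  have a223 : c 2 2 3 = 0 := by
    have := hcl 0 2 3
    simp at this
    linarith
  have a323 : c 3 2 3 = 0 := by
    have := hcl 1 2 3
    simp at this
    linarith
  refine ⟨c 3 1 2, θ, h, fun i x => twoForm_ext fun v w => ?_⟩
  rw [twoForm_apply_frame (hi x) ((θ i).d x) v w]
  simp only [Fin.sum_univ_six, ContinuousAlternatingMap.add_apply,
    ContinuousAlternatingMap.smul_apply, smul_eq_mul, wedge_apply, hcx, pair]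
  fin_cases i <;> simp [family, row, row', sq, sq', a012, a123, a023, a112, a212, a223, a323]

end Classification

/-! ### From the compact quotient back to M. -/

section Quotient

variable {X : Type u} [TopologicalSpace X] [ChartedSpace E4 X] [IsManifold 𝓘(ℝ, E4) ∞ X]
  {Y : Type v} [TopologicalSpace Y] [ChartedSpace E4 Y] [IsManifold 𝓘(ℝ, E4) ∞ Y]

theorem SatisfiesStructureEq.pull {θ : Fin 4 → CovectorField Y} {C : Matrix (Fin 4) (Fin 6) ℝ}
    (h : SatisfiesStructureEq θ C) (hθ : ∀ i, (θ i).toForm.SmoothOn Set.univ) {f : X → Y}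
    (hf : ContMDiff 𝓘(ℝ, E4) 𝓘(ℝ, E4) ∞ f) :
    SatisfiesStructureEq (fun i => (θ i).pull f) C := fun i x => twoForm_ext fun v w => by
  rw [CovectorField.d_pull_apply isOpen_univ (hθ i) hf.contMDiffAt trivial, h.apply]
  simp only [Fin.sum_univ_six, ContinuousAlternatingMap.add_apply,
    ContinuousAlternatingMap.smul_apply, smul_eq_mul, wedge_apply]
  rfl

omit [IsManifold 𝓘(ℝ, E4) ∞ X] in
theorem LagrangianEngel.AdaptedOn.isZeroAdapted {S : LagrangianEngel X}
    {θ : Fin 4 → CovectorField X} (h : S.AdaptedOn θ Set.univ) : S.IsZeroAdapted θ where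
  coframing := ⟨h.coframe.smooth, fun x => h.coframe.linearIndependent x trivial⟩
  symplectic := fun x => h.symplectic x trivial
  system := fun x => by rw [h.system x trivial, image_zero_one]
  derived := fun x => by rw [h.derived x trivial, image_zero]

/-- The quotient is compact and locally homogeneous, so it carries a global coframe of Case 1 with a
= 0. Its pullback along the projection is 0-adapted and satisfies the same equations. -/
theorem LagrangianEngel.IsHomogeneous.exists_isZeroAdapted {S : LagrangianEngel X}
    (hS : S.IsHomogeneous) (hq : S.HasCompactQuotient) :
    ∃ b θ, S.IsZeroAdapted θ ∧ SatisfiesStructureEq θ (family 0 b 0) := by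
  obtain ⟨N, _, _, _, _, _, S', f, hf, hsurj, hp, -⟩ := hq
  rcases isEmpty_or_nonempty X with hX | ⟨⟨x⟩⟩
  -- The empty manifold is treated separately, since the Stokes argument needs a point of the
  -- quotient.
  · exact ⟨0, fun _ x => (hX.false x).elim, ⟨⟨fun _ x => (hX.false x).elim,
      fun x => (hX.false x).elim⟩, fun x => (hX.false x).elim, fun x => (hX.false x).elim,
      fun x => (hX.false x).elim⟩, fun _ x => (hX.false x).elim⟩
  · have : Nonempty N := ⟨f x⟩
    have hp' := fun x => hp.preservesAt hf.contMDiff x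
    obtain ⟨b, θ, h, hθ⟩ := (hS.quotient hf hsurj hp').exists_satisfiesStructureEq
    exact ⟨b, _, (h.pull isOpen_univ (fun x _ => hp' x) fun _ _ => trivial).isZeroAdapted,
      hθ.pull h.coframe.smooth hf.contMDiff⟩

end Quotient

end LagEngel

end

theorem mainTheorem2 :
    (∀ (M : Type u) [TopologicalSpace M] [T2Space M] [SecondCountableTopology M]
      [ChartedSpace E4 M] [IsManifold 𝓘(ℝ, E4) ∞ M] (S : LagEngel.LagrangianEngel M),
      S.IsHomogeneous → S.HasCompactQuotient →
        ∃ (k : Fin 6) (a b : ℝ) (θ : Fin 4 → LagEngel.CovectorField M),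
          S.IsZeroAdapted θ ∧ LagEngel.SatisfiesStructureEq θ (LagEngel.family a b k)) ∧
    (∀ (k : Fin 6) (a b : ℝ),
      LagEngel.IsLieAlgebraStructure (LagEngel.family a b k) ∧
      ∀ (M : Type u) [TopologicalSpace M] [T2Space M] [SecondCountableTopology M]
        [ChartedSpace E4 M] [IsManifold 𝓘(ℝ, E4) ∞ M] (θ : Fin 4 → LagEngel.CovectorField M),
        LagEngel.IsCoframing θ → LagEngel.SatisfiesStructureEq θ (LagEngel.family a b k) →
          ∃ S : LagEngel.LagrangianEngel M, S.IsZeroAdapted θ) := by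
  refine ⟨fun M _ _ _ _ _ S hS hq => ?_, fun k a b =>
    ⟨LagEngel.isLieAlgebraStructure_family k a b, fun M _ _ _ _ _ θ hθ h =>
      LagEngel.exists_isZeroAdapted_family hθ h⟩⟩
  obtain ⟨b, θ, hθ, h⟩ := hS.exists_isZeroAdapted hq
  -- Index 0 is Case 1, and its first parameter a is 0: compactness excludes every other outcome for
  -- the canonical coframe.
  exact ⟨0, 0, b, θ, hθ, h⟩
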